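/- Let $s>1$ and let $\Phi(x)=\phi(|x|)$, $x\in\mathbb R^3\setminus\{0\}$, where $\phi(r)=f(r)r^{-s}$ for $0<r\le 1$ and $\phi(r)=0$ for $r>1$. Here $f\colon[0,1]\to\mathbb R$ is continuous and decreasing (not necessarily strictly), smooth on $(0,1)$ with all derivatives bounded there, and $f(0)>0$, $f(1)=0$. Let $M(v)=(2\pi)^{-3/2}e^{-|v|^2/2}$. For $\varepsilon>0$ put $\Phi_\varepsilon=\varepsilon\Phi$ and $$\mathcal L_\varepsilon\psi(v_1)=\int_{\mathbb R^3}\int_{\{\nu\in S^2:\ \nu\cdot(v_1-v_2)\ge 0\}}\big(\psi(v_{1,\varepsilon}')+\psi(v_{2,\varepsilon}')-\psi(v_1)-\psi(v_2)\big)\,M(v_2)\,(v_1-v_2)\cdot\nu\;d\nu\,dv_2 ,$$ where $v_{i,\varepsilon}'=\lim_{t\to\infty}V_i(t)$ are the outgoing velocities of the scattering problem $\dot X_i=V_i$, $\dot V_1=-\nabla\Phi_\varepsilon(X_1-X_2)$, $\dot V_2=-\nabla\Phi_\varepsilon(X_2-X_1)$, $V_i(0)=v_i$, $X_2(0)-X_1(0)=\nu$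 (the equations for the velocities being understood in integrated form). For a relative speed $w>0$ and an impact parameter $\rho>0$ let $$\theta_s(w,\rho)=\pi-2\int_{r_{\min}}^\infty\frac{\rho\,dr}{r^2\sqrt{1-\rho^2/r^2-4r^{-s}/w^2}}$$ be the deviation angle for the homogeneous potential $|x|^{-s}$, $r_{\min}$ being the zero of the expression under the root. Let $\rho_s(w,\cdot)$ be the inverse function of $\theta_s(w,\cdot)$, and let $\tilde B_s(w,\cos\theta)=w\,\frac{\rho_s(w,\theta)}{\sin\theta}\,\big|\partial_\theta\rho_s(w,\theta)\big|$ be the collision kernel of $|x|^{-s}$. The linearized non-cutoff Boltzmann operator is $$\mathcal L_\infty\psi(v_1)=\int_{\mathbb R^3}\int_{S^2}\big(\psi(v_1')+\psi(v_2')-\psi(v_1)-\psi(v_2)\big)\,M(v_2)\,\tilde B_s(|v_1-v_2|,\cos\theta)\,d\sigma\,dv_2,$$ with $v_{1}'=\frac{v_1+v_2}2+\frac{|v_1-v_2|}2\sigma$, $v_{2}'=\frac{v_1+v_2}2-\frac{|v_1-v_2|}2\sigma$, $\cos\theta=\sigma\cdot\frac{v_1-v_2}{|v_1-v_2|}$.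 The integral over $S^2$ is taken in spherical coordinates around $v_1-v_2$, first over the azimuth and then over $\theta\in(0,\pi)$. Then the outgoing velocities exist and are unique whenever $\nu\cdot(v_1-v_2)>0$. For every $\psi\in C^3_b(\mathbb R^3)$ the integrals that define $\mathcal L_\varepsilon\psi$ and $\mathcal L_\infty\psi$ converge, and $$\lim_{\varepsilon\downarrow 0}\varepsilon^{-2/s}\,\mathcal L_\varepsilon\psi=f(0)^{2/s}\,\mathcal L_\infty\psi ,$$ uniformly with respect to the weight $1+|v_1|^3$, i.e. $\sup_{v_1\in\mathbb R^3}\frac{|\varepsilon^{-2/s}\mathcal L_\varepsilon\psi(v_1)-f(0)^{2/s}\mathcal L_\infty\psi(v_1)|}{1+|v_1|^3}\to 0$; in particular locally uniformly in $v_1$. If $f(0)=1$, the limit is $\mathcal L_\infty\psi$. -/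

import Mathlib

open MeasureTheory Filter Topology
open scoped ContDiff

noncomputable section

namespace GrazingLimit

/-- Velocity and position space, `ℝ³` with the Euclidean norm. -/
abbrev E3 : Type := EuclideanSpace ℝ (Fin 3)

/-- The unit sphere of `ℝ³`. -/
abbrev S2 : Type := Metric.sphere (0 : E3) 1

/-- Surface measure on the unit sphere (total mass `4π`). -/
def surface : Measure S2 := (volume : Measure E3).toSphere

/-- The Maxwellian with unit temperature. -/
def maxwellian (v : E3) : ℝ :=
  Real.exp (-(‖v‖ ^ 2 / 2)) / (2 * Real.pi) ^ (3 / 2 : ℝ)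

/-! ### The interaction potential -/

/-- The assumption on the profile `f`: it is smooth on `(0,1)` with bounded derivatives of every
order, and continuous and decreasing (in the wide sense) up to the end points, with `f 0 > 0` and
`f 1 = 0`. -/
structure IsProfile (f : ℝ → ℝ) : Prop where
  smooth : ContDiffOn ℝ ∞ f (Set.Ioo 0 1)
  bounded : ∀ k : ℕ, ∃ C : ℝ, ∀ r ∈ Set.Ioo (0 : ℝ) 1, |iteratedDeriv k f r| ≤ C
  continuous : ContinuousOn f (Set.Icc 0 1)
  decreasing : AntitoneOn f (Set.Icc 0 1)
  pos_zero : 0 < f 0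
  eq_one : f 1 = 0

/-- The radial function `φ(r) = f(r) / r^s` for `0 < r ≤ 1`, and `0` otherwise. For a profile `f`
and `s ≥ 0` it is continuous and decreasing on `(0,∞)`. -/
def shortRange (f : ℝ → ℝ) (s : ℝ) (r : ℝ) : ℝ :=
  if 0 < r ∧ r ≤ 1 then f r / r ^ s else 0

/-- The pair potential `Φ(x) = φ(|x|)`. -/
def pairPotential (f : ℝ → ℝ) (s : ℝ) (x : E3) : ℝ := shortRange f s ‖x‖

/-! ### The two-particle scattering problem for a potential supported in the unit ball -/

/-- `(X₁, X₂, V₁, V₂)` solves, for times `t ≥ 0`, Newton's equations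
`Xᵢ' = Vᵢ`, `V₁' = -∇Φ(X₁ - X₂)`, `V₂' = -∇Φ(X₂ - X₁)`
with initial velocities `v₁, v₂`, the particles starting at distance one with `ν` the unit vector
that points from the first to the second particle; they are about to collide if
`ν · (v₁ - v₂) > 0`. The equation for the velocities is in integrated form because the force may
jump across `|X₁ - X₂| = 1`. -/
structure IsTrajectory (Φ : E3 → ℝ) (v₁ v₂ ν : E3) (X₁ X₂ V₁ V₂ : ℝ → E3) : Prop where
  init : X₂ 0 - X₁ 0 = ν
  ne : ∀ t, 0 ≤ t → X₁ t ≠ X₂ t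
  pos₁ : ∀ t, 0 ≤ t → HasDerivWithinAt X₁ (V₁ t) (Set.Ici 0) t
  pos₂ : ∀ t, 0 ≤ t → HasDerivWithinAt X₂ (V₂ t) (Set.Ici 0) t
  int₁ : ∀ t, 0 ≤ t → IntervalIntegrable (fun τ => gradient Φ (X₁ τ - X₂ τ)) volume 0 t
  int₂ : ∀ t, 0 ≤ t → IntervalIntegrable (fun τ => gradient Φ (X₂ τ - X₁ τ)) volume 0 t
  vel₁ : ∀ t, 0 ≤ t → V₁ t = v₁ - ∫ τ in (0 : ℝ)..t, gradient Φ (X₁ τ - X₂ τ)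
  vel₂ : ∀ t, 0 ≤ t → V₂ t = v₂ - ∫ τ in (0 : ℝ)..t, gradient Φ (X₂ τ - X₁ τ)

/-- `p = (v₁', v₂')` is a pair of outgoing velocities of the scattering problem. -/
def IsOutgoing (Φ : E3 → ℝ) (v₁ v₂ ν : E3) (p : E3 × E3) : Prop :=
  ∃ X₁ X₂ V₁ V₂ : ℝ → E3, IsTrajectory Φ v₁ v₂ ν X₁ X₂ V₁ V₂ ∧
    Tendsto V₁ atTop (𝓝 p.1) ∧ Tendsto V₂ atTop (𝓝 p.2)

open Classical in
/-- The outgoing velocities `(v₁', v₂')`; by convention the incoming ones, where there is no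
outgoing pair. -/
def outgoing (Φ : E3 → ℝ) (v₁ v₂ ν : E3) : E3 × E3 :=
  if h : ∃ p, IsOutgoing Φ v₁ v₂ ν p then h.choose else (v₁, v₂)

/-! ### The linearized Boltzmann operator of such a potential -/

/-- The integrand of the linearized Boltzmann operator in the representation by the impact vector
`ν`, set to zero outside of the hemisphere `ν · (v₁ - v₂) ≥ 0`. -/
def boltzmannIntegrand (Φ : E3 → ℝ) (ψ : E3 → ℝ) (v₁ v₂ : E3) (ν : S2) : ℝ :=
  if 0 ≤ inner ℝ (v₁ - v₂) (ν : E3) then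
    (ψ (outgoing Φ v₁ v₂ ν).1 + ψ (outgoing Φ v₁ v₂ ν).2 - ψ v₁ - ψ v₂)
      * maxwellian v₂ * inner ℝ (v₁ - v₂) (ν : E3)
  else 0

/-- The linearized Boltzmann operator of the potential `Φ`. -/
def linBoltzmann (Φ : E3 → ℝ) (ψ : E3 → ℝ) (v₁ : E3) : ℝ :=
  ∫ v₂ : E3, ∫ ν : S2, boltzmannIntegrand Φ ψ v₁ v₂ ν ∂surface

/-! ### Collision kernel of a repulsive potential of infinite range -/

/-- `1 - ρ²/r² - 4 φ(r)/w²`: the square of the radial velocity, divided by `w²`, at distance `r`,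
for relative speed `w` and impact parameter `ρ`. -/
def radialFactor (φ : ℝ → ℝ) (w ρ r : ℝ) : ℝ :=
  1 - ρ ^ 2 / r ^ 2 - 4 * φ r / w ^ 2

/-- The minimal distance of the two particles. -/
def minDistance (φ : ℝ → ℝ) (w ρ : ℝ) : ℝ :=
  sInf {r : ℝ | 0 < r ∧ 0 < radialFactor φ w ρ r}

/-- The deviation angle `θ` for relative speed `w` and impact parameter `ρ`. -/
def deviationAngle (φ : ℝ → ℝ) (w ρ : ℝ) : ℝ :=
  Real.pi - 2 * ∫ r in Set.Ioi (minDistance φ w ρ),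
    ρ / (r ^ 2 * Real.sqrt (radialFactor φ w ρ r))

/-- The impact parameter `ρ > 0` that leads to the deviation angle `θ` (inverse function). -/
def impactParameter (φ : ℝ → ℝ) (w θ : ℝ) : ℝ :=
  Function.invFunOn (deviationAngle φ w) (Set.Ioi 0) θ

/-- The collision kernel as a function of the relative speed `w` and of `c = cos θ`:
`w ρ / sin θ * |dρ/dθ|`. -/
def collisionKernel (φ : ℝ → ℝ) (w c : ℝ) : ℝ :=
  w * (impactParameter φ w (Real.arccos c) / Real.sin (Real.arccos c))
    * |deriv (impactParameter φ w) (Real.arccos c)|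

/-- The collision kernel of the homogeneous potential `|x|^{-s}`. -/
def homogeneousKernel (s w c : ℝ) : ℝ := collisionKernel (fun r => 1 / r ^ s) w c

/-! ### The linearized non-cutoff Boltzmann operator -/

/-- The direction of the relative velocity. -/
def direction (v₁ v₂ : E3) : E3 := ‖v₁ - v₂‖⁻¹ • (v₁ - v₂)

open Classical in
/-- A unit vector orthogonal to the unit vector `η`. -/
def frame₁ (η : E3) : E3 :=
  if η 0 = 0 ∧ η 1 = 0 then !₂[1, 0, 0]
  else (Real.sqrt (η 0 ^ 2 + η 1 ^ 2))⁻¹ • !₂[-η 1, η 0, 0]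

/-- The vector `η × frame₁ η`, completing `η`, `frame₁ η` to an orthonormal basis. -/
def frame₂ (η : E3) : E3 :=
  !₂[η 1 * frame₁ η 2 - η 2 * frame₁ η 1,
     η 2 * frame₁ η 0 - η 0 * frame₁ η 2,
     η 0 * frame₁ η 1 - η 1 * frame₁ η 0]

/-- The point of the unit sphere with polar angle `θ` and azimuth `ϕ` with respect to the axis
`η`. -/
def sphericalPoint (η : E3) (θ ϕ : ℝ) : E3 :=
  Real.cos θ • η + Real.sin θ • (Real.cos ϕ • frame₁ η + Real.sin ϕ • frame₂ η)

/-- `ψ(v₁') + ψ(v₂') - ψ(v₁) - ψ(v₂)` for the elastic collision rule with parameter `σ`. -/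
def collisionDifference (ψ : E3 → ℝ) (v₁ v₂ σ : E3) : ℝ :=
  ψ ((1 / 2 : ℝ) • (v₁ + v₂) + (‖v₁ - v₂‖ / 2) • σ)
    + ψ ((1 / 2 : ℝ) • (v₁ + v₂) - (‖v₁ - v₂‖ / 2) • σ) - ψ v₁ - ψ v₂

/-- The integral of the collision difference over the circle of all `σ` at deviation angle `θ`,
weighted with the Maxwellian, the kernel of `|x|^{-s}` and the surface density `sin θ`. -/
def angularIntegrand (s : ℝ) (ψ : E3 → ℝ) (v₁ v₂ : E3) (θ : ℝ) : ℝ :=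
  (∫ ϕ in (0 : ℝ)..(2 * Real.pi),
      collisionDifference ψ v₁ v₂ (sphericalPoint (direction v₁ v₂) θ ϕ))
    * maxwellian v₂ * homogeneousKernel s ‖v₁ - v₂‖ (Real.cos θ) * Real.sin θ

/-- The `σ`-integral over the unit sphere, in spherical coordinates around the relative velocity,
`dσ = sin θ dϕ dθ`. The kernel is not integrable at `θ = 0`; as usual for kernels without cutoff,
the azimuthal integral is taken first. -/
def sphereIntegral (s : ℝ) (ψ : E3 → ℝ) (v₁ v₂ : E3) : ℝ :=
  ∫ θ in Set.Ioo 0 Real.pi, angularIntegrand s ψ v₁ v₂ θ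

/-- The linearized non-cutoff Boltzmann operator of the potential `|x|^{-s}`. -/
def nonCutoff (s : ℝ) (ψ : E3 → ℝ) (v₁ : E3) : ℝ :=
  ∫ v₂ : E3, sphereIntegral s ψ v₁ v₂

/-- Functions of class `C³` that are bounded with their derivatives up to order three. -/
def IsC3b (ψ : E3 → ℝ) : Prop :=
  ContDiff ℝ 3 ψ ∧ ∀ k : ℕ, k ≤ 3 → ∃ C : ℝ, ∀ v : E3, ‖iteratedFDeriv ℝ k ψ v‖ ≤ C

end GrazingLimit

end

open scoped Pointwise

noncomputable section

namespace GrazingLimit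

/-! ### Radial motion in a repulsive potential -/

/-! In relative coordinates a collision is the motion of one point in a central field with energy
`|V|² + 4εφ(|X|)`. The outgoing relative velocity is the incoming one turned by an angle θ that
depends only on the relative speed w and the impact parameter ρ. In spherical coordinates around `v₁
- v₂` the integral over the hemisphere becomes M(v₂) w ∫ ρ A(θ(w,ρ)) dρ, where A is
`azimuthIntegral`. The non-cutoff operator takes the same form once its θ-integral is pulled back
along ρ ↦ θ, so only the deflection functions have to be compared.

Put κ = ε/w² and ρ = κ^{1/s} b. The normalized potential becomes 4κφ(κ^{1/s} r), which tends to
4f(0)r^{-s} as κ → 0, and ρ dρ yields the factor ε^{2/s} w^{-4/s}. After division by ε^{2/s} both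
operators are integrals of M w^{1-4/s} ∫ b A(θ(b)) db, and the limiting deflection no longer depends
on w (`boltzmann_sphere_eq`, `sphereIntegral_eq`).

Three estimates carry the limit. The substitution u = r_min/r writes the deflection as an integral
over (0,1) with the majorant 1/√(1-u²). This gives continuity under pointwise convergence of the
potentials (`tendsto_deflection`) and the decay θ ≤ C b^{-s} (`deflection_le`), uniformly in κ
because all scaled potentials are `IsRepulsive` with one constant. Next, opposite azimuths cancel to
first order, so |A(θ)| ≤ C w² θ² (`abs_azimuthIntegral_le`). The integrand is then bounded by a
multiple of b min(1, b^{-2s}), which is integrable for s > 1, and dominated convergence gives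
`tendsto_meanGap`. Finally, κ is not small where w is small. There the mean gap is merely bounded,
but the remaining weight w^{3-4/s} ≤ w^{-1} + w³ is integrable near the origin of ℝ³, so small
speeds contribute little. The term w³ is the source of the weight 1 + |v₁|³.

The mechanics rests on conservation of energy and angular momentum. They determine the outgoing
velocities of every solution, which gives uniqueness without a uniqueness theorem for the
differential equation. Existence comes from the Picard–Lindelöf theorem for a force that is modified
near the origin, where the energy does not permit the particles to come. -/

/-- A nonnegative continuous decreasing function on `(0,∞)` that is `O(r^{-s})`, together with a
Lipschitz bound that is uniform on the logarithmic scale. -/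
structure IsRepulsive (C s : ℝ) (Ψ : ℝ → ℝ) : Prop where
  nonneg : ∀ r, 0 < r → 0 ≤ Ψ r
  anti : AntitoneOn Ψ (Set.Ioi 0)
  cont : ContinuousOn Ψ (Set.Ioi 0)
  le : ∀ r, 0 < r → Ψ r ≤ C * r ^ (-s)
  sub_le : ∀ r u, 0 < r → 0 < u → u < 1 → Ψ r - Ψ (r / u) ≤ C * r ^ (-s) * (1 - u)

/-- The square of the radial velocity at unit incoming speed, for the potential energy `Ψ` in
units of the kinetic energy. -/
def radial (Ψ : ℝ → ℝ) (ρ r : ℝ) : ℝ := 1 - ρ ^ 2 / r ^ 2 - Ψ r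

/-- The turning point of the radial motion. -/
def turning (Ψ : ℝ → ℝ) (ρ : ℝ) : ℝ := sInf {r : ℝ | 0 < r ∧ 0 < radial Ψ ρ r}

/-- The deflection angle, as a function of the normalized potential and the impact parameter. -/
def deflection (Ψ : ℝ → ℝ) (ρ : ℝ) : ℝ :=
  Real.pi - 2 * ∫ r in Set.Ioi (turning Ψ ρ), ρ / (r ^ 2 * Real.sqrt (radial Ψ ρ r))

theorem deviationAngle_eq_deflection (φ : ℝ → ℝ) (w ρ : ℝ) :
    deviationAngle φ w ρ = deflection (fun r => 4 * φ r / w ^ 2) ρ := rfl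

section Radial

variable {C s ρ : ℝ} {Ψ : ℝ → ℝ}

theorem IsRepulsive.const_nonneg (h : IsRepulsive C s Ψ) : 0 ≤ C := by
  have h1 := h.nonneg 1 one_pos
  have h2 := h.le 1 one_pos
  simp at h2
  linarith

theorem radial_strictMonoOn (h : AntitoneOn Ψ (Set.Ioi 0)) (hρ : 0 < ρ) :
    StrictMonoOn (radial Ψ ρ) (Set.Ioi 0) := by
  intro a ha b hb hab
  have ha' : (0 : ℝ) < a := ha
  have h1 : Ψ b ≤ Ψ a := h ha hb hab.le
  have h2 : ρ ^ 2 / b ^ 2 < ρ ^ 2 / a ^ 2 := by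
    apply div_lt_div_of_pos_left (by positivity) (by positivity)
    exact pow_lt_pow_left₀ hab ha'.le (by norm_num)
  simp only [radial]
  linarith

/-- By strict monotonicity the set in the definition of `turning` is the open half-line above any
zero. Turning points are always identified by exhibiting a zero. -/
theorem turning_eq_of_radial_eq_zero (h : AntitoneOn Ψ (Set.Ioi 0)) (hρ : 0 < ρ) {r : ℝ}
    (hr : 0 < r) (h0 : radial Ψ ρ r = 0) : turning Ψ ρ = r := by
  have hm := radial_strictMonoOn h hρ
  have : {x : ℝ | 0 < x ∧ 0 < radial Ψ ρ x} = Set.Ioi r := by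
    ext x
    simp only [Set.mem_ofPred_eq, Set.mem_Ioi]
    constructor
    · rintro ⟨hx, hx'⟩
      rw [← h0] at hx'
      exact (hm.lt_iff_lt hr hx).1 hx'
    · intro hx
      refine ⟨hr.trans hx, ?_⟩
      rw [← h0]
      exact (hm.lt_iff_lt hr (hr.trans hx)).2 hx
  rw [turning, this, csInf_Ioi]

theorem radial_continuousOn (h : ContinuousOn Ψ (Set.Ioi 0)) :
    ContinuousOn (radial Ψ ρ) (Set.Ioi 0) := by
  have : ∀ x ∈ Set.Ioi (0 : ℝ), x ^ 2 ≠ 0 := fun x hx => pow_ne_zero _ (ne_of_gt hx)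
  unfold radial
  fun_prop (disch := assumption)

theorem exists_radial_eq_zero (hs : 0 < s) (h : IsRepulsive C s Ψ) (hρ : 0 < ρ) :
    ∃ r, ρ ≤ r ∧ radial Ψ ρ r = 0 := by
  have hlim : Tendsto (fun r : ℝ => 1 - ρ ^ 2 / r ^ 2 - C * r ^ (-s)) atTop (𝓝 (1 - 0 - C * 0)) := by
    refine (tendsto_const_nhds.sub ?_).sub (tendsto_const_nhds.mul (tendsto_rpow_neg_atTop hs))
    exact tendsto_const_nhds.div_atTop (tendsto_pow_atTop (by norm_num))
  have hev : ∀ᶠ r : ℝ in atTop, 0 < 1 - ρ ^ 2 / r ^ 2 - C * r ^ (-s) :=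
    hlim.eventually (lt_mem_nhds (by norm_num))
  obtain ⟨R, hR, hRρ⟩ := (hev.and (eventually_ge_atTop ρ)).exists
  have hR0 : 0 < R := hρ.trans_le hRρ
  have hcont : ContinuousOn (radial Ψ ρ) (Set.Icc ρ R) :=
    (radial_continuousOn h.cont).mono fun x hx => hρ.trans_le hx.1
  have h1 : radial Ψ ρ ρ ≤ 0 := by
    have := h.nonneg ρ hρ
    have h2 : ρ ^ 2 / ρ ^ 2 = 1 := div_self (by positivity)
    simp only [radial]
    linarith
  have h2 : 0 ≤ radial Ψ ρ R := by
    have := h.le R hR0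
    simp only [radial]
    linarith
  obtain ⟨r, hr, hr0⟩ := intermediate_value_Icc hRρ hcont ⟨h1, h2⟩
  exact ⟨r, hr.1, hr0⟩

theorem le_turning (hs : 0 < s) (h : IsRepulsive C s Ψ) (hρ : 0 < ρ) : ρ ≤ turning Ψ ρ := by
  obtain ⟨r, hr, h0⟩ := exists_radial_eq_zero hs h hρ
  rwa [turning_eq_of_radial_eq_zero h.anti hρ (hρ.trans_le hr) h0]

theorem radial_turning (hs : 0 < s) (h : IsRepulsive C s Ψ) (hρ : 0 < ρ) :
    radial Ψ ρ (turning Ψ ρ) = 0 := by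
  obtain ⟨r, hr, h0⟩ := exists_radial_eq_zero hs h hρ
  rwa [turning_eq_of_radial_eq_zero h.anti hρ (hρ.trans_le hr) h0]

theorem turning_pos (hs : 0 < s) (h : IsRepulsive C s Ψ) (hρ : 0 < ρ) : 0 < turning Ψ ρ :=
  hρ.trans_le (le_turning hs h hρ)

/-- The excess that the potential adds to `1 - u²` after the substitution `u = r_min / r`. -/
def excess (Ψ : ℝ → ℝ) (ρ u : ℝ) : ℝ :=
  (Ψ (turning Ψ ρ) - Ψ (turning Ψ ρ / u)) * (turning Ψ ρ / ρ) ^ 2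

theorem excess_nonneg (hs : 0 < s) (h : IsRepulsive C s Ψ) (hρ : 0 < ρ) {u : ℝ}
    (hu : u ∈ Set.Ioo (0 : ℝ) 1) : 0 ≤ excess Ψ ρ u := by
  have ht := turning_pos hs h hρ
  have : Ψ (turning Ψ ρ / u) ≤ Ψ (turning Ψ ρ) :=
    h.anti ht (div_pos ht hu.1) ((le_div_iff₀ hu.1).2 (by nlinarith [hu.2]))
  exact mul_nonneg (by linarith) (by positivity)

/-- The equation at the turning point, Ψ(m) = 1 - ρ²/m², eliminates the constant 1. What is left has
the common factor (ρ/m)². -/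
theorem radial_turning_div (hs : 0 < s) (h : IsRepulsive C s Ψ) (hρ : 0 < ρ) {u : ℝ}
    (hu : u ∈ Set.Ioo (0 : ℝ) 1) :
    radial Ψ ρ (turning Ψ ρ / u) = (ρ / turning Ψ ρ) ^ 2 * (1 - u ^ 2 + excess Ψ ρ u) := by
  have ht := turning_pos hs h hρ
  have h0 := radial_turning hs h hρ
  have hu0 := hu.1
  simp only [radial, excess] at h0 ⊢
  set m := turning Ψ ρ
  have : Ψ (m / u) = Ψ m - (Ψ m - Ψ (m / u)) := by ring
  generalize Ψ (m / u) = y at *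
  have hy : Ψ m = 1 - ρ ^ 2 / m ^ 2 := by linarith
  rw [hy]
  field_simp
  ring

/-- The substitution u = r_min/r replaces the moving, unbounded range of integration by (0,1). The
singularity then sits at u = 1 for every potential and is dominated by that of free motion. -/
theorem deflection_eq (hs : 0 < s) (h : IsRepulsive C s Ψ) (hρ : 0 < ρ) :
    deflection Ψ ρ =
      Real.pi - 2 * ∫ u in Set.Ioo (0 : ℝ) 1, 1 / Real.sqrt (1 - u ^ 2 + excess Ψ ρ u) := by
  have ht := turning_pos hs h hρ
  have himg : (fun u => turning Ψ ρ / u) '' Set.Ioo (0 : ℝ) 1 = Set.Ioi (turning Ψ ρ) := by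
    ext r
    simp only [Set.mem_image, Set.mem_Ioi, Set.mem_Ioo]
    constructor
    · rintro ⟨u, hu, rfl⟩
      rw [lt_div_iff₀ hu.1]
      nlinarith
    · intro hr
      have hr0 := ht.trans hr
      refine ⟨turning Ψ ρ / r, ⟨by positivity, (div_lt_one hr0).2 hr⟩, ?_⟩
      field_simp
  have hinj : Set.InjOn (fun u => turning Ψ ρ / u) (Set.Ioo (0 : ℝ) 1) := by
    intro a ha b hb hab
    have h1 := ha.1
    have h2 := hb.1
    simp only at hab
    field_simp at hab
    exact hab.symm
  have hder : ∀ u ∈ Set.Ioo (0 : ℝ) 1,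
      HasDerivWithinAt (fun u => turning Ψ ρ / u) (-turning Ψ ρ / u ^ 2) (Set.Ioo (0 : ℝ) 1) u := by
    intro u hu
    have := ((hasDerivAt_inv hu.1.ne').const_mul (turning Ψ ρ)).hasDerivWithinAt
      (s := Set.Ioo (0 : ℝ) 1)
    simp only [div_eq_mul_inv]
    exact this.congr_deriv (by ring)
  rw [deflection, ← himg, integral_image_eq_integral_abs_deriv_smul measurableSet_Ioo hder hinj]
  congr 2
  refine setIntegral_congr_fun measurableSet_Ioo fun u hu => ?_
  have hu0 := hu.1
  have hq := excess_nonneg hs h hρ hu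
  have hA : 0 < 1 - u ^ 2 + excess Ψ ρ u := by nlinarith [hu.2]
  have hsq : 0 < Real.sqrt (1 - u ^ 2 + excess Ψ ρ u) := Real.sqrt_pos.2 hA
  simp only [smul_eq_mul]
  rw [radial_turning_div hs h hρ hu, Real.sqrt_mul (by positivity), Real.sqrt_sq (by positivity),
    abs_div, abs_neg, abs_of_pos ht, abs_of_pos (by positivity)]
  field_simp

theorem integrableOn_one_div_sqrt_one_sub_sq :
    IntegrableOn (fun u : ℝ => 1 / Real.sqrt (1 - u ^ 2)) (Set.Ioo 0 1) := by
  have : IntegrableOn (fun u : ℝ => 1 / Real.sqrt (1 - u ^ 2)) (Set.Ioc 0 1) :=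
    intervalIntegral.integrableOn_deriv_of_nonneg Real.continuous_arcsin.continuousOn
      (fun x hx => Real.hasDerivAt_arcsin (by linarith [hx.1]) (by linarith [hx.2]))
      (fun x _ => by positivity)
  exact this.mono_set Set.Ioo_subset_Ioc_self

theorem integral_one_div_sqrt_one_sub_sq :
    ∫ u in Set.Ioo (0 : ℝ) 1, 1 / Real.sqrt (1 - u ^ 2) = Real.pi / 2 := by
  rw [← integral_Ioc_eq_integral_Ioo, ← intervalIntegral.integral_of_le zero_le_one,
    intervalIntegral.integral_eq_sub_of_hasDerivAt_of_le zero_le_one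
      Real.continuous_arcsin.continuousOn
      (fun x hx => Real.hasDerivAt_arcsin (by linarith [hx.1]) (by linarith [hx.2]))]
  · simp
  · rw [intervalIntegrable_iff_integrableOn_Ioc_of_le zero_le_one]
    exact (integrableOn_Ioc_iff_integrableOn_Ioo).2 integrableOn_one_div_sqrt_one_sub_sq

theorem excess_continuousOn (hs : 0 < s) (h : IsRepulsive C s Ψ) (hρ : 0 < ρ) :
    ContinuousOn (excess Ψ ρ) (Set.Ioo 0 1) := by
  have ht := turning_pos hs h hρ
  unfold excess
  refine (continuousOn_const.sub (h.cont.comp ?_ ?_)).mul continuousOn_const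
  · exact continuousOn_const.div continuousOn_id fun x hx => hx.1.ne'
  · exact fun x hx => div_pos ht hx.1

theorem aestronglyMeasurable_inv_sqrt_excess (hs : 0 < s) (h : IsRepulsive C s Ψ) (hρ : 0 < ρ) :
    AEStronglyMeasurable (fun u => 1 / Real.sqrt (1 - u ^ 2 + excess Ψ ρ u))
      (volume.restrict (Set.Ioo 0 1)) := by
  refine ContinuousOn.aestronglyMeasurable ?_ measurableSet_Ioo
  refine continuousOn_const.div (Real.continuous_sqrt.comp_continuousOn
    ((by fun_prop : Continuous fun u : ℝ => 1 - u ^ 2).continuousOn.add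
      (excess_continuousOn hs h hρ))) fun u hu => ?_
  have hq := excess_nonneg hs h hρ hu
  exact (Real.sqrt_pos.2 (by nlinarith [hu.1, hu.2])).ne'

theorem inv_sqrt_excess_le (hs : 0 < s) (h : IsRepulsive C s Ψ) (hρ : 0 < ρ) {u : ℝ}
    (hu : u ∈ Set.Ioo (0 : ℝ) 1) :
    1 / Real.sqrt (1 - u ^ 2 + excess Ψ ρ u) ≤ 1 / Real.sqrt (1 - u ^ 2) := by
  have hq := excess_nonneg hs h hρ hu
  apply one_div_le_one_div_of_le (Real.sqrt_pos.2 (by nlinarith [hu.1, hu.2]))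
  exact Real.sqrt_le_sqrt (by linarith)

theorem integrableOn_inv_sqrt_excess (hs : 0 < s) (h : IsRepulsive C s Ψ) (hρ : 0 < ρ) :
    IntegrableOn (fun u => 1 / Real.sqrt (1 - u ^ 2 + excess Ψ ρ u)) (Set.Ioo 0 1) := by
  refine Integrable.mono' integrableOn_one_div_sqrt_one_sub_sq
    (aestronglyMeasurable_inv_sqrt_excess hs h hρ) ?_
  refine (ae_restrict_iff' measurableSet_Ioo).2 (ae_of_all _ fun u hu => ?_)
  rw [Real.norm_of_nonneg (by positivity)]
  exact inv_sqrt_excess_le hs h hρ hu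

/-- Free motion satisfies 2∫ 1/√(1-u²) = π, so the constant can be absorbed and the deflection is
the integral of a nonnegative difference. Sign and decay are read off from this form. -/
theorem deflection_eq_integral_sub (hs : 0 < s) (h : IsRepulsive C s Ψ) (hρ : 0 < ρ) :
    deflection Ψ ρ = 2 * ∫ u in Set.Ioo (0 : ℝ) 1,
      (1 / Real.sqrt (1 - u ^ 2) - 1 / Real.sqrt (1 - u ^ 2 + excess Ψ ρ u)) := by
  rw [deflection_eq hs h hρ, integral_sub integrableOn_one_div_sqrt_one_sub_sq
    (integrableOn_inv_sqrt_excess hs h hρ), integral_one_div_sqrt_one_sub_sq]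
  ring

theorem deflection_nonneg (hs : 0 < s) (h : IsRepulsive C s Ψ) (hρ : 0 < ρ) :
    0 ≤ deflection Ψ ρ := by
  rw [deflection_eq_integral_sub hs h hρ]
  refine mul_nonneg zero_le_two (setIntegral_nonneg measurableSet_Ioo fun u hu => ?_)
  linarith [inv_sqrt_excess_le hs h hρ hu]

theorem deflection_le_pi (hs : 0 < s) (h : IsRepulsive C s Ψ) (hρ : 0 < ρ) :
    deflection Ψ ρ ≤ Real.pi := by
  rw [deflection_eq hs h hρ]
  have : 0 ≤ ∫ u in Set.Ioo (0 : ℝ) 1, 1 / Real.sqrt (1 - u ^ 2 + excess Ψ ρ u) :=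
    setIntegral_nonneg measurableSet_Ioo fun u hu => by positivity
  linarith

/-- The tangent line of the convex function x^{-1/2} at A lies below its graph. With square roots a
and b the two sides differ by (b-a)²(b+2a)/(2a³b). -/
theorem one_div_sqrt_sub_le {A q : ℝ} (hA : 0 < A) (hq : 0 ≤ q) :
    1 / Real.sqrt A - 1 / Real.sqrt (A + q) ≤ q / (2 * A) * (1 / Real.sqrt A) := by
  have hB : 0 < A + q := by linarith
  set a := Real.sqrt A with ha
  set b := Real.sqrt (A + q) with hb
  have ha0 : 0 < a := Real.sqrt_pos.2 hA
  have hb0 : 0 < b := Real.sqrt_pos.2 hB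
  have ha2 : A = a ^ 2 := (Real.sq_sqrt hA.le).symm
  have hb2 : q = b ^ 2 - a ^ 2 := by rw [hb, Real.sq_sqrt hB.le, ← ha2]; ring
  have hab : a ≤ b := Real.sqrt_le_sqrt (by linarith)
  rw [hb2, ha2]
  have : (b ^ 2 - a ^ 2) / (2 * a ^ 2) * (1 / a) - (1 / a - 1 / b)
      = (b - a) ^ 2 * (b + 2 * a) / (2 * a ^ 3 * b) := by
    field_simp
    ring
  have h2 : 0 ≤ (b - a) ^ 2 * (b + 2 * a) / (2 * a ^ 3 * b) := by positivity
  linarith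

/-- The factor 1 - u in `sub_le` compensates the extra 1/(1-u²) of the tangent line bound, so that a
multiple of the integrable 1/√(1-u²) remains. -/
theorem deflection_le (hs : 0 < s) (h : IsRepulsive C s Ψ) (hρ : 0 < ρ) :
    deflection Ψ ρ ≤ 2 * Real.pi * C * ρ ^ (-s) := by
  have hpi := Real.pi_pos
  have ht := turning_pos hs h hρ
  have hC := h.const_nonneg
  have hle := le_turning hs h hρ
  have h0 := radial_turning hs h hρ
  have hrs : turning Ψ ρ ^ (-s) ≤ ρ ^ (-s) :=
    Real.rpow_le_rpow_of_nonpos hρ hle (by linarith)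
  have hρs : 0 < ρ ^ (-s) := Real.rpow_pos_of_pos hρ _
  have hΨ := h.le _ ht
  -- Either the centrifugal part at the turning point is at least 1/2, and then (m/ρ)² ≤ 2, or the
  -- potential exceeds 1/2 there. In the second case C ρ^{-s} ≥ 1/2 and the trivial bound π
  -- suffices.
  rcases le_or_gt (1 / 2) ((ρ / turning Ψ ρ) ^ 2) with hp | hp
  · have hp' : (turning Ψ ρ / ρ) ^ 2 ≤ 2 := by
      have : (turning Ψ ρ / ρ) ^ 2 = 1 / ((ρ / turning Ψ ρ) ^ 2) := by field_simp
      rw [this, div_le_iff₀ (by positivity)]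
      linarith
    have hint : ∫ u in Set.Ioo (0 : ℝ) 1,
        (1 / Real.sqrt (1 - u ^ 2) - 1 / Real.sqrt (1 - u ^ 2 + excess Ψ ρ u)) ≤
        ∫ u in Set.Ioo (0 : ℝ) 1, (C * ρ ^ (-s)) * (1 / Real.sqrt (1 - u ^ 2)) := by
      refine setIntegral_mono_on (integrableOn_one_div_sqrt_one_sub_sq.sub
        (integrableOn_inv_sqrt_excess hs h hρ))
        (integrableOn_one_div_sqrt_one_sub_sq.const_mul _) measurableSet_Ioo fun u hu => ?_
      have hA : 0 < 1 - u ^ 2 := by nlinarith [hu.1, hu.2]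
      have hq := excess_nonneg hs h hρ hu
      refine (one_div_sqrt_sub_le hA hq).trans ?_
      refine mul_le_mul_of_nonneg_right ?_ (by positivity)
      rw [div_le_iff₀ (by positivity)]
      have h1 := h.sub_le _ u ht hu.1 hu.2
      have h1u : 0 < 1 - u := by linarith [hu.2]
      have h2 : C * turning Ψ ρ ^ (-s) * (1 - u) ≤ C * ρ ^ (-s) * (1 - u) := by gcongr
      have h3 : excess Ψ ρ u ≤ C * ρ ^ (-s) * (1 - u) * 2 := by
        unfold excess
        calc _ ≤ (C * ρ ^ (-s) * (1 - u)) * (turning Ψ ρ / ρ) ^ 2 := by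
              gcongr; linarith
          _ ≤ _ := by gcongr
      have h4 : 0 ≤ C * ρ ^ (-s) := by positivity
      nlinarith [mul_nonneg (mul_nonneg h4 hu.1.le) h1u.le]
    rw [integral_const_mul, integral_one_div_sqrt_one_sub_sq] at hint
    rw [deflection_eq_integral_sub hs h hρ]
    have h4 : 0 ≤ C * ρ ^ (-s) * Real.pi := by positivity
    nlinarith
  · have h1 : 1 / 2 < Ψ (turning Ψ ρ) := by
      rw [radial, ← div_pow] at h0
      linarith
    have h2 : C * turning Ψ ρ ^ (-s) ≤ C * ρ ^ (-s) := by gcongr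
    have h3 : 1 / 2 ≤ C * ρ ^ (-s) := by linarith
    have := deflection_le_pi hs h hρ
    nlinarith

/-! ### Scaling and continuity of the deflection angle -/

theorem turning_scale (hs : 0 < s) (h : IsRepulsive C s Ψ) (hρ : 0 < ρ) {l : ℝ} (hl : 0 < l)
    (h' : AntitoneOn (fun r => Ψ (l * r)) (Set.Ioi 0)) :
    turning (fun r => Ψ (l * r)) ρ = turning Ψ (l * ρ) / l := by
  have hlρ : 0 < l * ρ := by positivity
  have ht := turning_pos hs h hlρ
  have h0 := radial_turning hs h hlρ
  refine turning_eq_of_radial_eq_zero h' hρ (by positivity) ?_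
  rw [← h0]
  simp only [radial]
  rw [mul_div_cancel₀ _ hl.ne']
  field_simp

theorem IsRepulsive.scale (h : IsRepulsive C s Ψ) {l : ℝ} (hl : 0 < l) :
    IsRepulsive (C * l ^ (-s)) s (fun r => Ψ (l * r)) where
  nonneg r hr := h.nonneg _ (by positivity)
  anti a ha b hb hab := h.anti (mul_pos hl ha) (mul_pos hl hb) (by gcongr)
  cont := h.cont.comp (by fun_prop) fun x hx => mul_pos hl hx
  le r hr := by
    refine (h.le _ (by positivity)).trans_eq ?_
    rw [Real.mul_rpow hl.le hr.le]
    ring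
  sub_le r u hr hu hu1 := by
    have := h.sub_le (l * r) u (by positivity) hu hu1
    rw [Real.mul_rpow hl.le hr.le] at this
    rw [← mul_div_assoc]
    linarith

/-- A dilation moves the turning point and the impact parameter by the same factor and leaves the
excess unchanged. -/
theorem deflection_scale (hs : 0 < s) (h : IsRepulsive C s Ψ) (hρ : 0 < ρ) {l : ℝ} (hl : 0 < l) :
    deflection (fun r => Ψ (l * r)) ρ = deflection Ψ (l * ρ) := by
  have h' := h.scale hl
  rw [deflection_eq hs h' hρ, deflection_eq hs h (by positivity)]
  congr 2
  refine setIntegral_congr_fun measurableSet_Ioo fun u hu => ?_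
  simp only [excess, turning_scale hs h hρ hl h'.anti]
  have h1 : l * (turning Ψ (l * ρ) / l) = turning Ψ (l * ρ) := mul_div_cancel₀ _ hl.ne'
  have h2 : l * (turning Ψ (l * ρ) / l / u) = turning Ψ (l * ρ) / u := by
    rw [← mul_div_assoc, h1]
  have h3 : turning Ψ (l * ρ) / l / ρ = turning Ψ (l * ρ) / (l * ρ) := div_div _ _ _
  rw [h1, h2, h3]

theorem deflection_congr {Ψ₁ Ψ₂ : ℝ → ℝ} (h : ∀ r, 0 < r → Ψ₁ r = Ψ₂ r) (ρ : ℝ) :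
    deflection Ψ₁ ρ = deflection Ψ₂ ρ := by
  have h1 : turning Ψ₁ ρ = turning Ψ₂ ρ := by
    unfold turning
    congr 1
    ext r
    simp only [Set.mem_ofPred_eq, radial]
    exact and_congr_right fun hr => by rw [h r hr]
  have h0 : 0 ≤ turning Ψ₂ ρ := Real.sInf_nonneg fun x hx => hx.1.le
  unfold deflection
  rw [h1]
  congr 2
  refine setIntegral_congr_fun measurableSet_Ioi fun r hr => ?_
  simp only [radial, h r (h0.trans_lt hr)]

/-- In the integral for the deflection angle the range of integration may be replaced by all
`r > 0`, as the integrand vanishes (by convention) below the turning point. -/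
theorem deflection_eq_integral_Ioi_zero (hs : 0 < s) (h : IsRepulsive C s Ψ) (hρ : 0 < ρ) :
    deflection Ψ ρ =
      Real.pi - 2 * ∫ r in Set.Ioi 0, ρ / (r ^ 2 * Real.sqrt (radial Ψ ρ r)) := by
  have ht := turning_pos hs h hρ
  unfold deflection
  congr 2
  refine (setIntegral_eq_of_subset_of_forall_sdiff_eq_zero measurableSet_Ioi
    (Set.Ioi_subset_Ioi ht.le) fun r hr => ?_).symm
  have hr0 : 0 < r := hr.1
  have hr1 : r ≤ turning Ψ ρ := not_lt.1 hr.2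
  have : radial Ψ ρ r ≤ 0 := by
    rw [← radial_turning hs h hρ]
    exact (radial_strictMonoOn h.anti hρ).monotoneOn hr0 ht hr1
  rw [Real.sqrt_eq_zero_of_nonpos this]
  simp

/-- The particles never feel the force: the turning point is ρ itself and the excess vanishes. This
discards the impact parameters beyond the range of the potential. -/
theorem deflection_eq_zero (hs : 0 < s) (h : IsRepulsive C s Ψ) (hρ : 0 < ρ)
    (h0 : ∀ r, ρ ≤ r → Ψ r = 0) : deflection Ψ ρ = 0 := by
  have ht : turning Ψ ρ = ρ := by
    refine turning_eq_of_radial_eq_zero h.anti hρ hρ ?_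
    rw [radial, h0 ρ le_rfl, div_self (by positivity)]
    ring
  rw [deflection_eq_integral_sub hs h hρ]
  have : ∫ u in Set.Ioo (0 : ℝ) 1,
      (1 / Real.sqrt (1 - u ^ 2) - 1 / Real.sqrt (1 - u ^ 2 + excess Ψ ρ u)) =
      ∫ u in Set.Ioo (0 : ℝ) 1, (0 : ℝ) := by
    refine setIntegral_congr_fun measurableSet_Ioo fun u hu => ?_
    have h1 : Ψ (ρ / u) = 0 := h0 _ ((le_div_iff₀ hu.1).2 (by nlinarith [hu.2]))
    simp [excess, ht, h1, h0 ρ le_rfl]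
  rw [this]
  simp

end Radial

/-! ### Continuity of the deflection with respect to the potential. -/

section Limits

variable {C s ρ : ℝ} {ι : Type*} {l : Filter ι} {Ψ : ι → ℝ → ℝ} {Ψ₀ : ℝ → ℝ}

/-- The sign of `radial` at a fixed radius tells on which side of it the turning point lies, and a
strict sign survives pointwise convergence. -/
theorem tendsto_turning (hs : 0 < s) (h : ∀ᶠ i in l, IsRepulsive C s (Ψ i))
    (h₀ : IsRepulsive C s Ψ₀) (hlim : ∀ r, 0 < r → Tendsto (fun i => Ψ i r) l (𝓝 (Ψ₀ r)))
    (hρ : 0 < ρ) : Tendsto (fun i => turning (Ψ i) ρ) l (𝓝 (turning Ψ₀ ρ)) := by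
  have ht := turning_pos hs h₀ hρ
  have hrl : ∀ r, 0 < r → Tendsto (fun i => radial (Ψ i) ρ r) l (𝓝 (radial Ψ₀ ρ r)) :=
    fun r hr => tendsto_const_nhds.sub (hlim r hr)
  have hm := radial_strictMonoOn h₀.anti hρ
  refine tendsto_order.2 ⟨fun a ha => ?_, fun b hb => ?_⟩
  · rcases le_or_gt a 0 with ha0 | ha0
    · filter_upwards [h] with i hi
      exact ha0.trans_lt (turning_pos hs hi hρ)
    · have h1 : radial Ψ₀ ρ a < 0 := by
        rw [← radial_turning hs h₀ hρ]
        exact hm ha0 ht ha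
      filter_upwards [h, (hrl a ha0).eventually (gt_mem_nhds h1)] with i hi h2
      rw [← radial_turning hs hi hρ] at h2
      exact ((radial_strictMonoOn hi.anti hρ).lt_iff_lt ha0 (turning_pos hs hi hρ)).1 h2
  · have hb0 : 0 < b := ht.trans hb
    have h1 : 0 < radial Ψ₀ ρ b := by
      rw [← radial_turning hs h₀ hρ]
      exact hm ht hb0 hb
    filter_upwards [h, (hrl b hb0).eventually (lt_mem_nhds h1)] with i hi h2
    rw [← radial_turning hs hi hρ] at h2
    exact ((radial_strictMonoOn hi.anti hρ).lt_iff_lt (turning_pos hs hi hρ) hb0).1 h2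

/-- Pointwise convergence of decreasing functions to a continuous function is locally uniform. -/
theorem tendsto_antitone_apply (h : ∀ᶠ i in l, AntitoneOn (Ψ i) (Set.Ioi 0))
    (h₀ : ContinuousOn Ψ₀ (Set.Ioi 0))
    (hlim : ∀ r, 0 < r → Tendsto (fun i => Ψ i r) l (𝓝 (Ψ₀ r))) {x : ι → ℝ} {x₀ : ℝ}
    (hx₀ : 0 < x₀) (hx : Tendsto x l (𝓝 x₀)) : Tendsto (fun i => Ψ i (x i)) l (𝓝 (Ψ₀ x₀)) := by
  have hc : ContinuousAt Ψ₀ x₀ := h₀.continuousAt (Ioi_mem_nhds hx₀)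
  refine tendsto_order.2 ⟨fun a ha => ?_, fun b hb => ?_⟩
  · have h1 : ∀ᶠ y in 𝓝[>] x₀, a < Ψ₀ y :=
      (hc.eventually (lt_mem_nhds ha)).filter_mono nhdsWithin_le_nhds
    -- A fixed y slightly to the right of the limit point is eventually to the right of `x i`, so
    -- monotonicity bounds the value at `x i` from below by the value at y. The upper bound uses a
    -- point on the left.
    obtain ⟨y, hy, hxy⟩ := (h1.and self_mem_nhdsWithin).exists
    have hxy' : x₀ < y := hxy
    filter_upwards [h, (hlim y (hx₀.trans hxy')).eventually (lt_mem_nhds hy),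
      hx.eventually (gt_mem_nhds hxy'), hx.eventually (lt_mem_nhds hx₀)] with i h1 h2 h3 h4
    exact h2.trans_le (h1 h4 (hx₀.trans hxy') h3.le)
  · have h1 : ∀ᶠ y in 𝓝[<] x₀, Ψ₀ y < b :=
      (hc.eventually (gt_mem_nhds hb)).filter_mono nhdsWithin_le_nhds
    have h2 : ∀ᶠ y in 𝓝[<] x₀, 0 < y := (lt_mem_nhds hx₀).filter_mono nhdsWithin_le_nhds
    obtain ⟨y, ⟨hy, hy0⟩, hxy⟩ := ((h1.and h2).and self_mem_nhdsWithin).exists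
    have hxy' : y < x₀ := hxy
    filter_upwards [h, (hlim y hy0).eventually (gt_mem_nhds hy),
      hx.eventually (lt_mem_nhds hxy')] with i h1 h2 h3
    exact (h1 hy0 (hy0.trans h3) h3.le).trans_lt h2

/-- Dominated convergence on (0,1). The majorant 1/√(1-u²) is common to all repulsive potentials. -/
theorem tendsto_deflection [l.IsCountablyGenerated] (hs : 0 < s)
    (h : ∀ᶠ i in l, IsRepulsive C s (Ψ i)) (h₀ : IsRepulsive C s Ψ₀)
    (hlim : ∀ r, 0 < r → Tendsto (fun i => Ψ i r) l (𝓝 (Ψ₀ r))) (hρ : 0 < ρ) :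
    Tendsto (fun i => deflection (Ψ i) ρ) l (𝓝 (deflection Ψ₀ ρ)) := by
  have ht := turning_pos hs h₀ hρ
  have htl := tendsto_turning hs h h₀ hlim hρ
  have hanti : ∀ᶠ i in l, AntitoneOn (Ψ i) (Set.Ioi 0) := h.mono fun i hi => hi.anti
  rw [deflection_eq hs h₀ hρ]
  have key : Tendsto (fun i => ∫ u in Set.Ioo (0 : ℝ) 1,
      1 / Real.sqrt (1 - u ^ 2 + excess (Ψ i) ρ u)) l
      (𝓝 (∫ u in Set.Ioo (0 : ℝ) 1, 1 / Real.sqrt (1 - u ^ 2 + excess Ψ₀ ρ u))) := by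
    refine tendsto_integral_filter_of_dominated_convergence
      (fun u => 1 / Real.sqrt (1 - u ^ 2)) ?_ ?_ integrableOn_one_div_sqrt_one_sub_sq ?_
    · filter_upwards [h] with i hi using aestronglyMeasurable_inv_sqrt_excess hs hi hρ
    · filter_upwards [h] with i hi
      refine (ae_restrict_iff' measurableSet_Ioo).2 (ae_of_all _ fun u hu => ?_)
      rw [Real.norm_of_nonneg (by positivity)]
      exact inv_sqrt_excess_le hs hi hρ hu
    · refine (ae_restrict_iff' measurableSet_Ioo).2 (ae_of_all _ fun u hu => ?_)
      have hq := excess_nonneg hs h₀ hρ hu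
      have hA : 0 < 1 - u ^ 2 + excess Ψ₀ ρ u := by nlinarith [hu.1, hu.2]
      have h1 := tendsto_antitone_apply hanti h₀.cont hlim ht htl
      have h2 := tendsto_antitone_apply hanti h₀.cont hlim (div_pos ht hu.1) (htl.div_const u)
      have h3 : Tendsto (fun i => excess (Ψ i) ρ u) l (𝓝 (excess Ψ₀ ρ u)) :=
        (h1.sub h2).mul ((htl.div_const ρ).pow 2)
      exact tendsto_const_nhds.div ((Real.continuous_sqrt.tendsto _).comp
        (tendsto_const_nhds.add h3)) (Real.sqrt_pos.2 hA).ne'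
  refine Tendsto.congr' ?_ (tendsto_const_nhds.sub (key.const_mul 2))
  filter_upwards [h] with i hi
  rw [deflection_eq hs hi hρ]

end Limits

/-! ### The potentials as repulsive potentials -/

theorem IsRepulsive.const_mul {C s : ℝ} {Ψ : ℝ → ℝ} (h : IsRepulsive C s Ψ) {a : ℝ} (ha : 0 ≤ a) :
    IsRepulsive (a * C) s (fun r => a * Ψ r) where
  nonneg r hr := mul_nonneg ha (h.nonneg r hr)
  anti x hx y hy hxy := mul_le_mul_of_nonneg_left (h.anti hx hy hxy) ha
  cont := continuousOn_const.mul h.cont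
  le r hr := by
    have := mul_le_mul_of_nonneg_left (h.le r hr) ha
    linarith
  sub_le r u hr hu hu1 := by
    have := mul_le_mul_of_nonneg_left (h.sub_le r u hr hu hu1) ha
    linarith

/-- Bernoulli's inequality for (1 + (u - 1))^s. -/
theorem one_sub_rpow_le {s u : ℝ} (hs : 1 < s) (hu : 0 < u) : 1 - u ^ s ≤ s * (1 - u) := by
  have := one_add_mul_self_le_rpow_one_add (s := u - 1) (by linarith) hs.le
  rw [add_sub_cancel] at this
  linarith

theorem isRepulsive_rpow {s : ℝ} (hs : 1 < s) : IsRepulsive s s (fun r => r ^ (-s)) where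
  nonneg r hr := Real.rpow_nonneg hr.le _
  anti x hx y _ hxy := Real.rpow_le_rpow_of_nonpos hx hxy (by linarith)
  cont := continuousOn_id.rpow_const fun x hx => Or.inl (ne_of_gt hx)
  le r hr := by
    have := Real.rpow_nonneg hr.le (-s)
    nlinarith
  sub_le r u hr hu hu1 := by
    have h1 := Real.rpow_pos_of_pos hr (-s)
    rw [Real.div_rpow hr.le hu.le, Real.rpow_neg hu.le, div_inv_eq_mul]
    have := one_sub_rpow_le hs hu
    nlinarith

section Profile

variable {f : ℝ → ℝ} {s : ℝ}

theorem IsProfile.nonneg (hf : IsProfile f) {r : ℝ} (hr : r ∈ Set.Icc (0 : ℝ) 1) : 0 ≤ f r := by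
  rw [← hf.eq_one]
  exact hf.decreasing hr (Set.right_mem_Icc.2 zero_le_one) hr.2

theorem IsProfile.le_zero (hf : IsProfile f) {r : ℝ} (hr : r ∈ Set.Icc (0 : ℝ) 1) : f r ≤ f 0 :=
  hf.decreasing (Set.left_mem_Icc.2 zero_le_one) hr hr.1

theorem IsProfile.differentiableAt (hf : IsProfile f) {r : ℝ} (hr : r ∈ Set.Ioo (0 : ℝ) 1) :
    DifferentiableAt ℝ f r :=
  (hf.smooth.differentiableOn (by simp)).differentiableAt (isOpen_Ioo.mem_nhds hr)

/-- The mean value theorem with the bound on the first derivative. Continuity on the closed interval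
carries the estimate to the end points. -/
theorem IsProfile.exists_sub_le (hf : IsProfile f) :
    ∃ L, 0 ≤ L ∧ ∀ a ∈ Set.Icc (0 : ℝ) 1, ∀ b ∈ Set.Icc (0 : ℝ) 1, a ≤ b →
      f a - f b ≤ L * (b - a) := by
  obtain ⟨L, hL⟩ := hf.bounded 1
  have hL0 : 0 ≤ L := (abs_nonneg _).trans (hL (1 / 2) (by norm_num))
  refine ⟨L, hL0, fun a ha b hb hab => ?_⟩
  rcases hab.eq_or_lt with rfl | hab
  · simp
  obtain ⟨c, hc, hc'⟩ := exists_deriv_eq_slope f hab (hf.continuous.mono (Set.Icc_subset_Icc ha.1 hb.2))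
    (fun x hx => (hf.differentiableAt ⟨ha.1.trans_lt hx.1, hx.2.trans_le hb.2⟩).differentiableWithinAt)
  have h1 := hL c ⟨ha.1.trans_lt hc.1, hc.2.trans_le hb.2⟩
  rw [iteratedDeriv_one, hc', abs_le] at h1
  have h2 := h1.1
  rw [le_div_iff₀ (by linarith)] at h2
  linarith

theorem shortRange_eq {r : ℝ} (hr : 0 < r) (hr1 : r ≤ 1) : shortRange f s r = f r * r ^ (-s) := by
  rw [shortRange, if_pos ⟨hr, hr1⟩, Real.rpow_neg hr.le, div_eq_mul_inv]

theorem shortRange_eq_zero (hf : IsProfile f) {r : ℝ} (hr1 : 1 ≤ r) : shortRange f s r = 0 := by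
  rcases hr1.eq_or_lt with rfl | h
  · simp [shortRange, hf.eq_one]
  · rw [shortRange, if_neg (by rintro ⟨_, h2⟩; linarith)]

theorem exists_isRepulsive_shortRange (hs : 1 < s) (hf : IsProfile f) :
    ∃ C, IsRepulsive C s (shortRange f s) := by
  obtain ⟨L, hL0, hL⟩ := hf.exists_sub_le
  have hnn : ∀ r, 0 < r → 0 ≤ shortRange f s r := by
    intro r hr
    rcases le_total r 1 with h1 | h1
    · rw [shortRange_eq hr h1]
      exact mul_nonneg (hf.nonneg ⟨hr.le, h1⟩) (Real.rpow_nonneg hr.le _)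
    · rw [shortRange_eq_zero hf h1]
  have hf0 := hf.pos_zero
  -- The constant comes from f(r) - u^s f(r/u) = f(r)(1 - u^s) + u^s (f(r) - f(r/u)). Bernoulli's
  -- inequality bounds the first term by s f(0)(1-u) and the Lipschitz estimate bounds the second by
  -- L(1-u).
  refine ⟨s * f 0 + L, hnn, ?_, ?_, ?_, ?_⟩
  · intro x hx y hy hxy
    have hx0 : (0 : ℝ) < x := hx
    rcases le_total y 1 with h1 | h1
    · rw [shortRange_eq hy h1, shortRange_eq hx (hxy.trans h1)]
      have hy' : y ∈ Set.Icc (0 : ℝ) 1 := ⟨(hx0.trans_le hxy).le, h1⟩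
      have hx' : x ∈ Set.Icc (0 : ℝ) 1 := ⟨hx0.le, hxy.trans h1⟩
      exact mul_le_mul (hf.decreasing hx' hy' hxy)
        (Real.rpow_le_rpow_of_nonpos hx hxy (by linarith)) (Real.rpow_nonneg hy'.1 _)
        (hf.nonneg hx')
    · rw [shortRange_eq_zero hf h1]
      exact hnn x hx
  -- The two branches match at r = 1 because f(1) = 0.
  · have h3 : ContinuousOn (fun x => if x ≤ 1 then f x * x ^ (-s) else 0) (Set.Ioi 0) := by
      refine ContinuousOn.if ?_ ?_ ?_
      · rintro a ⟨_, ha⟩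
        have ha' := frontier_le_subset_eq continuous_id continuous_const ha
        simp only [id, Set.mem_ofPred_eq] at ha'
        rw [ha', hf.eq_one, zero_mul]
      · have : closure {a : ℝ | a ≤ 1} = Set.Iic 1 := isClosed_Iic.closure_eq
        rw [this]
        refine (hf.continuous.mono fun x hx => ⟨(le_of_lt hx.1), hx.2⟩).mul
          (continuousOn_id.rpow_const fun x hx => Or.inl (ne_of_gt hx.1))
      · exact continuousOn_const
    refine h3.congr fun x hx => ?_
    by_cases h : x ≤ 1
    · rw [shortRange_eq hx h]
      exact (if_pos h).symm
    · rw [shortRange_eq_zero hf (not_le.1 h).le]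
      exact (if_neg h).symm
  · intro r hr
    have h1 := Real.rpow_pos_of_pos hr (-s)
    rcases le_total r 1 with h2 | h2
    · rw [shortRange_eq hr h2]
      refine mul_le_mul_of_nonneg_right ?_ h1.le
      have := hf.le_zero ⟨hr.le, h2⟩
      nlinarith
    · rw [shortRange_eq_zero hf h2]
      positivity
  · intro r u hr hu hu1
    have h1 := Real.rpow_pos_of_pos hr (-s)
    have h1u : 0 < 1 - u := by linarith
    rcases le_total r 1 with h2 | h2
    swap
    · have h3 := hnn (r / u) (by positivity)
      rw [shortRange_eq_zero hf h2]
      have : 0 ≤ (s * f 0 + L) * r ^ (-s) * (1 - u) := by positivity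
      linarith
    have hrm : r ∈ Set.Icc (0 : ℝ) 1 := ⟨hr.le, h2⟩
    rcases le_total (r / u) 1 with h3 | h3
    · have hru : 0 < r / u := by positivity
      have hus : 0 ≤ u ^ s := Real.rpow_nonneg hu.le _
      have hle : r ≤ r / u := (le_div_iff₀ hu).2 (by nlinarith)
      have hrum : r / u ∈ Set.Icc (0 : ℝ) 1 := ⟨hru.le, h3⟩
      rw [shortRange_eq hr h2, shortRange_eq hru h3, Real.div_rpow hr.le hu.le,
        Real.rpow_neg hu.le, div_inv_eq_mul]
      have h4 := hL r hrm (r / u) hrum hle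
      have h5 := one_sub_rpow_le hs hu
      -- One power of u absorbs the denominator in r/u - r = r(1-u)/u.
      have h6 : u ^ s ≤ u := by
        calc u ^ s ≤ u ^ (1 : ℝ) := Real.rpow_le_rpow_of_exponent_ge hu hu1.le hs.le
          _ = u := Real.rpow_one u
      have h7 : u ^ s * (f r - f (r / u)) ≤ L * (1 - u) := by
        calc u ^ s * (f r - f (r / u)) ≤ u * (L * (r / u - r)) := by
              apply mul_le_mul h6 h4 _ hu.le
              linarith [hf.decreasing hrm hrum hle]
          _ = L * (1 - u) * r := by field_simp
          _ ≤ L * (1 - u) * 1 := by gcongr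
          _ = _ := by ring
      have h8 : f r * (1 - u ^ s) ≤ f 0 * (s * (1 - u)) := by
        apply mul_le_mul (hf.le_zero hrm) h5 _ hf0.le
        linarith
      have h9 : f r - u ^ s * f (r / u) ≤ (s * f 0 + L) * (1 - u) := by nlinarith
      nlinarith
    -- Here r/u lies outside the range, and u ≤ r gives f(r) = f(r) - f(1) ≤ L(1-r) ≤ L(1-u).
    · rw [shortRange_eq_zero hf h3, shortRange_eq hr h2]
      have h4 := hL r hrm 1 (by simp) h2
      rw [hf.eq_one] at h4
      rw [le_div_iff₀ hu] at h3
      have h5 : f r ≤ (s * f 0 + L) * (1 - u) := by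
        have h6 : L * (1 - r) ≤ L * (1 - u) := by gcongr; linarith
        have : 0 ≤ s * f 0 * (1 - u) := by positivity
        nlinarith
      nlinarith

/-- The short range potential in the scaling of grazing collisions. -/
def scaledPotential (f : ℝ → ℝ) (s κ r : ℝ) : ℝ :=
  4 * κ * shortRange f s (κ ^ (1 / s) * r)

/-- The prefactor κ cancels (κ^{1/s})^{-s} = κ^{-1}. The constant is therefore independent of κ,
which makes all later bounds uniform. -/
theorem isRepulsive_scaledPotential (hs : 1 < s) {C : ℝ} (h : IsRepulsive C s (shortRange f s))
    {κ : ℝ} (hκ : 0 < κ) : IsRepulsive (4 * C) s (scaledPotential f s κ) := by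
  have h1 := (h.scale (Real.rpow_pos_of_pos hκ (1 / s))).const_mul (a := 4 * κ) (by positivity)
  have h2 : 4 * κ * (C * (κ ^ (1 / s)) ^ (-s)) = 4 * C := by
    rw [← Real.rpow_mul hκ.le]
    have : 1 / s * -s = -1 := by field_simp
    rw [this, Real.rpow_neg_one]
    field_simp
  rwa [h2] at h1

/-- As soon as κ^{1/s} r ≤ 1 the scaled potential equals 4f(κ^{1/s} r) r^{-s}. Only continuity of f
at 0 is involved. -/
theorem tendsto_scaledPotential (hs : 1 < s) (hf : IsProfile f) {r : ℝ} (hr : 0 < r) :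
    Tendsto (fun κ => scaledPotential f s κ r) (𝓝[>] 0) (𝓝 (4 * f 0 * r ^ (-s))) := by
  have h1 : Tendsto (fun κ : ℝ => κ ^ (1 / s) * r) (𝓝[>] 0) (𝓝 0) := by
    have : Tendsto (fun κ : ℝ => κ ^ (1 / s) * r) (𝓝 0) (𝓝 ((0 : ℝ) ^ (1 / s) * r)) :=
      ((Real.continuousAt_rpow_const _ _ (Or.inr (by positivity))).tendsto).mul_const r
    rw [Real.zero_rpow (by positivity), zero_mul] at this
    exact this.mono_left nhdsWithin_le_nhds
  have h2 : Tendsto (fun κ : ℝ => κ ^ (1 / s) * r) (𝓝[>] 0) (𝓝[Set.Icc 0 1] 0) := by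
    refine tendsto_nhdsWithin_iff.2 ⟨h1, ?_⟩
    filter_upwards [self_mem_nhdsWithin, h1.eventually (gt_mem_nhds one_pos)] with κ hκ hκ1
    have : (0 : ℝ) < κ := hκ
    exact ⟨by positivity, hκ1.le⟩
  have h3 := (hf.continuous 0 (by simp)).tendsto.comp h2
  refine (((h3.const_mul 4)).mul_const (r ^ (-s))).congr' ?_
  filter_upwards [self_mem_nhdsWithin, h1.eventually (gt_mem_nhds one_pos)] with κ hκ hκ1
  have hκ0 : (0 : ℝ) < κ := hκ
  rw [scaledPotential, shortRange_eq (by positivity) hκ1.le,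
    Real.mul_rpow (by positivity) hr.le, ← Real.rpow_mul hκ0.le]
  have : 1 / s * -s = -1 := by field_simp
  rw [this, Real.rpow_neg_one]
  simp only [Function.comp]
  field_simp

end Profile

/-! ### The deflection angle of a homogeneous potential and its inverse -/

/-- The deflection angle of a homogeneous potential as a function of the ratio `x` of the
radial parts of the potential and the centrifugal energy at the turning point. -/
def homAngle (s x : ℝ) : ℝ :=
  Real.pi - 2 * ∫ u in Set.Ioo (0 : ℝ) 1, 1 / Real.sqrt (1 - u ^ 2 + x * (1 - u ^ s))

/-- The impact parameter for the potential `c r^{-s}` in the same parametrization. -/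
def homImpact (c s x : ℝ) : ℝ :=
  c ^ (1 / s) * (x / (1 + x)) ^ (-(1 / s)) / Real.sqrt (1 + x)

section Homogeneous

variable {s c : ℝ}

theorem one_sub_rpow_mem {s u : ℝ} (hs : 1 < s) (hu : u ∈ Set.Ioo (0 : ℝ) 1) :
    0 < 1 - u ^ s ∧ 1 - u ^ s ≤ s * (1 - u) := by
  refine ⟨?_, one_sub_rpow_le hs hu.1⟩
  have := Real.rpow_lt_one hu.1.le hu.2 (by linarith : 0 < s)
  linarith

theorem homImpact_pos (hc : 0 < c) {x : ℝ} (hx : 0 < x) : 0 < homImpact c s x := by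
  unfold homImpact
  positivity

/-- The radius m is chosen with c m^{-s} = x/(1+x), and the impact parameter m/√(1+x) makes the
centrifugal part 1/(1+x). The two add up to one, and their ratio is x. -/
theorem turning_homImpact (hs : 1 < s) (hc : 0 < c) {x : ℝ} (hx : 0 < x) :
    turning (fun r => c * r ^ (-s)) (homImpact c s x) =
      c ^ (1 / s) * (x / (1 + x)) ^ (-(1 / s)) := by
  have hr := (isRepulsive_rpow hs).const_mul hc.le
  have hm : 0 < c ^ (1 / s) * (x / (1 + x)) ^ (-(1 / s)) := by positivity
  refine turning_eq_of_radial_eq_zero hr.anti (homImpact_pos hc hx) hm ?_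
  have h1 : c * (c ^ (1 / s) * (x / (1 + x)) ^ (-(1 / s))) ^ (-s) = x / (1 + x) := by
    rw [Real.mul_rpow (by positivity) (by positivity), ← Real.rpow_mul hc.le,
      ← Real.rpow_mul (by positivity)]
    have e1 : 1 / s * -s = -1 := by field_simp
    have e2 : -(1 / s) * -s = 1 := by field_simp
    rw [e1, e2, Real.rpow_neg_one, Real.rpow_one]
    field_simp
  rw [radial, h1, homImpact, div_pow, Real.sq_sqrt (by positivity)]
  field_simp
  ring

/-- For a power law the excess is c m^{-s}(1 - u^s)(m/ρ)² = x(1 - u^s). In this parameter it is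
linear and the turning point has disappeared, so the angle can be differentiated under the integral.
-/
theorem deflection_homImpact (hs : 1 < s) (hc : 0 < c) {x : ℝ} (hx : 0 < x) :
    deflection (fun r => c * r ^ (-s)) (homImpact c s x) = homAngle s x := by
  have hr := (isRepulsive_rpow hs).const_mul hc.le
  rw [deflection_eq (by linarith) hr (homImpact_pos hc hx), homAngle]
  congr 2
  refine setIntegral_congr_fun measurableSet_Ioo fun u hu => ?_
  have hu0 := hu.1
  have hm : 0 < c ^ (1 / s) * (x / (1 + x)) ^ (-(1 / s)) := by positivity
  have h1 : c * (c ^ (1 / s) * (x / (1 + x)) ^ (-(1 / s))) ^ (-s) = x / (1 + x) := by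
    rw [Real.mul_rpow (by positivity) (by positivity), ← Real.rpow_mul hc.le,
      ← Real.rpow_mul (by positivity)]
    have e1 : 1 / s * -s = -1 := by field_simp
    have e2 : -(1 / s) * -s = 1 := by field_simp
    rw [e1, e2, Real.rpow_neg_one, Real.rpow_one]
    field_simp
  simp only [excess, turning_homImpact hs hc hx]
  rw [Real.div_rpow hm.le hu0.le, Real.rpow_neg hu0.le, div_inv_eq_mul, ← mul_assoc, h1, homImpact]
  congr 3
  set m := c ^ (1 / s) * (x / (1 + x)) ^ (-(1 / s))
  rw [div_div_cancel₀ hm.ne', Real.sq_sqrt (by positivity)]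
  field_simp

theorem exists_homImpact_eq (hs : 1 < s) (hc : 0 < c) {b : ℝ} (hb : 0 < b) :
    ∃ x, 0 < x ∧ homImpact c s x = b := by
  have hr := (isRepulsive_rpow hs).const_mul hc.le
  have hs0 : 0 < s := by linarith
  have ht := turning_pos hs0 hr hb
  have h0 := radial_turning hs0 hr hb
  set m := turning (fun r => c * r ^ (-s)) b
  simp only [radial] at h0
  have hy : 0 < c * m ^ (-s) := by positivity
  have hb2 : 0 < b ^ 2 / m ^ 2 := by positivity
  have e : c * m ^ (-s) = 1 - b ^ 2 / m ^ 2 := by linarith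
  -- The witness is the ratio of potential and centrifugal part at the turning point of b.
  refine ⟨m ^ 2 / b ^ 2 * (c * m ^ (-s)), by positivity, ?_⟩
  have h1 : 1 + m ^ 2 / b ^ 2 * (c * m ^ (-s)) = (m / b) ^ 2 := by
    rw [e]; field_simp; ring
  rw [homImpact, h1, Real.sqrt_sq (by positivity)]
  have h2 : m ^ 2 / b ^ 2 * (c * m ^ (-s)) / (m / b) ^ 2 = c * m ^ (-s) := by
    field_simp
  rw [h2, Real.mul_rpow hc.le (by positivity), ← Real.rpow_mul ht.le]
  have e1 : -s * -(1 / s) = 1 := by field_simp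
  rw [e1, Real.rpow_one, Real.rpow_neg hc.le]
  have : 0 < c ^ (1 / s) := by positivity
  field_simp

theorem homAngle_integrand_pos (hs : 1 < s) {x u : ℝ} (hx : 0 ≤ x) (hu : u ∈ Set.Ioo (0 : ℝ) 1) :
    0 < 1 - u ^ 2 ∧ 1 - u ^ 2 ≤ 1 - u ^ 2 + x * (1 - u ^ s) := by
  have h1 : 0 < 1 - u ^ 2 := by nlinarith [hu.1, hu.2]
  have h2 := mul_nonneg hx (one_sub_rpow_mem hs hu).1.le
  exact ⟨h1, by linarith⟩

theorem continuousOn_homAngle_integrand (hs : 1 < s) {x : ℝ} (hx : 0 ≤ x) :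
    ContinuousOn (fun u : ℝ => 1 / Real.sqrt (1 - u ^ 2 + x * (1 - u ^ s))) (Set.Ioo 0 1) := by
  have h1 : ContinuousOn (fun u : ℝ => u ^ s) (Set.Ioo 0 1) :=
    continuousOn_id.rpow_const fun u hu => Or.inl (ne_of_gt hu.1)
  refine continuousOn_const.div (Real.continuous_sqrt.comp_continuousOn (by fun_prop)) fun u hu => ?_
  have := homAngle_integrand_pos hs hx hu
  exact (Real.sqrt_pos.2 (by linarith)).ne'

theorem homAngle_integrand_le (hs : 1 < s) {x u : ℝ} (hx : 0 ≤ x) (hu : u ∈ Set.Ioo (0 : ℝ) 1) :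
    ‖1 / Real.sqrt (1 - u ^ 2 + x * (1 - u ^ s))‖ ≤ 1 / Real.sqrt (1 - u ^ 2) := by
  rw [Real.norm_of_nonneg (by positivity)]
  have := homAngle_integrand_pos hs hx hu
  exact one_div_le_one_div_of_le (Real.sqrt_pos.2 this.1) (Real.sqrt_le_sqrt this.2)

theorem integrableOn_homAngle_integrand (hs : 1 < s) {x : ℝ} (hx : 0 ≤ x) :
    IntegrableOn (fun u : ℝ => 1 / Real.sqrt (1 - u ^ 2 + x * (1 - u ^ s))) (Set.Ioo 0 1) :=
  Integrable.mono' integrableOn_one_div_sqrt_one_sub_sq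
    ((continuousOn_homAngle_integrand hs hx).aestronglyMeasurable measurableSet_Ioo)
    ((ae_restrict_iff' measurableSet_Ioo).2 (ae_of_all _ fun _ hu => homAngle_integrand_le hs hx hu))

theorem exists_hasDerivAt_homAngle (hs : 1 < s) {x : ℝ} (hx : 0 < x) :
    ∃ d, 0 < d ∧ HasDerivAt (homAngle s) d x := by
  set F' : ℝ → ℝ → ℝ := fun y u => -((1 - u ^ s) / (2 * Real.sqrt (1 - u ^ 2 + y * (1 - u ^ s)))) /
    (Real.sqrt (1 - u ^ 2 + y * (1 - u ^ s))) ^ 2 with hF'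
  have hpos : ∀ y ∈ Set.Ioi (0 : ℝ), ∀ u ∈ Set.Ioo (0 : ℝ) 1,
      0 < Real.sqrt (1 - u ^ 2 + y * (1 - u ^ s)) := fun y hy u hu => by
    have := homAngle_integrand_pos hs (le_of_lt hy) hu
    exact Real.sqrt_pos.2 (by linarith)
  have hrc : ContinuousOn (fun u : ℝ => u ^ s) (Set.Ioo 0 1) :=
    continuousOn_id.rpow_const fun u hu => Or.inl (ne_of_gt hu.1)
  have hFc : ContinuousOn (F' x) (Set.Ioo 0 1) := by
    have h0 : ∀ u ∈ Set.Ioo (0 : ℝ) 1, Real.sqrt (1 - u ^ 2 + x * (1 - u ^ s)) ≠ 0 :=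
      fun u hu => (hpos x hx u hu).ne'
    have hsq : ContinuousOn (fun u => Real.sqrt (1 - u ^ 2 + x * (1 - u ^ s))) (Set.Ioo 0 1) :=
      Real.continuous_sqrt.comp_continuousOn (by fun_prop)
    refine ContinuousOn.div (ContinuousOn.neg (ContinuousOn.div (by fun_prop) (by fun_prop) ?_))
      (by fun_prop) ?_
    · exact fun u hu => mul_ne_zero two_ne_zero (h0 u hu)
    · exact fun u hu => pow_ne_zero _ (h0 u hu)
  have key := hasDerivAt_integral_of_dominated_loc_of_deriv_le
    (μ := volume.restrict (Set.Ioo (0 : ℝ) 1)) (s := Set.Ioi 0) (x₀ := x)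
    (F := fun y u => 1 / Real.sqrt (1 - u ^ 2 + y * (1 - u ^ s))) (F' := F')
    (bound := fun u => s / 2 * (1 / Real.sqrt (1 - u ^ 2))) (Ioi_mem_nhds hx)
    ?_ (integrableOn_homAngle_integrand hs hx.le) (hFc.aestronglyMeasurable measurableSet_Ioo) ?_
    (integrableOn_one_div_sqrt_one_sub_sq.const_mul _) ?_
  · obtain ⟨hint, hder⟩ := key
    refine ⟨-2 * ∫ u in Set.Ioo (0 : ℝ) 1, F' x u, ?_, ?_⟩
    · have : 0 < ∫ u in Set.Ioo (0 : ℝ) 1, -F' x u := by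
        rw [setIntegral_pos_iff_support_of_nonneg_ae]
        · have : Set.Ioo (0 : ℝ) 1 ⊆ (Function.support fun u => -F' x u) ∩ Set.Ioo 0 1 := by
            intro u hu
            refine ⟨?_, hu⟩
            have h1 := hpos x hx u hu
            have h2 := (one_sub_rpow_mem hs hu).1
            have : 0 < -F' x u := by
              simp only [hF', neg_div, neg_neg]
              positivity
            exact this.ne'
          refine lt_of_lt_of_le ?_ (measure_mono this)
          simp
        · refine (ae_restrict_iff' measurableSet_Ioo).2 (ae_of_all _ fun u hu => ?_)
          have h1 := hpos x hx u hu
          have h2 := (one_sub_rpow_mem hs hu).1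
          simp only [hF', neg_div, neg_neg, Pi.zero_apply]
          positivity
        · exact hint.neg
      rw [integral_neg] at this
      linarith
    · exact ((hder.const_mul 2).const_sub Real.pi).congr_deriv (by ring)
  · filter_upwards [Ioi_mem_nhds hx] with y hy
    exact (continuousOn_homAngle_integrand hs (le_of_lt hy)).aestronglyMeasurable measurableSet_Ioo
  · refine (ae_restrict_iff' measurableSet_Ioo).2 (ae_of_all _ fun u hu y hy => ?_)
    have h1 := hpos y hy u hu
    have h2 := one_sub_rpow_mem hs hu
    have h3 := homAngle_integrand_pos hs (le_of_lt hy) hu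
    have h4 : Real.sqrt (1 - u ^ 2) ≤ Real.sqrt (1 - u ^ 2 + y * (1 - u ^ s)) :=
      Real.sqrt_le_sqrt h3.2
    have h5 : 0 < Real.sqrt (1 - u ^ 2) := Real.sqrt_pos.2 h3.1
    rw [hF']
    simp only
    rw [neg_div, norm_neg, Real.norm_of_nonneg (by have := h2.1; positivity)]
    -- By Bernoulli's inequality the numerator is at most s times the radicand. This leaves s/2
    -- times the free integrand, a majorant independent of y.
    have h6 : 1 - u ^ s ≤ s * (Real.sqrt (1 - u ^ 2 + y * (1 - u ^ s))) ^ 2 := by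
      rw [Real.sq_sqrt (by linarith)]
      have : 1 - u ≤ 1 - u ^ 2 := by nlinarith [hu.1, hu.2]
      nlinarith
    set B := Real.sqrt (1 - u ^ 2 + y * (1 - u ^ s))
    calc (1 - u ^ s) / (2 * B) / B ^ 2 ≤ (s * B ^ 2) / (2 * B) / B ^ 2 := by gcongr
      _ = s / 2 * (1 / B) := by field_simp
      _ ≤ _ := by gcongr
  · refine (ae_restrict_iff' measurableSet_Ioo).2 (ae_of_all _ fun u hu y hy => ?_)
    have h1 := hpos y hy u hu
    have h3 := homAngle_integrand_pos hs (le_of_lt hy) hu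
    have h4 : HasDerivAt (fun y : ℝ => 1 - u ^ 2 + y * (1 - u ^ s)) (1 - u ^ s) y := by
      simpa using ((hasDerivAt_id y).mul_const (1 - u ^ s)).const_add (1 - u ^ 2)
    have h5 := (h4.sqrt (by linarith)).inv h1.ne'
    simp only [one_div]
    exact h5

theorem homAngle_strictMonoOn (hs : 1 < s) : StrictMonoOn (homAngle s) (Set.Ioi 0) := by
  refine strictMonoOn_of_deriv_pos (convex_Ioi 0) (fun x hx => ?_) fun x hx => ?_
  · obtain ⟨d, _, h⟩ := exists_hasDerivAt_homAngle hs hx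
    exact h.continuousAt.continuousWithinAt
  · rw [interior_Ioi] at hx
    obtain ⟨d, hd, h⟩ := exists_hasDerivAt_homAngle hs hx
    rwa [h.deriv]

theorem tendsto_homAngle_zero (hs : 1 < s) : Tendsto (homAngle s) (𝓝[>] 0) (𝓝 0) := by
  have : Tendsto (fun x => ∫ u in Set.Ioo (0 : ℝ) 1, 1 / Real.sqrt (1 - u ^ 2 + x * (1 - u ^ s)))
      (𝓝[>] 0) (𝓝 (∫ u in Set.Ioo (0 : ℝ) 1, 1 / Real.sqrt (1 - u ^ 2))) := by
    refine tendsto_integral_filter_of_dominated_convergence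
      (fun u => 1 / Real.sqrt (1 - u ^ 2)) ?_ ?_ integrableOn_one_div_sqrt_one_sub_sq ?_
    · filter_upwards [self_mem_nhdsWithin] with x hx
      exact (continuousOn_homAngle_integrand hs (le_of_lt hx)).aestronglyMeasurable measurableSet_Ioo
    · filter_upwards [self_mem_nhdsWithin] with x hx
      exact (ae_restrict_iff' measurableSet_Ioo).2
        (ae_of_all _ fun u hu => homAngle_integrand_le hs (le_of_lt hx) hu)
    · refine (ae_restrict_iff' measurableSet_Ioo).2 (ae_of_all _ fun u hu => ?_)
      have h1 : Tendsto (fun x : ℝ => 1 - u ^ 2 + x * (1 - u ^ s)) (𝓝[>] 0) (𝓝 (1 - u ^ 2)) := by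
        have : Continuous (fun x : ℝ => 1 - u ^ 2 + x * (1 - u ^ s)) := by fun_prop
        simpa using (this.tendsto 0).mono_left nhdsWithin_le_nhds
      exact tendsto_const_nhds.div ((Real.continuous_sqrt.tendsto _).comp h1)
        (Real.sqrt_pos.2 (homAngle_integrand_pos hs le_rfl hu).1).ne'
  rw [integral_one_div_sqrt_one_sub_sq] at this
  have h := (this.const_mul 2).const_sub Real.pi
  rwa [mul_div_cancel₀ _ two_ne_zero, sub_self] at h

theorem tendsto_homAngle_atTop (hs : 1 < s) : Tendsto (homAngle s) atTop (𝓝 Real.pi) := by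
  have : Tendsto (fun x => ∫ u in Set.Ioo (0 : ℝ) 1, 1 / Real.sqrt (1 - u ^ 2 + x * (1 - u ^ s)))
      atTop (𝓝 (∫ u in Set.Ioo (0 : ℝ) 1, (0 : ℝ))) := by
    refine tendsto_integral_filter_of_dominated_convergence
      (fun u => 1 / Real.sqrt (1 - u ^ 2)) ?_ ?_ integrableOn_one_div_sqrt_one_sub_sq ?_
    · filter_upwards [eventually_ge_atTop 0] with x hx
      exact (continuousOn_homAngle_integrand hs hx).aestronglyMeasurable measurableSet_Ioo
    · filter_upwards [eventually_ge_atTop 0] with x hx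
      exact (ae_restrict_iff' measurableSet_Ioo).2
        (ae_of_all _ fun u hu => homAngle_integrand_le hs hx hu)
    · refine (ae_restrict_iff' measurableSet_Ioo).2 (ae_of_all _ fun u hu => ?_)
      have h1 : Tendsto (fun x : ℝ => 1 - u ^ 2 + x * (1 - u ^ s)) atTop atTop :=
        tendsto_atTop_add_const_left _ _ (tendsto_id.atTop_mul_const (one_sub_rpow_mem hs hu).1)
      exact tendsto_const_nhds.div_atTop (Real.tendsto_sqrt_atTop.comp h1)
  have h := (this.const_mul 2).const_sub Real.pi
  rw [integral_zero, mul_zero, sub_zero] at h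
  exact h

/-- The limits 0 and π at the two ends, combined with continuity, give all intermediate angles.
Strict monotonicity keeps the end values from being attained. -/
theorem image_homAngle (hs : 1 < s) : homAngle s '' Set.Ioi 0 = Set.Ioo 0 Real.pi := by
  have hm := homAngle_strictMonoOn hs
  have hcont : ContinuousOn (homAngle s) (Set.Ioi 0) := fun x hx => by
    obtain ⟨d, _, h⟩ := exists_hasDerivAt_homAngle hs hx
    exact h.continuousAt.continuousWithinAt
  have h0 := tendsto_homAngle_zero hs
  have h1 := tendsto_homAngle_atTop hs
  refine Set.Subset.antisymm ?_ ?_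
  · rintro _ ⟨x, hx, rfl⟩
    have hx0 : (0 : ℝ) < x := hx
    constructor
    · have h2 : homAngle s (x / 2) < homAngle s x :=
        hm (half_pos hx0) hx (half_lt_self hx0)
      refine lt_of_le_of_lt (le_of_tendsto h0 ?_) h2
      filter_upwards [self_mem_nhdsWithin, nhdsWithin_le_nhds (gt_mem_nhds (half_pos hx0))] with y hy hy'
      exact hm.monotoneOn hy (half_pos hx0) hy'.le
    · have h2 : homAngle s x < homAngle s (x + 1) :=
        hm hx (by simp only [Set.mem_Ioi]; linarith) (by linarith)
      refine lt_of_lt_of_le h2 (ge_of_tendsto h1 ?_)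
      filter_upwards [eventually_ge_atTop (x + 1)] with y hy
      exact hm.monotoneOn (by simp only [Set.mem_Ioi]; linarith) (by simp only [Set.mem_Ioi]; linarith) hy
  · rintro θ ⟨hθ0, hθ1⟩
    obtain ⟨a, ha, ha'⟩ := ((h0.eventually (gt_mem_nhds hθ0)).and self_mem_nhdsWithin).exists
    obtain ⟨b, hb, hb'⟩ := ((h1.eventually (lt_mem_nhds hθ1)).and (eventually_ge_atTop a)).exists
    have ha0 : (0 : ℝ) < a := ha'
    obtain ⟨x, hx, hx'⟩ := intermediate_value_Icc hb'
      (hcont.mono fun y hy => ha0.trans_le hy.1) ⟨ha.le, hb.le⟩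
    exact ⟨x, ha0.trans_le hx.1, hx'⟩

/-- The inverse function of the deflection angle of the potential `c r^{-s}`. -/
def homInverse (c s : ℝ) : ℝ → ℝ :=
  Function.invFunOn (deflection fun r => c * r ^ (-s)) (Set.Ioi 0)

/-- Every impact parameter is of the form `homImpact c s x`, and its angle `homAngle s x` is
strictly increasing in x. -/
theorem injOn_deflection_hom (hs : 1 < s) (hc : 0 < c) :
    Set.InjOn (deflection fun r => c * r ^ (-s)) (Set.Ioi 0) := by
  intro a ha b hb hab
  obtain ⟨x, hx, rfl⟩ := exists_homImpact_eq hs hc ha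
  obtain ⟨y, hy, rfl⟩ := exists_homImpact_eq hs hc hb
  rw [deflection_homImpact hs hc hx, deflection_homImpact hs hc hy] at hab
  rw [(homAngle_strictMonoOn hs).injOn hx hy hab]

theorem homInverse_deflection (hs : 1 < s) (hc : 0 < c) {b : ℝ} (hb : 0 < b) :
    homInverse c s (deflection (fun r => c * r ^ (-s)) b) = b :=
  (injOn_deflection_hom hs hc).leftInvOn_invFunOn hb

theorem deflection_hom_mem (hs : 1 < s) (hc : 0 < c) {b : ℝ} (hb : 0 < b) :
    deflection (fun r => c * r ^ (-s)) b ∈ Set.Ioo 0 Real.pi := by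
  obtain ⟨x, hx, rfl⟩ := exists_homImpact_eq hs hc hb
  rw [deflection_homImpact hs hc hx, ← image_homAngle hs]
  exact ⟨x, hx, rfl⟩

theorem exists_deflection_hom_eq (hs : 1 < s) (hc : 0 < c) {θ : ℝ} (hθ : θ ∈ Set.Ioo 0 Real.pi) :
    ∃ b, 0 < b ∧ deflection (fun r => c * r ^ (-s)) b = θ := by
  rw [← image_homAngle hs] at hθ
  obtain ⟨x, hx, rfl⟩ := hθ
  exact ⟨_, homImpact_pos hc hx, deflection_homImpact hs hc hx⟩

theorem homInverse_pos (hs : 1 < s) (hc : 0 < c) {θ : ℝ} (hθ : θ ∈ Set.Ioo 0 Real.pi) :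
    0 < homInverse c s θ := by
  obtain ⟨b, hb, rfl⟩ := exists_deflection_hom_eq hs hc hθ
  rwa [homInverse_deflection hs hc hb]

theorem deflection_homInverse (hs : 1 < s) (hc : 0 < c) {θ : ℝ} (hθ : θ ∈ Set.Ioo 0 Real.pi) :
    deflection (fun r => c * r ^ (-s)) (homInverse c s θ) = θ := by
  obtain ⟨b, hb, rfl⟩ := exists_deflection_hom_eq hs hc hθ
  rw [homInverse_deflection hs hc hb]

/-- The inverse factors as `homImpact c s` after the inverse of `homAngle s`. The latter is
differentiable since `homAngle` has a positive derivative, and no implicit differentiation of the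
turning point is needed. -/
theorem differentiableAt_homInverse (hs : 1 < s) (hc : 0 < c) {θ : ℝ}
    (hθ : θ ∈ Set.Ioo 0 Real.pi) : DifferentiableAt ℝ (homInverse c s) θ := by
  have hm := homAngle_strictMonoOn hs
  set g := Function.invFunOn (homAngle s) (Set.Ioi 0) with hg
  have hgl : ∀ x ∈ Set.Ioi (0 : ℝ), g (homAngle s x) = x := fun x hx =>
    hm.injOn.leftInvOn_invFunOn hx
  have himg := image_homAngle hs
  have hgr : ∀ t ∈ Set.Ioo 0 Real.pi, g t ∈ Set.Ioi (0 : ℝ) ∧ homAngle s (g t) = t := by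
    intro t ht
    rw [← himg] at ht
    obtain ⟨x, hx, rfl⟩ := ht
    rw [hgl x hx]
    exact ⟨hx, rfl⟩
  have hnhds : Set.Ioo 0 Real.pi ∈ 𝓝 θ := isOpen_Ioo.mem_nhds hθ
  have hgmono : StrictMonoOn g (Set.Ioo 0 Real.pi) := by
    intro a ha b hb hab
    rw [← (hgr a ha).2, ← (hgr b hb).2] at hab
    exact (hm.lt_iff_lt (hgr a ha).1 (hgr b hb).1).1 hab
  have hgimg : g '' Set.Ioo 0 Real.pi = Set.Ioi 0 := by
    refine Set.Subset.antisymm ?_ fun x hx => ?_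
    · rintro _ ⟨t, ht, rfl⟩
      exact (hgr t ht).1
    · exact ⟨homAngle s x, himg ▸ ⟨x, hx, rfl⟩, hgl x hx⟩
  -- A strictly increasing function whose image is a neighbourhood of the value is continuous there.
  have hgc : ContinuousAt g θ := by
    refine hgmono.continuousAt_of_image_mem_nhds hnhds ?_
    rw [hgimg]
    exact Ioi_mem_nhds (hgr θ hθ).1
  have hx0 : (0 : ℝ) < g θ := (hgr θ hθ).1
  obtain ⟨d, hd, hder⟩ := exists_hasDerivAt_homAngle hs hx0
  have hgd : HasDerivAt g d⁻¹ θ := HasDerivAt.of_local_left_inverse hgc hder hd.ne'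
    (by filter_upwards [hnhds] with t ht using (hgr t ht).2)
  have himp : DifferentiableAt ℝ (homImpact c s) (g θ) := by
    unfold homImpact
    have h1 : (1 : ℝ) + g θ ≠ 0 := by positivity
    have h2 : g θ / (1 + g θ) ≠ 0 := by positivity
    have h3 : Real.sqrt (1 + g θ) ≠ 0 := by positivity
    refine DifferentiableAt.div (DifferentiableAt.const_mul (DifferentiableAt.rpow_const
      (DifferentiableAt.div (by fun_prop) (by fun_prop) h1) (Or.inl h2)) _)
      (DifferentiableAt.sqrt (by fun_prop) h1) h3
  have hcomp : DifferentiableAt ℝ (homImpact c s ∘ g) θ := himp.comp θ hgd.differentiableAt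
  refine hcomp.congr_of_eventuallyEq ?_
  filter_upwards [hnhds] with t ht
  obtain ⟨hgt, hgt'⟩ := hgr t ht
  conv_lhs => rw [← hgt', ← deflection_homImpact hs hc hgt]
  exact homInverse_deflection hs hc (homImpact_pos hc hgt)

theorem image_homInverse (hs : 1 < s) (hc : 0 < c) :
    homInverse c s '' Set.Ioo 0 Real.pi = Set.Ioi 0 := by
  refine Set.Subset.antisymm ?_ fun b hb => ?_
  · rintro _ ⟨θ, hθ, rfl⟩
    exact homInverse_pos hs hc hθ
  · exact ⟨_, deflection_hom_mem hs hc hb, homInverse_deflection hs hc hb⟩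

theorem injOn_homInverse (hs : 1 < s) (hc : 0 < c) :
    Set.InjOn (homInverse c s) (Set.Ioo 0 Real.pi) := by
  intro a ha b hb hab
  rw [← deflection_homInverse hs hc ha, ← deflection_homInverse hs hc hb, hab]

/-- The change of variables b = ρ(θ) turns the singular kernel ρ|ρ'| dθ into b db. Integrability is
transferred in both directions, so it can be checked in the impact parameter. -/
theorem integrableOn_homInverse_iff (hs : 1 < s) (hc : 0 < c) (G : ℝ → ℝ) :
    IntegrableOn (fun b => b * G (deflection (fun r => c * r ^ (-s)) b)) (Set.Ioi 0) ↔
      IntegrableOn (fun θ => G θ * (homInverse c s θ * |deriv (homInverse c s) θ|))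
        (Set.Ioo 0 Real.pi) := by
  rw [← image_homInverse hs hc, integrableOn_image_iff_integrableOn_abs_deriv_smul measurableSet_Ioo
    (fun θ hθ => (differentiableAt_homInverse hs hc hθ).hasDerivAt.hasDerivWithinAt)
    (injOn_homInverse hs hc)]
  refine integrableOn_congr_fun (fun θ hθ => ?_) measurableSet_Ioo
  simp only [deflection_homInverse hs hc hθ, smul_eq_mul]
  ring

theorem integral_homInverse (hs : 1 < s) (hc : 0 < c) (G : ℝ → ℝ) :
    ∫ θ in Set.Ioo 0 Real.pi, G θ * (homInverse c s θ * |deriv (homInverse c s) θ|) =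
      ∫ b in Set.Ioi 0, b * G (deflection (fun r => c * r ^ (-s)) b) := by
  rw [← image_homInverse hs hc, integral_image_eq_integral_abs_deriv_smul measurableSet_Ioo
    (fun θ hθ => (differentiableAt_homInverse hs hc hθ).hasDerivAt.hasDerivWithinAt)
    (injOn_homInverse hs hc)]
  refine setIntegral_congr_fun measurableSet_Ioo fun θ hθ => ?_
  simp only [deflection_homInverse hs hc hθ, smul_eq_mul]
  ring

end Homogeneous

/-! ### Relative motion inside the range of a central potential -/

/-- A nonnegative radial potential energy `U` with derivative `U'` in the unit ball, vanishing at
`r = 1`, whose force dominates the potential energy. -/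
structure IsBarrier (U U' : ℝ → ℝ) : Prop where
  deriv : ∀ r ∈ Set.Ioo (0 : ℝ) 1, HasDerivAt U (U' r) r
  cont : ContinuousOn U (Set.Ioi 0)
  nonneg : ∀ r, 0 < r → 0 ≤ U r
  one : U 1 = 0
  virial : ∀ r ∈ Set.Ioo (0 : ℝ) 1, r * U' r ≤ -U r

section Passage

variable {E : Type*} [NormedAddCommGroup E] [InnerProductSpace ℝ E]

/-- Relative position and velocity of a particle pair during the passage through the unit ball. -/
structure IsPassage (U' : ℝ → ℝ) (X V : ℝ → E) (T : ℝ) : Prop where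
  pos : 0 < T
  contX : ContinuousOn X (Set.Icc 0 T)
  contV : ContinuousOn V (Set.Icc 0 T)
  derivX : ∀ t ∈ Set.Ioo 0 T, HasDerivAt X (V t) t
  derivV : ∀ t ∈ Set.Ioo 0 T, HasDerivAt V (-(U' ‖X t‖ / (2 * ‖X t‖)) • X t) t
  lt_one : ∀ t ∈ Set.Ioo 0 T, ‖X t‖ < 1
  ne : ∀ t ∈ Set.Icc 0 T, X t ≠ 0
  init : ‖X 0‖ = 1
  incoming : inner ℝ (X 0) (V 0) < 0

theorem eq_left_of_hasDerivAt_zero {g : ℝ → ℝ} {T : ℝ} (hc : ContinuousOn g (Set.Icc 0 T))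
    (hd : ∀ t ∈ Set.Ioo 0 T, HasDerivAt g 0 t) {t : ℝ} (ht : t ∈ Set.Icc 0 T) : g t = g 0 := by
  rcases ht.1.eq_or_lt with h | h
  · rw [← h]
  obtain ⟨c, _, hc'⟩ := exists_hasDerivAt_eq_slope g (fun _ => 0) h
    (hc.mono (Set.Icc_subset_Icc_right ht.2)) fun x hx => hd x ⟨hx.1, hx.2.trans_le ht.2⟩
  have h2 : t - 0 ≠ 0 := by linarith
  field_simp at hc'
  linarith

theorem hasDerivAt_norm {X : ℝ → E} {v : E} {t : ℝ} (h : HasDerivAt X v t) (h0 : X t ≠ 0) :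
    HasDerivAt (fun τ => ‖X τ‖) (inner ℝ (X t) v / ‖X t‖) t := by
  have h1 := (h.norm_sq).sqrt (pow_ne_zero 2 (norm_ne_zero_iff.2 h0))
  have h2 : (fun τ => Real.sqrt (‖X τ‖ ^ 2)) = fun τ => ‖X τ‖ := by
    ext τ
    exact Real.sqrt_sq (norm_nonneg _)
  rw [h2, Real.sqrt_sq (norm_nonneg _)] at h1
  refine h1.congr_deriv ?_
  have : ‖X t‖ ≠ 0 := norm_ne_zero_iff.2 h0
  field_simp

namespace IsPassage

variable {U U' : ℝ → ℝ} {X V : ℝ → E} {T : ℝ}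

theorem norm_pos (h : IsPassage U' X V T) {t : ℝ} (ht : t ∈ Set.Icc 0 T) : 0 < ‖X t‖ :=
  norm_pos_iff.2 (h.ne t ht)

theorem mem_Ioo (h : IsPassage U' X V T) {t : ℝ} (ht : t ∈ Set.Ioo 0 T) :
    ‖X t‖ ∈ Set.Ioo (0 : ℝ) 1 :=
  ⟨h.norm_pos (Set.Ioo_subset_Icc_self ht), h.lt_one t ht⟩

theorem zero_mem (h : IsPassage U' X V T) : (0 : ℝ) ∈ Set.Icc 0 T := ⟨le_rfl, h.pos.le⟩

theorem right_mem (h : IsPassage U' X V T) : T ∈ Set.Icc 0 T := ⟨h.pos.le, le_rfl⟩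

theorem hasDerivAt_norm (h : IsPassage U' X V T) {t : ℝ} (ht : t ∈ Set.Ioo 0 T) :
    HasDerivAt (fun τ => ‖X τ‖) (inner ℝ (X t) (V t) / ‖X t‖) t :=
  GrazingLimit.hasDerivAt_norm (h.derivX t ht) (h.ne t (Set.Ioo_subset_Icc_self ht))

theorem energy (hU : IsBarrier U U') (h : IsPassage U' X V T) {t : ℝ} (ht : t ∈ Set.Icc 0 T) :
    ‖V t‖ ^ 2 + U ‖X t‖ = ‖V 0‖ ^ 2 := by
  have h0 : ‖V 0‖ ^ 2 = ‖V 0‖ ^ 2 + U ‖X 0‖ := by rw [h.init, hU.one, add_zero]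
  rw [h0]
  refine eq_left_of_hasDerivAt_zero (g := fun t => ‖V t‖ ^ 2 + U ‖X t‖) ?_ (fun t ht => ?_) ht
  · exact (h.contV.norm.pow 2).add (hU.cont.comp h.contX.norm fun t ht => h.norm_pos ht)
  · have h1 := (h.derivV t ht).norm_sq
    have h2 := (hU.deriv _ (h.mem_Ioo ht)).comp t (h.hasDerivAt_norm ht)
    refine (h1.add h2).congr_deriv ?_
    have := (h.mem_Ioo ht).1
    rw [real_inner_smul_right, real_inner_comm]
    field_simp
    ring

/-- The force is parallel to X, so every component of the bivector X ∧ V is conserved. Testing with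
two vectors works in any inner product space. -/
theorem angular (h : IsPassage U' X V T) (a b : E) {t : ℝ} (ht : t ∈ Set.Icc 0 T) :
    inner ℝ (X t) a * inner ℝ (V t) b - inner ℝ (X t) b * inner ℝ (V t) a =
      inner ℝ (X 0) a * inner ℝ (V 0) b - inner ℝ (X 0) b * inner ℝ (V 0) a := by
  refine eq_left_of_hasDerivAt_zero
    (g := fun t => inner ℝ (X t) a * inner ℝ (V t) b - inner ℝ (X t) b * inner ℝ (V t) a)
    ?_ (fun t ht => ?_) ht
  · exact ((h.contX.inner continuousOn_const).mul (h.contV.inner continuousOn_const)).sub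
      ((h.contX.inner continuousOn_const).mul (h.contV.inner continuousOn_const))
  · have hX := h.derivX t ht
    have hV := h.derivV t ht
    have d1 := (hX.inner ℝ (hasDerivAt_const t a)).mul (hV.inner ℝ (hasDerivAt_const t b))
    have d2 := (hX.inner ℝ (hasDerivAt_const t b)).mul (hV.inner ℝ (hasDerivAt_const t a))
    refine (d1.sub d2).congr_deriv ?_
    simp only [inner_zero_right, real_inner_smul_left]
    ring

theorem hasDerivAt_inner (h : IsPassage U' X V T) {t : ℝ} (ht : t ∈ Set.Ioo 0 T) :
    HasDerivAt (fun t => inner ℝ (X t) (V t)) (‖V t‖ ^ 2 - U' ‖X t‖ * ‖X t‖ / 2) t := by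
  refine ((h.derivX t ht).inner ℝ (h.derivV t ht)).congr_deriv ?_
  have := (h.mem_Ioo ht).1
  rw [real_inner_smul_right, real_inner_self_eq_norm_sq, real_inner_self_eq_norm_sq]
  field_simp
  ring

theorem speed_pos (h : IsPassage U' X V T) : 0 < ‖V 0‖ := by
  rw [norm_pos_iff]
  intro h0
  have := h.incoming
  rw [h0, inner_zero_right] at this
  exact lt_irrefl _ this

/-- By the virial inequality -rU'/2 ≥ U/2, and |V|² + U/2 ≥ (|V|² + U)/2, which is half of the
conserved energy. -/
theorem le_deriv_inner (hU : IsBarrier U U') (h : IsPassage U' X V T) {t : ℝ}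
    (ht : t ∈ Set.Ioo 0 T) : ‖V 0‖ ^ 2 / 2 ≤ ‖V t‖ ^ 2 - U' ‖X t‖ * ‖X t‖ / 2 := by
  have h1 := h.energy hU (Set.Ioo_subset_Icc_self ht)
  have h2 := hU.virial _ (h.mem_Ioo ht)
  have h3 := hU.nonneg _ (h.mem_Ioo ht).1
  nlinarith [sq_nonneg ‖V t‖]

theorem continuousOn_inner (h : IsPassage U' X V T) :
    ContinuousOn (fun t => inner ℝ (X t) (V t)) (Set.Icc 0 T) :=
  h.contX.inner h.contV

theorem strictMonoOn_inner (hU : IsBarrier U U') (h : IsPassage U' X V T) :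
    StrictMonoOn (fun t => inner ℝ (X t) (V t)) (Set.Icc 0 T) := by
  refine strictMonoOn_of_deriv_pos (convex_Icc 0 T) h.continuousOn_inner fun t ht => ?_
  rw [interior_Icc] at ht
  rw [(h.hasDerivAt_inner ht).deriv]
  have h1 := h.le_deriv_inner hU ht
  have h2 := h.speed_pos
  have : 0 < ‖V 0‖ ^ 2 / 2 := by positivity
  linarith

theorem speed_le (hU : IsBarrier U U') (h : IsPassage U' X V T) {t : ℝ} (ht : t ∈ Set.Icc 0 T) :
    ‖V t‖ ≤ ‖V 0‖ := by
  have h1 := h.energy hU ht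
  have h2 := hU.nonneg _ (h.norm_pos ht)
  exact le_of_sq_le_sq (by linarith) (norm_nonneg _)

theorem norm_le_one (h : IsPassage U' X V T) {t : ℝ} (ht : t ∈ Set.Icc 0 T) : ‖X t‖ ≤ 1 := by
  have h1 : Set.Icc 0 T ⊆ closure (Set.Ioo 0 T) := by rw [closure_Ioo h.pos.ne]
  have h2 : ContinuousOn (fun t => ‖X t‖) (Set.Icc 0 T) := h.contX.norm
  rcases eq_or_ne t 0 with rfl | h0
  · exact h.init.le
  rcases eq_or_ne t T with rfl | hT
  · have h3 : Tendsto (fun τ => ‖X τ‖) (𝓝[<] t) (𝓝 ‖X t‖) :=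
      ((h2 t ht).mono Set.Ioo_subset_Icc_self).tendsto.mono_left
        (by rw [nhdsWithin_Ioo_eq_nhdsLT h.pos])
    refine le_of_tendsto h3 ?_
    rw [← nhdsWithin_Ioo_eq_nhdsLT h.pos]
    filter_upwards [self_mem_nhdsWithin] with τ hτ using (h.lt_one τ hτ).le
  · exact (h.lt_one t ⟨lt_of_le_of_ne ht.1 h0.symm, lt_of_le_of_ne ht.2 hT⟩).le

/-- The product ⟨X,V⟩ starts at or above -‖V 0‖, cannot exceed ‖V 0‖, and grows at a rate of at
least ‖V 0‖²/2. -/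
theorem time_le (hU : IsBarrier U U') (h : IsPassage U' X V T) : T ≤ 4 / ‖V 0‖ := by
  obtain ⟨c, hc, hc'⟩ := exists_hasDerivAt_eq_slope _ _ h.pos h.continuousOn_inner
    fun t ht => h.hasDerivAt_inner ht
  have h1 := h.le_deriv_inner hU hc
  rw [hc', sub_zero, le_div_iff₀ h.pos] at h1
  have h2 : inner ℝ (X T) (V T) ≤ ‖V 0‖ := by
    calc _ ≤ ‖X T‖ * ‖V T‖ := real_inner_le_norm _ _
      _ ≤ 1 * ‖V 0‖ := mul_le_mul (h.norm_le_one h.right_mem) (h.speed_le hU h.right_mem)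
          (norm_nonneg _) zero_le_one
      _ = _ := one_mul _
  have h3 : -‖V 0‖ ≤ inner ℝ (X 0) (V 0) := by
    have := neg_le_of_abs_le (abs_real_inner_le_norm (X 0) (V 0))
    rwa [h.init, one_mul] at this
  have h4 := h.speed_pos
  rw [le_div_iff₀ h4]
  nlinarith

/-- The squared angular momentum |X|²|V|² - ⟨X,V⟩² is conserved, and conservation of energy removes
|V|². -/
theorem angular_sq (hU : IsBarrier U U') (h : IsPassage U' X V T) {t : ℝ} (ht : t ∈ Set.Icc 0 T) :
    inner ℝ (X t) (V t) ^ 2 =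
      ‖X t‖ ^ 2 * (‖V 0‖ ^ 2 - U ‖X t‖) - (‖V 0‖ ^ 2 - inner ℝ (X 0) (V 0) ^ 2) := by
  have key : ‖X t‖ ^ 2 * ‖V t‖ ^ 2 - inner ℝ (X t) (V t) ^ 2 =
      ‖X 0‖ ^ 2 * ‖V 0‖ ^ 2 - inner ℝ (X 0) (V 0) ^ 2 := by
    refine eq_left_of_hasDerivAt_zero
      (g := fun t => ‖X t‖ ^ 2 * ‖V t‖ ^ 2 - inner ℝ (X t) (V t) ^ 2) ?_ (fun t ht => ?_) ht
    · exact ((h.contX.norm.pow 2).mul (h.contV.norm.pow 2)).sub (h.continuousOn_inner.pow 2)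
    · have d1 := ((h.derivX t ht).norm_sq).mul (h.derivV t ht).norm_sq
      have d2 := (h.hasDerivAt_inner ht).pow 2
      refine (d1.sub d2).congr_deriv ?_
      have := (h.mem_Ioo ht).1
      rw [real_inner_smul_right, real_inner_comm (X t) (V t)]
      field_simp
      ring
  have he := h.energy hU ht
  rw [h.init] at key
  have : ‖V t‖ ^ 2 = ‖V 0‖ ^ 2 - U ‖X t‖ := by linarith
  rw [this] at key
  linarith

/-- Conservation of energy and angular momentum makes the squares at entry and exit equal. Strict
increase of ⟨X,V⟩ leaves only the opposite sign. -/
theorem inner_exit (hU : IsBarrier U U') (h : IsPassage U' X V T) (hT : ‖X T‖ = 1) :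
    inner ℝ (X T) (V T) = -inner ℝ (X 0) (V 0) := by
  have h1 := h.angular_sq hU h.right_mem
  rw [hT, hU.one] at h1
  have h2 : inner ℝ (X 0) (V 0) < inner ℝ (X T) (V T) :=
    h.strictMonoOn_inner hU h.zero_mem h.right_mem h.pos
  have h3 : (inner ℝ (X T) (V T) - inner ℝ (X 0) (V 0)) *
      (inner ℝ (X T) (V T) + inner ℝ (X 0) (V 0)) = 0 := by linarith
  rcases mul_eq_zero.1 h3 with h4 | h4 <;> linarith

/-- The derivative of ⟨X,e⟩/‖X‖ is, up to a power of ‖X‖, a component of the angular momentum that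
vanishes initially. The motion thus stays in its initial plane, without recourse to uniqueness for
the equation. -/
theorem inner_eq_zero (h : IsPassage U' X V T) {e : E} (hX : inner ℝ (X 0) e = 0)
    (hV : inner ℝ (V 0) e = 0) {t : ℝ} (ht : t ∈ Set.Icc 0 T) : inner ℝ (X t) e = 0 := by
  have key : inner ℝ (X t) e / ‖X t‖ = inner ℝ (X 0) e / ‖X 0‖ := by
    refine eq_left_of_hasDerivAt_zero (g := fun t => inner ℝ (X t) e / ‖X t‖) ?_
      (fun t ht => ?_) ht
    · exact (h.contX.inner continuousOn_const).div h.contX.norm fun t ht => (h.norm_pos ht).ne'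
    · have h0 := (h.mem_Ioo ht).1
      have d1 := ((h.derivX t ht).inner ℝ (hasDerivAt_const t e)).div (h.hasDerivAt_norm ht) h0.ne'
      refine d1.congr_deriv ?_
      have h1 := h.angular e (X t) (Set.Ioo_subset_Icc_self ht)
      rw [hX, hV, zero_mul, mul_zero, sub_zero, real_inner_self_eq_norm_sq,
        real_inner_comm (X t) (V t)] at h1
      rw [inner_zero_right, zero_add]
      have h2 : inner ℝ (V t) e * ‖X t‖ - inner ℝ (X t) e * (inner ℝ (X t) (V t) / ‖X t‖) = 0 := by
        field_simp
        linarith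
      rw [h2, zero_div]
  rw [hX, zero_div] at key
  exact (div_eq_zero_iff.1 key).resolve_right (h.norm_pos ht).ne'

theorem inner_velocity_eq_zero (h : IsPassage U' X V T) {e : E} (hX : inner ℝ (X 0) e = 0)
    (hV : inner ℝ (V 0) e = 0) {t : ℝ} (ht : t ∈ Set.Icc 0 T) : inner ℝ (V t) e = 0 := by
  have h1 := h.angular e (X t) ht
  rw [hX, hV, h.inner_eq_zero hX hV ht, zero_mul, mul_zero, zero_mul, sub_zero, zero_sub,
    real_inner_self_eq_norm_sq] at h1
  have := h.norm_pos ht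
  have h2 : ‖X t‖ ^ 2 * inner ℝ (V t) e = 0 := by linarith
  exact (mul_eq_zero.1 h2).resolve_left (by positivity)

end IsPassage

end Passage

/-- An antiderivative is -arcsin(ρ/r). This is the part of the deflection integral outside the unit
ball, where the motion is straight. -/
theorem integrableOn_free_deflection {ρ : ℝ} (h0 : 0 ≤ ρ) (h1 : ρ < 1) :
    IntegrableOn (fun r => ρ / (r ^ 2 * Real.sqrt (1 - ρ ^ 2 / r ^ 2))) (Set.Ioi 1) ∧
      ∫ r in Set.Ioi 1, ρ / (r ^ 2 * Real.sqrt (1 - ρ ^ 2 / r ^ 2)) = Real.arcsin ρ := by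
  have hder : ∀ r ∈ Set.Ici (1 : ℝ), HasDerivAt (fun r => -Real.arcsin (ρ / r))
      (ρ / (r ^ 2 * Real.sqrt (1 - ρ ^ 2 / r ^ 2))) r := by
    intro r hr
    have hr1 : (1 : ℝ) ≤ r := hr
    have hr0 : 0 < r := by linarith
    have h2 : ρ / r < 1 := (div_lt_one hr0).2 (by linarith)
    have h3 : 0 ≤ ρ / r := by positivity
    have h4 := (Real.hasDerivAt_arcsin (x := ρ / r) (by linarith) h2.ne).comp r
      ((hasDerivAt_inv hr0.ne').const_mul ρ)
    refine h4.neg.congr_deriv ?_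
    rw [div_pow]
    have : 0 < 1 - ρ ^ 2 / r ^ 2 := by rw [← div_pow]; nlinarith
    have := Real.sqrt_pos.2 this
    field_simp
  have hlim : Tendsto (fun r : ℝ => -Real.arcsin (ρ / r)) atTop (𝓝 0) := by
    have := (Real.continuous_arcsin.tendsto 0).comp
      (tendsto_const_nhds (x := ρ).div_atTop tendsto_id)
    simpa using this.neg
  have hnn : ∀ r ∈ Set.Ioi (1 : ℝ), 0 ≤ ρ / (r ^ 2 * Real.sqrt (1 - ρ ^ 2 / r ^ 2)) :=
    fun r _ => by positivity
  refine ⟨integrableOn_Ioi_deriv_of_nonneg' hder hnn hlim, ?_⟩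
  rw [integral_Ioi_of_hasDerivAt_of_nonneg' hder hnn hlim]
  simp

theorem image_Ioo_of_strictAntiOn {g : ℝ → ℝ} {a b : ℝ} (hab : a < b)
    (hc : ContinuousOn g (Set.Icc a b)) (hg : StrictAntiOn g (Set.Icc a b)) :
    g '' Set.Ioo a b = Set.Ioo (g b) (g a) := by
  refine Set.Subset.antisymm ?_ (intermediate_value_Ioo' hab.le hc)
  rintro _ ⟨t, ht, rfl⟩
  exact ⟨hg (Set.Ioo_subset_Icc_self ht) (Set.right_mem_Icc.2 hab.le) ht.2,
    hg (Set.left_mem_Icc.2 hab.le) (Set.Ioo_subset_Icc_self ht) ht.1⟩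

theorem image_Ioo_of_strictMonoOn {g : ℝ → ℝ} {a b : ℝ} (hab : a < b)
    (hc : ContinuousOn g (Set.Icc a b)) (hg : StrictMonoOn g (Set.Icc a b)) :
    g '' Set.Ioo a b = Set.Ioo (g a) (g b) := by
  refine Set.Subset.antisymm ?_ (intermediate_value_Ioo hab.le hc)
  rintro _ ⟨t, ht, rfl⟩
  exact ⟨hg (Set.left_mem_Icc.2 hab.le) (Set.Ioo_subset_Icc_self ht) ht.1,
    hg (Set.Ioo_subset_Icc_self ht) (Set.right_mem_Icc.2 hab.le) ht.2⟩

/-! ### The deflection angle as an angle swept by the trajectory. -/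

section Exit

variable {E : Type*} [NormedAddCommGroup E] [InnerProductSpace ℝ E]

namespace IsPassage

variable {U U' : ℝ → ℝ} {X V : ℝ → E} {T : ℝ}

theorem inner_sq_eq (hU : IsBarrier U U') (h : IsPassage U' X V T) {α : ℝ}
    (hα : inner ℝ (X 0) (V 0) = -(‖V 0‖ * Real.cos α)) {t : ℝ} (ht : t ∈ Set.Icc 0 T) :
    inner ℝ (X t) (V t) ^ 2 =
      ‖V 0‖ ^ 2 * ‖X t‖ ^ 2 * radial (fun r => U r / ‖V 0‖ ^ 2) (Real.sin α) ‖X t‖ := by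
  have h1 := h.angular_sq hU ht
  have h2 := h.norm_pos ht
  have h3 := h.speed_pos
  rw [h1, hα, radial, Real.sin_sq]
  field_simp
  ring

/-- On a branch where r = ‖X t‖ is monotone, |dr/dt| = w √radial. Taking r as variable turns the
radial integral into the time integral of the angular velocity w sin α / r². -/
theorem sweep_half (hU : IsBarrier U U') (h : IsPassage U' X V T) {α : ℝ}
    (hα : inner ℝ (X 0) (V 0) = -(‖V 0‖ * Real.cos α)) {a b m : ℝ}
    (hab : Set.Icc a b ⊆ Set.Icc 0 T) (hle : a < b)
    (hne : ∀ t ∈ Set.Ioo a b, inner ℝ (X t) (V t) ≠ 0)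
    (hinj : Set.InjOn (fun t => ‖X t‖) (Set.Ioo a b))
    (himg : (fun t => ‖X t‖) '' Set.Ioo a b = Set.Ioo m 1) :
    IntegrableOn (fun r => Real.sin α / (r ^ 2 *
        Real.sqrt (radial (fun r => U r / ‖V 0‖ ^ 2) (Real.sin α) r))) (Set.Ioo m 1) ∧
      ∫ r in Set.Ioo m 1, Real.sin α / (r ^ 2 *
        Real.sqrt (radial (fun r => U r / ‖V 0‖ ^ 2) (Real.sin α) r)) =
      ∫ t in a..b, ‖V 0‖ * Real.sin α / ‖X t‖ ^ 2 := by
  have hsub : Set.Ioo a b ⊆ Set.Ioo 0 T := by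
    have h1 := hab (Set.left_mem_Icc.2 hle.le)
    have h2 := hab (Set.right_mem_Icc.2 hle.le)
    exact Set.Ioo_subset_Ioo h1.1 h2.2
  have hder : ∀ t ∈ Set.Ioo a b, HasDerivWithinAt (fun t => ‖X t‖)
      (inner ℝ (X t) (V t) / ‖X t‖) (Set.Ioo a b) t :=
    fun t ht => (h.hasDerivAt_norm (hsub ht)).hasDerivWithinAt
  have hpt : Set.EqOn (fun t => |inner ℝ (X t) (V t) / ‖X t‖| • (Real.sin α / (‖X t‖ ^ 2 *
        Real.sqrt (radial (fun r => U r / ‖V 0‖ ^ 2) (Real.sin α) ‖X t‖))))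
      (fun t => ‖V 0‖ * Real.sin α / ‖X t‖ ^ 2) (Set.Ioo a b) := by
    intro t ht
    have h0 := (h.mem_Ioo (hsub ht)).1
    have hw := h.speed_pos
    have hsq := h.inner_sq_eq hU hα (hab (Set.Ioo_subset_Icc_self ht))
    have hm : 0 < |inner ℝ (X t) (V t)| := abs_pos.2 (hne t ht)
    have hF : 0 < radial (fun r => U r / ‖V 0‖ ^ 2) (Real.sin α) ‖X t‖ := by
      have : 0 < inner ℝ (X t) (V t) ^ 2 := by rw [← sq_abs]; positivity
      rw [hsq] at this
      exact (pos_iff_pos_of_mul_pos this).1 (by positivity)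
    have hab' : |inner ℝ (X t) (V t)| = ‖V 0‖ * ‖X t‖ *
        Real.sqrt (radial (fun r => U r / ‖V 0‖ ^ 2) (Real.sin α) ‖X t‖) := by
      rw [← Real.sqrt_sq_eq_abs, hsq, Real.sqrt_mul (by positivity), ← mul_pow,
        Real.sqrt_sq (by positivity)]
    have := Real.sqrt_pos.2 hF
    simp only [smul_eq_mul]
    rw [abs_div, abs_of_pos h0, hab']
    field_simp
  have hcont : ContinuousOn (fun t => ‖V 0‖ * Real.sin α / ‖X t‖ ^ 2) (Set.Icc a b) :=
    continuousOn_const.div ((h.contX.mono hab).norm.pow 2) fun t ht =>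
      pow_ne_zero 2 (h.norm_pos (hab ht)).ne'
  constructor
  · rw [← himg, integrableOn_image_iff_integrableOn_abs_deriv_smul measurableSet_Ioo hder hinj,
      integrableOn_congr_fun hpt measurableSet_Ioo]
    exact hcont.integrableOn_Icc.mono_set Set.Ioo_subset_Icc_self
  · rw [← himg, integral_image_eq_integral_abs_deriv_smul measurableSet_Ioo hder hinj,
      setIntegral_congr_fun measurableSet_Ioo hpt, intervalIntegral.integral_of_le hle.le,
      integral_Ioc_eq_integral_Ioo]

theorem exists_turning_time (hU : IsBarrier U U') (h : IsPassage U' X V T) (hT : ‖X T‖ = 1) :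
    ∃ t ∈ Set.Ioo 0 T, inner ℝ (X t) (V t) = 0 := by
  have h1 := h.incoming
  have h2 := h.inner_exit hU hT
  obtain ⟨t, ht, ht'⟩ := intermediate_value_Ioo h.pos.le h.continuousOn_inner
    (show (0 : ℝ) ∈ Set.Ioo (inner ℝ (X 0) (V 0)) (inner ℝ (X T) (V T)) from
      ⟨h1, by rw [h2]; linarith⟩)
  exact ⟨t, ht, ht'⟩

/-- The angle swept inside the unit ball is the deflection integral over `r < 1`. -/
theorem deflection_eq_sweep (hU : IsBarrier U U') (hU1 : ∀ r, 1 ≤ r → U r = 0)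
    (hanti : AntitoneOn U (Set.Ioi 0)) (h : IsPassage U' X V T) (hT : ‖X T‖ = 1) {α : ℝ}
    (hα0 : 0 ≤ α) (hα1 : α < Real.pi / 2)
    (hα : inner ℝ (X 0) (V 0) = -(‖V 0‖ * Real.cos α)) :
    deflection (fun r => U r / ‖V 0‖ ^ 2) (Real.sin α) =
      Real.pi - 2 * α - ∫ t in (0 : ℝ)..T, ‖V 0‖ * Real.sin α / ‖X t‖ ^ 2 := by
  -- In a head-on collision both integrands vanish and both sides equal π.
  rcases hα0.eq_or_lt with rfl | hαp
  · simp [deflection]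
  have hsin0 : 0 < Real.sin α := Real.sin_pos_of_pos_of_lt_pi hαp (by linarith)
  have hsin1 : Real.sin α < 1 := by
    rw [← Real.sin_pi_div_two]
    exact Real.sin_lt_sin_of_lt_of_le_pi_div_two (by linarith) le_rfl hα1
  have hw := h.speed_pos
  set Ψ : ℝ → ℝ := fun r => U r / ‖V 0‖ ^ 2 with hΨ
  -- The zero of ⟨X,V⟩ is the time of closest approach. The incoming and the outgoing branch
  -- contribute the same radial integral, hence the factor 2 in the deflection.
  obtain ⟨t₀, ht₀, hm0⟩ := h.exists_turning_time hU hT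
  have hmono := h.strictMonoOn_inner hU
  have ht₀' := Set.Ioo_subset_Icc_self ht₀
  have hΨanti : AntitoneOn Ψ (Set.Ioi 0) := fun x hx y hy hxy =>
    div_le_div_of_nonneg_right (hanti hx hy hxy) (by positivity)
  have htr : turning Ψ (Real.sin α) = ‖X t₀‖ := by
    refine turning_eq_of_radial_eq_zero hΨanti hsin0 (h.norm_pos ht₀') ?_
    have h1 := h.inner_sq_eq hU hα ht₀'
    have h2 := h.norm_pos ht₀'
    rw [hm0] at h1
    have h3 : ‖V 0‖ ^ 2 * ‖X t₀‖ ^ 2 ≠ 0 := by positivity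
    exact (mul_eq_zero.1 (by linarith : ‖V 0‖ ^ 2 * ‖X t₀‖ ^ 2 * _ = 0)).resolve_left h3
  have hsub1 : Set.Icc 0 t₀ ⊆ Set.Icc 0 T := Set.Icc_subset_Icc_right ht₀.2.le
  have hsub2 : Set.Icc t₀ T ⊆ Set.Icc 0 T := Set.Icc_subset_Icc_left ht₀.1.le
  have hneg : ∀ t ∈ Set.Ioo 0 t₀, inner ℝ (X t) (V t) < 0 := fun t ht => by
    have := hmono (hsub1 (Set.Ioo_subset_Icc_self ht)) ht₀' ht.2
    simp only at this
    rwa [hm0] at this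
  have hpos : ∀ t ∈ Set.Ioo t₀ T, 0 < inner ℝ (X t) (V t) := fun t ht => by
    have := hmono ht₀' (hsub2 (Set.Ioo_subset_Icc_self ht)) ht.1
    simp only at this
    rwa [hm0] at this
  have hanti1 : StrictAntiOn (fun t => ‖X t‖) (Set.Icc 0 t₀) := by
    refine strictAntiOn_of_deriv_neg (convex_Icc _ _) (h.contX.norm.mono hsub1) fun t ht => ?_
    rw [interior_Icc] at ht
    have ht' : t ∈ Set.Ioo 0 T := ⟨ht.1, ht.2.trans ht₀.2⟩
    rw [(h.hasDerivAt_norm ht').deriv]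
    exact div_neg_of_neg_of_pos (hneg t ht) (h.mem_Ioo ht').1
  have hmono2 : StrictMonoOn (fun t => ‖X t‖) (Set.Icc t₀ T) := by
    refine strictMonoOn_of_deriv_pos (convex_Icc _ _) (h.contX.norm.mono hsub2) fun t ht => ?_
    rw [interior_Icc] at ht
    have ht' : t ∈ Set.Ioo 0 T := ⟨ht₀.1.trans ht.1, ht.2⟩
    rw [(h.hasDerivAt_norm ht').deriv]
    exact div_pos (hpos t ht) (h.mem_Ioo ht').1
  obtain ⟨hi, hs1⟩ := h.sweep_half hU hα (m := ‖X t₀‖) hsub1 ht₀.1 (fun t ht => (hneg t ht).ne)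
    (hanti1.injOn.mono Set.Ioo_subset_Icc_self)
    (by rw [image_Ioo_of_strictAntiOn ht₀.1 (h.contX.norm.mono hsub1) hanti1, h.init])
  obtain ⟨_, hs2⟩ := h.sweep_half hU hα (m := ‖X t₀‖) hsub2 ht₀.2 (fun t ht => (hpos t ht).ne')
    (hmono2.injOn.mono Set.Ioo_subset_Icc_self)
    (by rw [image_Ioo_of_strictMonoOn ht₀.2 (h.contX.norm.mono hsub2) hmono2, hT])
  have hcont : ContinuousOn (fun t => ‖V 0‖ * Real.sin α / ‖X t‖ ^ 2) (Set.Icc 0 T) :=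
    continuousOn_const.div (h.contX.norm.pow 2) fun t ht => pow_ne_zero 2 (h.norm_pos ht).ne'
  have hadd := intervalIntegral.integral_add_adjacent_intervals
    ((hcont.mono hsub1).intervalIntegrable_of_Icc ht₀.1.le)
    ((hcont.mono hsub2).intervalIntegrable_of_Icc (μ := volume) ht₀.2.le)
  obtain ⟨hfi, hf⟩ := integrableOn_free_deflection hsin0.le hsin1
  have hfree : Set.EqOn (fun r => Real.sin α / (r ^ 2 * Real.sqrt (radial Ψ (Real.sin α) r)))
      (fun r => Real.sin α / (r ^ 2 * Real.sqrt (1 - Real.sin α ^ 2 / r ^ 2))) (Set.Ioi 1) := by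
    intro r hr
    simp only [radial, hΨ, hU1 r (le_of_lt hr), zero_div, sub_zero]
  have hr1 : ‖X t₀‖ < 1 := h.lt_one t₀ ht₀
  have hsplit : ∫ r in Set.Ioi ‖X t₀‖, Real.sin α / (r ^ 2 * Real.sqrt (radial Ψ (Real.sin α) r)) =
      (∫ r in Set.Ioo ‖X t₀‖ 1, Real.sin α / (r ^ 2 * Real.sqrt (radial Ψ (Real.sin α) r))) +
      ∫ r in Set.Ioi 1, Real.sin α / (r ^ 2 * Real.sqrt (radial Ψ (Real.sin α) r)) := by
    rw [← integral_Ioc_eq_integral_Ioo, ← Set.Ioc_union_Ioi_eq_Ioi hr1.le]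
    refine setIntegral_union (Set.Ioc_disjoint_Ioi le_rfl) measurableSet_Ioi ?_ ?_
    · exact (integrableOn_Ioc_iff_integrableOn_Ioo).2 hi
    · rw [integrableOn_congr_fun hfree measurableSet_Ioi]
      exact hfi
  rw [deflection, htr, hsplit, setIntegral_congr_fun measurableSet_Ioi hfree, hf,
    Real.arcsin_sin (by linarith) hα1.le]
  linarith

theorem eq_planar (h : IsPassage U' X V T) {a b : E} (ha : ‖a‖ = 1) (hb : ‖b‖ = 1)
    (hab : inner ℝ a b = 0) (hX : ∃ x y : ℝ, X 0 = x • a + y • b)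
    (hV : ∃ x y : ℝ, V 0 = x • a + y • b) {t : ℝ} (ht : t ∈ Set.Icc 0 T) :
    X t = inner ℝ (X t) a • a + inner ℝ (X t) b • b ∧
      V t = inner ℝ (V t) a • a + inner ℝ (V t) b • b := by
  have haa : inner ℝ a a = (1 : ℝ) := by rw [real_inner_self_eq_norm_sq, ha]; norm_num
  have hbb : inner ℝ b b = (1 : ℝ) := by rw [real_inner_self_eq_norm_sq, hb]; norm_num
  have hba : inner ℝ b a = (0 : ℝ) := by rw [real_inner_comm, hab]
  obtain ⟨x₁, y₁, hX⟩ := hX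
  obtain ⟨x₂, y₂, hV⟩ := hV
  have hperp : ∀ z : E, inner ℝ z a = (0 : ℝ) → inner ℝ z b = (0 : ℝ) →
      inner ℝ (X t) z = 0 ∧ inner ℝ (V t) z = 0 := by
    intro z h1 h2
    have h3 : inner ℝ (X 0) z = 0 := by
      rw [hX, inner_add_left, real_inner_smul_left, real_inner_smul_left, real_inner_comm, h1,
        real_inner_comm, h2]
      ring
    have h4 : inner ℝ (V 0) z = 0 := by
      rw [hV, inner_add_left, real_inner_smul_left, real_inner_smul_left, real_inner_comm, h1,
        real_inner_comm, h2]
      ring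
    exact ⟨h.inner_eq_zero h3 h4 ht, h.inner_velocity_eq_zero h3 h4 ht⟩
  have hproj : ∀ y : E, (∀ z : E, inner ℝ z a = (0 : ℝ) → inner ℝ z b = (0 : ℝ) →
      inner ℝ y z = (0 : ℝ)) → y = inner ℝ y a • a + inner ℝ y b • b := by
    intro y hy
    set e := y - (inner ℝ y a • a + inner ℝ y b • b) with he
    have h1 : inner ℝ e a = (0 : ℝ) := by
      simp only [he, inner_sub_left, inner_add_left, real_inner_smul_left, haa, hba]
      ring
    have h2 : inner ℝ e b = (0 : ℝ) := by
      simp only [he, inner_sub_left, inner_add_left, real_inner_smul_left, hbb, hab]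
      ring
    have h3 : inner ℝ e e = (0 : ℝ) := by
      conv_lhs => rw [he, inner_sub_left, inner_add_left, real_inner_smul_left,
        real_inner_smul_left, real_inner_comm e a, real_inner_comm e b, ← he, h1, h2]
      rw [hy e h1 h2]
      ring
    exact sub_eq_zero.1 (inner_self_eq_zero.1 h3)
  exact ⟨hproj _ fun z h1 h2 => (hperp z h1 h2).1, hproj _ fun z h1 h2 => (hperp z h1 h2).2⟩

/-- The outgoing relative velocity is the incoming one, rotated by the deflection angle. -/
theorem velocity_exit (hU : IsBarrier U U') (hU1 : ∀ r, 1 ≤ r → U r = 0)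
    (hanti : AntitoneOn U (Set.Ioi 0)) (h : IsPassage U' X V T) (hT : ‖X T‖ = 1) {α : ℝ}
    (hα0 : 0 ≤ α) (hα1 : α < Real.pi / 2) {a b : E} (ha : ‖a‖ = 1) (hb : ‖b‖ = 1)
    (hab : inner ℝ a b = 0) (hX : X 0 = -Real.cos α • a + Real.sin α • b)
    (hV : V 0 = ‖V 0‖ • a) :
    V T = (‖V 0‖ * Real.cos (deflection (fun r => U r / ‖V 0‖ ^ 2) (Real.sin α))) • a +
      (‖V 0‖ * Real.sin (deflection (fun r => U r / ‖V 0‖ ^ 2) (Real.sin α))) • b := by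
  have haa : inner ℝ a a = (1 : ℝ) := by rw [real_inner_self_eq_norm_sq, ha]; norm_num
  have hbb : inner ℝ b b = (1 : ℝ) := by rw [real_inner_self_eq_norm_sq, hb]; norm_num
  have hba : inner ℝ b a = (0 : ℝ) := by rw [real_inner_comm, hab]
  have hXa : inner ℝ (X 0) a = -Real.cos α := by
    rw [hX, inner_add_left, real_inner_smul_left, real_inner_smul_left, haa, hba]; ring
  have hXb : inner ℝ (X 0) b = Real.sin α := by
    rw [hX, inner_add_left, real_inner_smul_left, real_inner_smul_left, hab, hbb]; ring
  have hVa : inner ℝ (V 0) a = ‖V 0‖ := by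
    conv_lhs => rw [hV]
    rw [real_inner_smul_left, haa, mul_one]
  have hVb : inner ℝ (V 0) b = 0 := by
    conv_lhs => rw [hV]
    rw [real_inner_smul_left, hab, mul_zero]
  have hα : inner ℝ (X 0) (V 0) = -(‖V 0‖ * Real.cos α) := by
    conv_lhs => rw [hV]
    rw [real_inner_smul_right, hXa]
    ring
  have hplan := fun t ht => h.eq_planar ha hb hab ⟨_, _, hX⟩ ⟨‖V 0‖, 0, by rw [zero_smul, add_zero]; exact hV⟩
    (t := t) ht
  set w := ‖V 0‖ with hw
  have hL : ∀ t ∈ Set.Icc 0 T, inner ℝ (X t) a * inner ℝ (V t) b -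
      inner ℝ (X t) b * inner ℝ (V t) a = -(w * Real.sin α) := by
    intro t ht
    rw [h.angular a b ht, hXa, hXb, hVa, hVb]
    ring
  have hm : ∀ t ∈ Set.Icc 0 T, inner ℝ (X t) (V t) =
      inner ℝ (X t) a * inner ℝ (V t) a + inner ℝ (X t) b * inner ℝ (V t) b := by
    intro t ht
    conv_lhs => rw [(hplan t ht).2]
    rw [inner_add_right, real_inner_smul_right, real_inner_smul_right]
    ring
  have hr2 : ∀ t ∈ Set.Icc 0 T, ‖X t‖ ^ 2 = inner ℝ (X t) a ^ 2 + inner ℝ (X t) b ^ 2 := by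
    intro t ht
    rw [← real_inner_self_eq_norm_sq]
    conv_lhs => rw [(hplan t ht).1]
    simp only [inner_add_left, inner_add_right, real_inner_smul_left, real_inner_smul_right,
      haa, hbb, hab, hba]
    ring
  -- The candidate for the polar angle of X in the plane of a and b: it starts at π - α and
  -- decreases with the angular velocity w sin α / r².
  set φ : ℝ → ℝ := fun t => Real.pi - α - ∫ τ in (0 : ℝ)..t, w * Real.sin α / ‖X τ‖ ^ 2 with hφ
  have hcont : ContinuousOn (fun t => w * Real.sin α / ‖X t‖ ^ 2) (Set.Icc 0 T) :=
    continuousOn_const.div (h.contX.norm.pow 2) fun t ht => pow_ne_zero 2 (h.norm_pos ht).ne'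
  have hint : IntervalIntegrable (fun t => w * Real.sin α / ‖X t‖ ^ 2) volume 0 T :=
    hcont.intervalIntegrable_of_Icc h.pos.le
  have hφc : ContinuousOn φ (Set.Icc 0 T) := by
    refine continuousOn_const.sub ?_
    have := intervalIntegral.continuousOn_primitive_interval' hint Set.left_mem_uIcc
    rwa [Set.uIcc_of_le h.pos.le] at this
  have hφd : ∀ t ∈ Set.Ioo 0 T, HasDerivAt φ (-(w * Real.sin α / ‖X t‖ ^ 2)) t := by
    intro t ht
    have hco := hcont.mono Set.Ioo_subset_Icc_self
    refine (intervalIntegral.integral_hasDerivAt_right (hint.mono_set ?_)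
      (hco.stronglyMeasurableAtFilter isOpen_Ioo t ht)
      (hco.continuousAt (isOpen_Ioo.mem_nhds ht))).const_sub _
    rw [Set.uIcc_of_le ht.1.le, Set.uIcc_of_le h.pos.le]
    exact Set.Icc_subset_Icc_right ht.2.le
  have hφ0 : φ 0 = Real.pi - α := by simp [hφ]
  have hPc : ContinuousOn (fun t => inner ℝ (X t) a) (Set.Icc 0 T) :=
    h.contX.inner continuousOn_const
  have hQc : ContinuousOn (fun t => inner ℝ (X t) b) (Set.Icc 0 T) :=
    h.contX.inner continuousOn_const
  have hd : ∀ t ∈ Set.Ioo 0 T, ∀ e : E, HasDerivAt (fun t => inner ℝ (X t) e) (inner ℝ (V t) e) t := by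
    intro t ht e
    refine ((h.derivX t ht).inner ℝ (hasDerivAt_const t e)).congr_deriv ?_
    rw [inner_zero_right, zero_add]
  have hne : ∀ t ∈ Set.Icc 0 T, ‖X t‖ ≠ 0 := fun t ht => (h.norm_pos ht).ne'
  -- The two coordinates of X/‖X‖ in the frame rotating with φ are constant in time. Hence X(T) has
  -- polar angle φ(T), and no choice of a branch of the argument is needed.
  have hA : (inner ℝ (X T) a * Real.cos (φ T) + inner ℝ (X T) b * Real.sin (φ T)) / ‖X T‖ =
      (inner ℝ (X 0) a * Real.cos (φ 0) + inner ℝ (X 0) b * Real.sin (φ 0)) / ‖X 0‖ := by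
    refine eq_left_of_hasDerivAt_zero (g := fun t =>
      (inner ℝ (X t) a * Real.cos (φ t) + inner ℝ (X t) b * Real.sin (φ t)) / ‖X t‖) ?_
      (fun t ht => ?_) h.right_mem
    · exact (((hPc.mul (Real.continuous_cos.comp_continuousOn hφc)).add
        (hQc.mul (Real.continuous_sin.comp_continuousOn hφc)))).div h.contX.norm hne
    · have ht' := Set.Ioo_subset_Icc_self ht
      have d := ((((hd t ht a).mul (hφd t ht).cos).add ((hd t ht b).mul (hφd t ht).sin))).div
        (h.hasDerivAt_norm ht) (hne t ht')
      refine d.congr_deriv ?_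
      have h0 := (h.mem_Ioo ht).1
      have e1 := hL t ht'
      have e2 := hr2 t ht'
      rw [hm t ht']
      simp only [Pi.mul_apply, Pi.add_apply]
      generalize inner ℝ (X t) a = P at *
      generalize inner ℝ (X t) b = Q at *
      generalize inner ℝ (V t) a = p at *
      generalize inner ℝ (V t) b = q at *
      generalize ‖X t‖ = r at *
      rw [show w * Real.sin α = Q * p - P * q by linarith]
      field_simp
      rw [e2]
      ring
  have hB : (inner ℝ (X T) b * Real.cos (φ T) - inner ℝ (X T) a * Real.sin (φ T)) / ‖X T‖ =
      (inner ℝ (X 0) b * Real.cos (φ 0) - inner ℝ (X 0) a * Real.sin (φ 0)) / ‖X 0‖ := by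
    refine eq_left_of_hasDerivAt_zero (g := fun t =>
      (inner ℝ (X t) b * Real.cos (φ t) - inner ℝ (X t) a * Real.sin (φ t)) / ‖X t‖) ?_
      (fun t ht => ?_) h.right_mem
    · exact (((hQc.mul (Real.continuous_cos.comp_continuousOn hφc)).sub
        (hPc.mul (Real.continuous_sin.comp_continuousOn hφc)))).div h.contX.norm hne
    · have ht' := Set.Ioo_subset_Icc_self ht
      have d := ((((hd t ht b).mul (hφd t ht).cos).sub ((hd t ht a).mul (hφd t ht).sin))).div
        (h.hasDerivAt_norm ht) (hne t ht')
      refine d.congr_deriv ?_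
      have h0 := (h.mem_Ioo ht).1
      have e1 := hL t ht'
      have e2 := hr2 t ht'
      rw [hm t ht']
      simp only [Pi.mul_apply, Pi.sub_apply]
      generalize inner ℝ (X t) a = P at *
      generalize inner ℝ (X t) b = Q at *
      generalize inner ℝ (V t) a = p at *
      generalize inner ℝ (V t) b = q at *
      generalize ‖X t‖ = r at *
      rw [show w * Real.sin α = Q * p - P * q by linarith]
      field_simp
      rw [e2]
      ring
  rw [hT, h.init, hφ0, hXa, hXb, Real.cos_pi_sub, Real.sin_pi_sub, div_one, div_one] at hA hB
  have hcs := Real.sin_sq_add_cos_sq α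
  have hcs' := Real.sin_sq_add_cos_sq (φ T)
  have hA' : inner ℝ (X T) a * Real.cos (φ T) + inner ℝ (X T) b * Real.sin (φ T) = 1 := by
    rw [hA]; linarith
  have hB' : inner ℝ (X T) b * Real.cos (φ T) - inner ℝ (X T) a * Real.sin (φ T) = 0 := by
    rw [hB]; ring
  have hP : inner ℝ (X T) a = Real.cos (φ T) := by
    linear_combination Real.cos (φ T) * hA' - Real.sin (φ T) * hB' - inner ℝ (X T) a * hcs'
  have hQ : inner ℝ (X T) b = Real.sin (φ T) := by
    linear_combination Real.sin (φ T) * hA' + Real.cos (φ T) * hB' - inner ℝ (X T) b * hcs'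
  have e1 := hL T h.right_mem
  have e2 := hm T h.right_mem
  rw [h.inner_exit hU hT, hα, hP, hQ] at e2
  rw [hP, hQ] at e1
  have hθ : deflection (fun r => U r / w ^ 2) (Real.sin α) = φ T - α := by
    rw [h.deflection_eq_sweep hU hU1 hanti hT hα0 hα1 hα]
    ring
  -- At the exit the radial component of V is w cos α and the tangential one is -w sin α. So V(T)
  -- has length w and polar angle φ(T) - α, which is the deflection.
  have hva : inner ℝ (V T) a = w * Real.cos (φ T - α) := by
    rw [Real.cos_sub]
    linear_combination -Real.cos (φ T) * e2 - Real.sin (φ T) * e1 - inner ℝ (V T) a * hcs'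
  have hvb : inner ℝ (V T) b = w * Real.sin (φ T - α) := by
    rw [Real.sin_sub]
    linear_combination -Real.sin (φ T) * e2 + Real.cos (φ T) * e1 - inner ℝ (V T) b * hcs'
  rw [hθ, ← hva, ← hvb]
  exact (hplan T h.right_mem).2

end IsPassage

end Exit

/-! ### The gradient of the pair potential -/

section Force

variable {f : ℝ → ℝ} {s ε : ℝ}

theorem shortRange_eventuallyEq {r : ℝ} (hr : r ∈ Set.Ioo (0 : ℝ) 1) :
    shortRange f s =ᶠ[𝓝 r] fun r => f r * r ^ (-s) := by
  filter_upwards [isOpen_Ioo.mem_nhds hr] with x hx using shortRange_eq hx.1 hx.2.le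

theorem hasDerivAt_shortRange (hf : IsProfile f) {r : ℝ} (hr : r ∈ Set.Ioo (0 : ℝ) 1) :
    HasDerivAt (shortRange f s) (deriv f r * r ^ (-s) + f r * (-s * r ^ (-s - 1))) r := by
  have h1 := (hf.differentiableAt hr).hasDerivAt.mul
    (Real.hasDerivAt_rpow_const (p := -s) (Or.inl hr.1.ne'))
  exact h1.congr_of_eventuallyEq (shortRange_eventuallyEq hr)

theorem IsProfile.deriv_nonpos (hf : IsProfile f) {r : ℝ} (hr : r ∈ Set.Ioo (0 : ℝ) 1) :
    deriv f r ≤ 0 := by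
  have h1 : derivWithin f (Set.Ioo 0 1) r ≤ 0 :=
    (hf.decreasing.mono Set.Ioo_subset_Icc_self).derivWithin_nonpos
  rwa [derivWithin_of_isOpen isOpen_Ioo hr] at h1

theorem shortRange_nonneg (hf : IsProfile f) {r : ℝ} (hr : 0 < r) : 0 ≤ shortRange f s r := by
  rcases le_total r 1 with h1 | h1
  · rw [shortRange_eq hr h1]
    exact mul_nonneg (hf.nonneg ⟨hr.le, h1⟩) (Real.rpow_nonneg hr.le _)
  · rw [shortRange_eq_zero hf h1]

/-- The relative acceleration is -2∇Φ, so the conserved quantity is |V|² + 4Φ; this is the factor 4.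
For the virial inequality, rU' = 4ε r^{-s}(r f' - s f) with f' ≤ 0, f ≥ 0 and s ≥ 1. -/
theorem isBarrier_shortRange (hs : 1 < s) (hf : IsProfile f) (hε : 0 < ε) :
    IsBarrier (fun r => 4 * (ε * shortRange f s r))
      (fun r => 4 * (ε * (deriv f r * r ^ (-s) + f r * (-s * r ^ (-s - 1))))) where
  deriv r hr := ((hasDerivAt_shortRange hf hr).const_mul ε).const_mul 4
  cont := by
    obtain ⟨C, hC⟩ := exists_isRepulsive_shortRange hs hf
    exact continuousOn_const.mul (continuousOn_const.mul hC.cont)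
  nonneg r hr := by
    have := shortRange_nonneg (s := s) hf hr
    positivity
  one := by rw [shortRange_eq_zero hf le_rfl]; ring
  virial r hr := by
    rw [shortRange_eq hr.1 hr.2.le, Real.rpow_sub_one hr.1.ne']
    have h1 := hf.deriv_nonpos hr
    have h2 := hf.nonneg (Set.Ioo_subset_Icc_self hr)
    have h3 := Real.rpow_pos_of_pos hr.1 (-s)
    have hr0 := hr.1
    have e : r * (4 * (ε * (deriv f r * r ^ (-s) + f r * (-s * (r ^ (-s) / r))))) =
        4 * ε * (r ^ (-s) * (r * deriv f r - s * f r)) := by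
      field_simp
      ring
    rw [e]
    have h4 : r * deriv f r - s * f r ≤ -f r := by nlinarith
    have h5 : r ^ (-s) * (r * deriv f r - s * f r) ≤ r ^ (-s) * -f r :=
      mul_le_mul_of_nonneg_left h4 h3.le
    have h6 := mul_le_mul_of_nonneg_left h5 (by positivity : 0 ≤ 4 * ε)
    linarith

theorem hasGradientAt_radial {g : ℝ → ℝ} {g' : ℝ} {x : E3} (hx : x ≠ 0)
    (hg : HasDerivAt g g' ‖x‖) : HasGradientAt (fun x : E3 => g ‖x‖) ((g' / ‖x‖) • x) x := by
  rw [hasGradientAt_iff_hasFDerivAt]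
  have hn : ‖x‖ ≠ 0 := norm_ne_zero_iff.2 hx
  have h1 : HasFDerivAt (fun x : E3 => ‖x‖) (‖x‖⁻¹ • innerSL ℝ x) x := by
    have := ((hasStrictFDerivAt_norm_sq x).hasFDerivAt).sqrt (pow_ne_zero 2 hn)
    have h2 : (fun y : E3 => Real.sqrt (‖y‖ ^ 2)) = fun y => ‖y‖ := by
      ext y
      exact Real.sqrt_sq (norm_nonneg _)
    rw [h2, Real.sqrt_sq (norm_nonneg _)] at this
    refine this.congr_fderiv ?_
    ext y
    simp
    field_simp
  have h3 := hg.comp_hasFDerivAt x h1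
  refine h3.congr_fderiv ?_
  ext y
  simp
  field_simp

/-- The derivative of `4 ε φ`, the potential energy of the relative motion. -/
def slope (f : ℝ → ℝ) (s ε r : ℝ) : ℝ :=
  4 * (ε * (deriv f r * r ^ (-s) + f r * (-s * r ^ (-s - 1))))

theorem gradient_pairPotential (hf : IsProfile f) {x : E3} (hx : x ≠ 0) (hx1 : ‖x‖ < 1) :
    gradient (fun x => ε * pairPotential f s x) x = (slope f s ε ‖x‖ / (4 * ‖x‖)) • x := by
  have h := hasGradientAt_radial hx ((hasDerivAt_shortRange (s := s) hf
    ⟨norm_pos_iff.2 hx, hx1⟩).const_mul ε)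
  have h2 := h.gradient
  simp only [pairPotential]
  rw [h2]
  congr 1
  have : ‖x‖ ≠ 0 := norm_ne_zero_iff.2 hx
  rw [slope]
  field_simp

theorem gradient_pairPotential_eq_zero (hf : IsProfile f) {x : E3} (hx1 : 1 < ‖x‖) :
    gradient (fun x => ε * pairPotential f s x) x = 0 := by
  have h : (fun x => ε * pairPotential f s x) =ᶠ[𝓝 x] fun _ => 0 := by
    filter_upwards [(isOpen_lt continuous_const continuous_norm).mem_nhds hx1] with y hy
    rw [pairPotential, shortRange_eq_zero hf (le_of_lt hy), mul_zero]
  rw [h.gradient_eq]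
  simp

/-- The potential is even. The rule for composition with a linear equivalence requires no
differentiability, so the forces are opposite even where `gradient` takes its default value, and
momentum is conserved at all times. -/
theorem gradient_pairPotential_neg (x : E3) :
    gradient (fun x => ε * pairPotential f s x) (-x) =
      -gradient (fun x => ε * pairPotential f s x) x := by
  have h : (fun x => ε * pairPotential f s x) = fun x => (fun x => ε * pairPotential f s x) (-x) := by
    ext x
    simp [pairPotential]
  have h2 : fderiv ℝ (fun x => ε * pairPotential f s x) x =
      -fderiv ℝ (fun x => ε * pairPotential f s x) (-x) := by
    have h3 := (ContinuousLinearEquiv.neg ℝ (M := E3)).comp_right_fderiv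
      (f := fun x => ε * pairPotential f s x) (x := x)
    conv_lhs => rw [h]
    refine h3.trans ?_
    ext y
    simp
  simp only [gradient]
  rw [h2]
  simp

theorem continuousOn_slope (hf : IsProfile f) : ContinuousOn (slope f s ε) (Set.Ioo 0 1) := by
  have h1 : ContinuousOn f (Set.Ioo 0 1) := hf.continuous.mono Set.Ioo_subset_Icc_self
  have h2 : ContinuousOn (deriv f) (Set.Ioo 0 1) :=
    hf.smooth.continuousOn_deriv_of_isOpen isOpen_Ioo (by simp)
  have h3 : ∀ p : ℝ, ContinuousOn (fun r : ℝ => r ^ p) (Set.Ioo 0 1) := fun p =>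
    continuousOn_id.rpow_const fun x hx => Or.inl (ne_of_gt hx.1)
  have h4 := h3 (-s)
  have h5 := h3 (-s - 1)
  unfold slope
  fun_prop

/-! ### Lipschitz extension of the force -/

theorem lipschitzOnWith_smul {α F : Type*} [PseudoMetricSpace α] [NormedAddCommGroup F]
    [NormedSpace ℝ F] {g : α → ℝ} {h : α → F} {t : Set α} {K L A B : NNReal}
    (hg : LipschitzOnWith K g t) (hh : LipschitzOnWith L h t) (hA : ∀ x ∈ t, |g x| ≤ A)
    (hB : ∀ x ∈ t, ‖h x‖ ≤ B) : LipschitzOnWith (A * L + K * B) (fun x => g x • h x) t := by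
  refine LipschitzOnWith.of_dist_le_mul fun x hx y hy => ?_
  have h1 := hg.dist_le_mul x hx y hy
  have h2 := hh.dist_le_mul x hx y hy
  rw [dist_eq_norm] at h1 h2 ⊢
  have e : g x • h x - g y • h y = g x • (h x - h y) + (g x - g y) • h y := by
    rw [smul_sub, sub_smul]; abel
  rw [e]
  push_cast
  calc ‖g x • (h x - h y) + (g x - g y) • h y‖ ≤ |g x| * ‖h x - h y‖ + ‖g x - g y‖ * ‖h y‖ := by
        refine (norm_add_le _ _).trans ?_
        rw [norm_smul, norm_smul, Real.norm_eq_abs]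
    _ ≤ A * (L * dist x y) + (K * dist x y) * B := by
        gcongr
        · exact hA x hx
        · exact hB y hy
    _ = _ := by ring

theorem IsProfile.exists_lipschitzOnWith (hf : IsProfile f) :
    (∃ K A : NNReal, LipschitzOnWith K f (Set.Ioo 0 1) ∧ ∀ r ∈ Set.Ioo (0 : ℝ) 1, |f r| ≤ A) ∧
    ∃ K A : NNReal, LipschitzOnWith K (deriv f) (Set.Ioo 0 1) ∧
      ∀ r ∈ Set.Ioo (0 : ℝ) 1, |deriv f r| ≤ A := by
  have hb : ∀ k, ∃ C : NNReal, ∀ r ∈ Set.Ioo (0 : ℝ) 1, |iteratedDeriv k f r| ≤ C := by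
    intro k
    obtain ⟨C, hC⟩ := hf.bounded k
    exact ⟨C.toNNReal, fun r hr => (hC r hr).trans (Real.le_coe_toNNReal C)⟩
  obtain ⟨C0, h0⟩ := hb 0
  obtain ⟨C1, h1⟩ := hb 1
  obtain ⟨C2, h2⟩ := hb 2
  rw [iteratedDeriv_zero] at h0
  rw [iteratedDeriv_one] at h1
  rw [iteratedDeriv_succ, iteratedDeriv_one] at h2
  have hd : ContDiffOn ℝ 1 (deriv f) (Set.Ioo 0 1) :=
    hf.smooth.deriv_of_isOpen isOpen_Ioo (by norm_cast)
  refine ⟨⟨C1, C0, ?_, h0⟩, C2, C1, ?_, h1⟩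
  · refine Convex.lipschitzOnWith_of_nnnorm_deriv_le (fun x hx => hf.differentiableAt hx)
      (fun x hx => ?_) (convex_Ioo 0 1)
    exact_mod_cast h1 x hx
  · refine Convex.lipschitzOnWith_of_nnnorm_deriv_le (fun x hx => ?_)
      (fun x hx => ?_) (convex_Ioo 0 1)
    · exact (hd.differentiableOn (by simp)).differentiableAt (isOpen_Ioo.mem_nhds hx)
    · exact_mod_cast h2 x hx

theorem exists_lipschitzOnWith_rpow (p : ℝ) {r₀ : ℝ} (hr₀ : 0 < r₀) :
    ∃ K A : NNReal, LipschitzOnWith K (fun r : ℝ => r ^ p) (Set.Ioo r₀ 1) ∧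
      ∀ r ∈ Set.Ioo r₀ 1, |r ^ p| ≤ A := by
  have hcont : ∀ q : ℝ, ∃ A : NNReal, ∀ r ∈ Set.Icc r₀ 1, ‖r ^ q‖ ≤ A := by
    intro q
    obtain ⟨A, hA⟩ := isCompact_Icc.exists_bound_of_continuousOn (f := fun r : ℝ => r ^ q)
      (s := Set.Icc r₀ 1) (continuousOn_id.rpow_const fun x hx => Or.inl (hr₀.trans_le hx.1).ne')
    exact ⟨A.toNNReal, fun r hr => (hA r hr).trans (Real.le_coe_toNNReal A)⟩
  obtain ⟨A, hA⟩ := hcont p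
  obtain ⟨B, hB⟩ := hcont (p - 1)
  refine ⟨‖p‖₊ * B, A, ?_, fun r hr => hA r (Set.Ioo_subset_Icc_self hr)⟩
  refine Convex.lipschitzOnWith_of_nnnorm_deriv_le (fun x hx => ?_) (fun x hx => ?_)
    (convex_Ioo r₀ 1)
  · exact (Real.hasDerivAt_rpow_const (Or.inl (hr₀.trans hx.1).ne')).differentiableAt
  · rw [(Real.hasDerivAt_rpow_const (p := p) (Or.inl (hr₀.trans hx.1).ne')).deriv, nnnorm_mul]
    exact mul_le_mul_right (by exact_mod_cast hB x (Set.Ioo_subset_Icc_self hx)) _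

/-- A spherical shell is not convex, so the mean value inequality is applied to scalar functions on
the interval (r₀,1). These are composed with the norm, and the force is assembled from products of
bounded Lipschitz functions. -/
theorem exists_lipschitzOnWith_force (hf : IsProfile f) {r₀ : ℝ} (hr₀ : 0 < r₀) :
    ∃ K : NNReal, LipschitzOnWith K (fun x : E3 => -(slope f s ε ‖x‖ / (2 * ‖x‖)) • x)
      {x : E3 | ‖x‖ ∈ Set.Ioo r₀ 1} := by
  obtain ⟨⟨K₀, A₀, hK₀, hA₀⟩, K₁, A₁, hK₁, hA₁⟩ := hf.exists_lipschitzOnWith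
  obtain ⟨K₂, A₂, hK₂, hA₂⟩ := exists_lipschitzOnWith_rpow (-s - 1) hr₀
  obtain ⟨K₃, A₃, hK₃, hA₃⟩ := exists_lipschitzOnWith_rpow (-s - 2) hr₀
  have hsub : Set.Ioo r₀ 1 ⊆ Set.Ioo (0 : ℝ) 1 := Set.Ioo_subset_Ioo_left hr₀.le
  have h1 := lipschitzOnWith_smul (hK₁.mono hsub) hK₂ (fun x hx => hA₁ x (hsub hx)) hA₂
  have h2 := lipschitzOnWith_smul (hK₀.mono hsub) hK₃ (fun x hx => hA₀ x (hsub hx)) hA₃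
  have b1 : ∀ r ∈ Set.Ioo r₀ 1, |deriv f r • r ^ (-s - 1)| ≤ (A₁ * A₂ : NNReal) := fun r hr => by
    rw [smul_eq_mul, abs_mul]
    exact mul_le_mul (hA₁ r (hsub hr)) (hA₂ r hr) (abs_nonneg _) A₁.2
  have b2 : ∀ r ∈ Set.Ioo r₀ 1, |f r • r ^ (-s - 2)| ≤ (A₀ * A₃ : NNReal) := fun r hr => by
    rw [smul_eq_mul, abs_mul]
    exact mul_le_mul (hA₀ r (hsub hr)) (hA₃ r hr) (abs_nonneg _) A₀.2
  have hn : LipschitzOnWith 1 (fun x : E3 => ‖x‖) {x : E3 | ‖x‖ ∈ Set.Ioo r₀ 1} :=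
    (lipschitzWith_one_norm).lipschitzOnWith
  have hmaps : Set.MapsTo (fun x : E3 => ‖x‖) {x : E3 | ‖x‖ ∈ Set.Ioo r₀ 1} (Set.Ioo r₀ 1) :=
    fun x hx => hx
  have hid : LipschitzOnWith 1 (fun x : E3 => x) {x : E3 | ‖x‖ ∈ Set.Ioo r₀ 1} :=
    LipschitzWith.id.lipschitzOnWith
  have hB : ∀ x ∈ {x : E3 | ‖x‖ ∈ Set.Ioo r₀ 1}, ‖x‖ ≤ (1 : NNReal) := fun x hx => hx.2.le
  have g1 := lipschitzOnWith_smul (h1.comp hn hmaps) hid (fun x hx => b1 _ hx) hB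
  have g2 := lipschitzOnWith_smul (h2.comp hn hmaps) hid (fun x hx => b2 _ hx) hB
  have hconst : ∀ c : ℝ, LipschitzWith ‖c‖₊ (fun x : E3 => c • x) := fun c => lipschitzWith_smul c
  have k1 := (hconst (-2 * ε)).comp_lipschitzOnWith g1
  have k2 := (hconst (2 * ε * s)).comp_lipschitzOnWith g2
  have heq : ∀ x ∈ {x : E3 | ‖x‖ ∈ Set.Ioo r₀ 1}, ((-2 * ε) • ((deriv f ‖x‖ • ‖x‖ ^ (-s - 1)) • x) +
      (2 * ε * s) • ((f ‖x‖ • ‖x‖ ^ (-s - 2)) • x)) = -(slope f s ε ‖x‖ / (2 * ‖x‖)) • x := by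
    intro x hx
    have hx0 : 0 < ‖x‖ := hr₀.trans hx.1
    simp only [slope]
    rw [smul_smul, smul_smul, ← add_smul]
    congr 1
    have e1 : ‖x‖ ^ (-s) = ‖x‖ ^ (-s - 1) * ‖x‖ := by
      rw [Real.rpow_sub_one hx0.ne']; field_simp
    have e2 : ‖x‖ ^ (-s - 1) = ‖x‖ ^ (-s - 2) * ‖x‖ := by
      rw [show -s - 1 = -s - 2 + 1 by ring, Real.rpow_add_one hx0.ne']
    simp only [smul_eq_mul]
    rw [e1, e2]
    field_simp
    ring
  obtain ⟨K, hK⟩ : ∃ K, LipschitzOnWith K (fun x : E3 =>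
      (-2 * ε) • ((deriv f ‖x‖ • ‖x‖ ^ (-s - 1)) • x) +
      (2 * ε * s) • ((f ‖x‖ • ‖x‖ ^ (-s - 2)) • x)) {x : E3 | ‖x‖ ∈ Set.Ioo r₀ 1} :=
    ⟨_, k1.add k2⟩
  refine ⟨K, LipschitzOnWith.of_dist_le_mul fun x hx y hy => ?_⟩
  rw [← heq x hx, ← heq y hy]
  exact hK.dist_le_mul x hx y hy

theorem lipschitzWith_retraction {F : Type*} [NormedAddCommGroup F] [NormedSpace ℝ F] :
    LipschitzWith 2 (fun x : F => (max 1 ‖x‖)⁻¹ • x) := by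
  refine LipschitzWith.of_dist_le_mul fun x y => ?_
  rw [dist_eq_norm, dist_eq_norm]
  set m := max 1 ‖x‖ with hm
  set n := max 1 ‖y‖ with hn
  have hm1 : 1 ≤ m := le_max_left _ _
  have hn1 : 1 ≤ n := le_max_left _ _
  have hyn : ‖y‖ ≤ n := le_max_right _ _
  have hmn : |n - m| ≤ ‖x - y‖ := by
    have h1 : |n - m| ≤ max |1 - 1| |‖y‖ - ‖x‖| := abs_max_sub_max_le_max _ _ _ _
    simp only [sub_self, abs_zero] at h1
    refine h1.trans (max_le (norm_nonneg _) ?_)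
    rw [← norm_sub_rev y x]
    exact abs_norm_sub_norm_le y x
  have e : m⁻¹ • x - n⁻¹ • y = m⁻¹ • (x - y) + ((n - m) / (m * n)) • y := by
    have : (n - m) / (m * n) = m⁻¹ - n⁻¹ := by field_simp
    rw [this, smul_sub, sub_smul]
    abel
  rw [e]
  refine (norm_add_le _ _).trans ?_
  rw [norm_smul, norm_smul, Real.norm_eq_abs, Real.norm_eq_abs, abs_div, abs_mul, abs_inv,
    abs_of_pos (by linarith : 0 < m), abs_of_pos (by linarith : 0 < n)]
  have h1 : m⁻¹ * ‖x - y‖ ≤ ‖x - y‖ :=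
    mul_le_of_le_one_left (norm_nonneg _) (inv_le_one_of_one_le₀ hm1)
  have h2 : |n - m| / (m * n) * ‖y‖ ≤ ‖x - y‖ := by
    rw [div_mul_eq_mul_div, div_le_iff₀ (by positivity)]
    calc |n - m| * ‖y‖ ≤ ‖x - y‖ * n := by gcongr
      _ ≤ ‖x - y‖ * (m * n) := by
          gcongr
          nlinarith
  push_cast
  linarith

/-- A Lipschitz extension of the force is precomposed with the radial retraction onto the closed
unit ball. The retraction makes it bounded and does not alter it on the shell. -/
theorem exists_bounded_extension (hf : IsProfile f) {r₀ : ℝ} (hr₀ : 0 < r₀) :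
    ∃ (g : E3 → E3) (K : NNReal) (B : ℝ), LipschitzWith K g ∧ (∀ x, ‖g x‖ ≤ B) ∧
      ∀ x : E3, ‖x‖ ∈ Set.Ioo r₀ 1 → g x = -(slope f s ε ‖x‖ / (2 * ‖x‖)) • x := by
  obtain ⟨K, hK⟩ := exists_lipschitzOnWith_force (s := s) (ε := ε) hf hr₀
  obtain ⟨g, hg, heq⟩ := hK.extend_finite_dimension
  refine ⟨fun x => g ((max 1 ‖x‖)⁻¹ • x), _, ‖g 0‖ + lipschitzExtensionConstant E3 * K,
    hg.comp lipschitzWith_retraction, fun x => ?_, fun x hx => ?_⟩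
  · have h1 := hg.dist_le_mul ((max 1 ‖x‖)⁻¹ • x) 0
    rw [dist_eq_norm, dist_zero_right] at h1
    have h2 : ‖(max 1 ‖x‖)⁻¹ • x‖ ≤ 1 := by
      have hm : 0 < max 1 ‖x‖ := lt_max_of_lt_left one_pos
      rw [norm_smul, norm_inv, Real.norm_of_nonneg hm.le, inv_mul_le_iff₀ hm, mul_one]
      exact le_max_right _ _
    have h3 : ‖g ((max 1 ‖x‖)⁻¹ • x)‖ ≤ ‖g 0‖ + ‖g ((max 1 ‖x‖)⁻¹ • x) - g 0‖ := by
      have := norm_add_le (g 0) (g ((max 1 ‖x‖)⁻¹ • x) - g 0)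
      rwa [add_sub_cancel] at this
    have h4 : ((lipschitzExtensionConstant E3 * K : NNReal) : ℝ) * ‖(max 1 ‖x‖)⁻¹ • x‖ ≤
        ((lipschitzExtensionConstant E3 * K : NNReal) : ℝ) * 1 := by gcongr
    push_cast at h1 h4
    linarith
  · have : max 1 ‖x‖ = 1 := max_eq_left hx.2.le
    simp only [this, inv_one, one_smul]
    exact (heq hx).symm

end Force

/-- Solvability of Newton's equation with a bounded Lipschitz force on any time interval. -/
theorem exists_newton_solution {F : Type*} [NormedAddCommGroup F] [NormedSpace ℝ F]
    [CompleteSpace F] {g : F → F} {K : NNReal} {B T : ℝ} (hg : LipschitzWith K g)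
    (hB : ∀ x, ‖g x‖ ≤ B) (hT : 0 < T) (x₀ v₀ : F) :
    ∃ X V : ℝ → F, X 0 = x₀ ∧ V 0 = v₀ ∧
      (∀ t ∈ Set.Icc 0 T, HasDerivWithinAt X (V t) (Set.Icc 0 T) t) ∧
      ∀ t ∈ Set.Icc 0 T, HasDerivWithinAt V (g (X t)) (Set.Icc 0 T) t := by
  have hB0 : 0 ≤ B := (norm_nonneg _).trans (hB x₀)
  -- the velocity is measured in units of `l` to make the time of existence as long as desired
  set l : ℝ := 1 / (2 * T) with hl
  have hl0 : 0 < l := by positivity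
  -- Within radius a of the initial point the field must be bounded by a/T. The two components ask
  -- for ‖v₀‖ + a/(2T) ≤ a/T and 2TB ≤ a/T, one for each summand of a.
  set a : ℝ := 2 * ‖v₀‖ * T + 2 * B * T ^ 2 with ha
  have ha0 : 0 ≤ a := by positivity
  set G : F × F → F × F := fun p => (l • p.2, l⁻¹ • g p.1) with hG
  have hlip : LipschitzWith (max (‖l‖₊ * 1) (‖l⁻¹‖₊ * (K * 1))) G :=
    ((lipschitzWith_smul l).comp LipschitzWith.prod_snd).prodMk
      ((lipschitzWith_smul l⁻¹).comp (hg.comp LipschitzWith.prod_fst))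
  have hpl : IsPicardLindelof (fun _ => G) (⟨0, le_rfl, hT.le⟩ : Set.Icc (0 : ℝ) T)
      (x₀, l⁻¹ • v₀) a.toNNReal 0 (a / T).toNNReal
      (max (‖l‖₊ * 1) (‖l⁻¹‖₊ * (K * 1))) := by
    have haT : 0 ≤ a / T := by positivity
    refine IsPicardLindelof.of_time_independent (fun p hp => ?_) hlip.lipschitzOnWith ?_
    · rw [Real.coe_toNNReal _ haT]
      rw [Real.coe_toNNReal _ ha0, mem_closedBall_iff_norm, Prod.norm_def] at hp
      have h2 : ‖p.2 - l⁻¹ • v₀‖ ≤ a := (le_max_right _ _).trans hp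
      rw [Prod.norm_def]
      refine max_le ?_ ?_
      · simp only [hG]
        have e : l • p.2 = v₀ + l • (p.2 - l⁻¹ • v₀) := by
          rw [smul_sub, smul_inv_smul₀ hl0.ne']
          abel
        rw [e]
        refine (norm_add_le _ _).trans ?_
        rw [norm_smul, Real.norm_of_nonneg hl0.le]
        have h3 : l * ‖p.2 - l⁻¹ • v₀‖ ≤ l * a := by gcongr
        have h4 : ‖v₀‖ + l * a ≤ a / T := by
          rw [hl, le_div_iff₀ hT]
          field_simp
          rw [ha]
          nlinarith [mul_nonneg hB0 (sq_nonneg T)]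
        linarith
      · simp only [hG]
        rw [norm_smul, norm_inv, Real.norm_of_nonneg hl0.le]
        have h3 : l⁻¹ * ‖g p.1‖ ≤ l⁻¹ * B := by
          have := hB p.1
          gcongr
        have h4 : l⁻¹ * B ≤ a / T := by
          rw [hl, le_div_iff₀ hT, ha]
          field_simp
          nlinarith [norm_nonneg v₀]
        linarith
    · rw [Real.coe_toNNReal _ haT, Real.coe_toNNReal _ ha0]
      simp only [sub_zero, NNReal.coe_zero]
      rw [max_eq_left hT.le, div_mul_cancel₀ _ hT.ne']
  obtain ⟨z, hz0, hz⟩ := hpl.exists_eq_forall_mem_Icc_hasDerivWithinAt₀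
  refine ⟨fun t => (z t).1, fun t => l • (z t).2, ?_, ?_, fun t ht => ?_, fun t ht => ?_⟩
  · simp only at hz0
    simp [hz0]
  · simp only at hz0
    simp [hz0, smul_inv_smul₀ hl0.ne']
  · exact (hz t ht).fst
  · have h2 : HasDerivWithinAt (fun t => (z t).2) (l⁻¹ • g (z t).1) (Set.Icc 0 T) t := (hz t ht).snd
    have h3 := h2.const_smul l
    rw [smul_inv_smul₀ hl0.ne'] at h3
    exact h3

/-! ### The scattering problem -/

/-- F may vanish at 0, as 1 - ‖X t‖ does. The infimum is therefore taken over a compact interval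
that starts inside the range of initial positivity. -/
theorem exists_first_exit {F : ℝ → ℝ} {B : ℝ} (hc : ContinuousOn F (Set.Icc 0 B))
    (h0 : ∀ᶠ t in 𝓝[>] 0, 0 < F t) (hn : ¬∀ t ∈ Set.Ioo 0 B, 0 < F t) :
    ∃ T ∈ Set.Ioo 0 B, (∀ t ∈ Set.Ioo 0 T, 0 < F t) ∧ F T ≤ 0 := by
  obtain ⟨δ, hδ, hδF⟩ := (mem_nhdsGT_iff_exists_Ioo_subset).1 h0
  have hδ0 : (0 : ℝ) < δ := hδ
  push Not at hn
  obtain ⟨t₁, ht₁, hF₁⟩ := hn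
  have hδt : δ ≤ t₁ := by
    by_contra h
    have : 0 < F t₁ := hδF ⟨ht₁.1, not_le.1 h⟩
    linarith
  have hsub : Set.Icc (δ / 2) t₁ ⊆ Set.Icc 0 B := Set.Icc_subset_Icc (by linarith) ht₁.2.le
  have hZ : IsCompact (Set.Icc (δ / 2) t₁ ∩ F ⁻¹' Set.Iic 0) :=
    isCompact_Icc.of_isClosed_subset
      ((hc.mono hsub).preimage_isClosed_of_isClosed isClosed_Icc isClosed_Iic) Set.inter_subset_left
  have hne : (Set.Icc (δ / 2) t₁ ∩ F ⁻¹' Set.Iic 0).Nonempty :=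
    ⟨t₁, ⟨by linarith, le_rfl⟩, hF₁⟩
  have hT := hZ.sInf_mem hne
  set T := sInf (Set.Icc (δ / 2) t₁ ∩ F ⁻¹' Set.Iic 0) with hTdef
  refine ⟨T, ⟨by linarith [hT.1.1], hT.1.2.trans_lt ht₁.2⟩, fun t ht => ?_, hT.2⟩
  rcases lt_or_ge t δ with h | h
  · exact hδF ⟨ht.1, h⟩
  · by_contra hF
    have : T ≤ t := csInf_le hZ.bddBelow ⟨⟨by linarith, ht.2.le.trans hT.1.2⟩, not_lt.1 hF⟩
    linarith [ht.2]

theorem eventually_lt_of_hasDerivWithinAt_pos {F : ℝ → ℝ} {d : ℝ}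
    (h : HasDerivWithinAt F d (Set.Ici 0) 0) (hd : 0 < d) : ∀ᶠ t in 𝓝[>] 0, F 0 < F t := by
  have h1 := (hasDerivWithinAt_iff_tendsto_slope' (s := Set.Ioi (0 : ℝ)) (by simp)).1
    (h.mono Set.Ioi_subset_Ici_self)
  filter_upwards [h1.eventually (lt_mem_nhds hd), self_mem_nhdsWithin] with t ht ht0
  have ht0' : (0 : ℝ) < t := ht0
  rw [slope_def_field, sub_zero] at ht
  have := (div_pos_iff_of_pos_right ht0').1 ht
  linarith

theorem norm_frame₁ {η : E3} : ‖frame₁ η‖ = 1 := by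
  have h : ‖frame₁ η‖ ^ 2 = 1 := by
    rw [EuclideanSpace.norm_sq_eq, Fin.sum_univ_three]
    unfold frame₁
    split_ifs with h
    · simp
    · have h1 : 0 < η 0 ^ 2 + η 1 ^ 2 := by
        by_contra h2
        have h3 := sq_nonneg (η 0)
        have h4 := sq_nonneg (η 1)
        exact h ⟨by nlinarith, by nlinarith⟩
      have h2 := Real.sq_sqrt h1.le
      have h3 := Real.sqrt_pos.2 h1
      simp [mul_pow]
      field_simp
      linarith
  exact (pow_eq_one_iff_of_nonneg (norm_nonneg _) two_ne_zero).1 h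

theorem inner_frame₁ {η : E3} : inner ℝ η (frame₁ η) = 0 := by
  rw [PiLp.inner_apply, Fin.sum_univ_three]
  unfold frame₁
  split_ifs with h
  · simp [h.1]
  · simp
    ring

/-- The outgoing relative velocity, for incoming relative velocity `v` and impact vector `ν`. -/
def relOutgoing (φ : ℝ → ℝ) (v ν : E3) : E3 :=
  ‖v‖ • (Real.cos (deviationAngle φ ‖v‖ (Real.sqrt (1 - inner ℝ (‖v‖⁻¹ • v) ν ^ 2))) • (‖v‖⁻¹ • v)
    - Real.sin (deviationAngle φ ‖v‖ (Real.sqrt (1 - inner ℝ (‖v‖⁻¹ • v) ν ^ 2))) •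
      ((Real.sqrt (1 - inner ℝ (‖v‖⁻¹ • v) ν ^ 2))⁻¹ • (ν - inner ℝ (‖v‖⁻¹ • v) ν • (‖v‖⁻¹ • v))))

theorem deviationAngle_zero (φ : ℝ → ℝ) (w : ℝ) : deviationAngle φ w 0 = Real.pi := by
  simp [deviationAngle]

section Scattering

variable {f : ℝ → ℝ} {s ε : ℝ} {v ν : E3}

theorem isBarrier_slope (hs : 1 < s) (hf : IsProfile f) (hε : 0 < ε) :
    IsBarrier (fun r => 4 * (ε * shortRange f s r)) (slope f s ε) :=
  isBarrier_shortRange hs hf hε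

/-- The relative position `X₁ - X₂` starts at -ν. The second axis of the plane of motion is
therefore minus the normalized component of ν orthogonal to v, which gives the minus sign in
`relOutgoing`. -/
theorem velocity_exit_eq_relOutgoing (hs : 1 < s) (hf : IsProfile f) (hε : 0 < ε) (hν : ‖ν‖ = 1)
    (hv : 0 < inner ℝ v ν) {X V : ℝ → E3} {T : ℝ} (h : IsPassage (slope f s ε) X V T)
    (hX : X 0 = -ν) (hV : V 0 = v) (hT : ‖X T‖ = 1) :
    V T = relOutgoing (fun r => ε * shortRange f s r) v ν := by
  have hw : 0 < ‖v‖ := hV ▸ h.speed_pos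
  have hw' : ‖V 0‖ = ‖v‖ := by rw [hV]
  obtain ⟨C, hC⟩ := exists_isRepulsive_shortRange hs hf
  have hanti : AntitoneOn (fun r => 4 * (ε * shortRange f s r)) (Set.Ioi 0) := fun x hx y hy hxy => by
    have := hC.anti hx hy hxy
    simp only
    gcongr
  have hU1 : ∀ r, 1 ≤ r → 4 * (ε * shortRange f s r) = 0 := fun r hr => by
    rw [shortRange_eq_zero hf hr]; ring
  rw [relOutgoing]
  set a : E3 := ‖v‖⁻¹ • v with ha
  have hna : ‖a‖ = 1 := by rw [ha, norm_smul, norm_inv, norm_norm, inv_mul_cancel₀ hw.ne']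
  have hva : v = ‖v‖ • a := by rw [ha, smul_inv_smul₀ hw.ne']
  set c : ℝ := inner ℝ a ν with hc
  have hc0 : 0 < c := by rw [hc, ha, real_inner_smul_left]; positivity
  have hc1 : c ≤ 1 := by
    have := real_inner_le_norm a ν
    rwa [hna, hν, mul_one] at this
  set ρ := Real.sqrt (1 - c ^ 2) with hρ
  clear_value ρ c a
  have hcos : Real.cos (Real.arccos c) = c := Real.cos_arccos (by linarith) hc1
  have hsin : Real.sin (Real.arccos c) = ρ := by rw [hρ, Real.sin_arccos]
  have hnn : 0 ≤ 1 - c ^ 2 := by nlinarith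
  have haa : inner ℝ a a = (1 : ℝ) := by rw [real_inner_self_eq_norm_sq, hna]; norm_num
  have hνν : inner ℝ ν ν = (1 : ℝ) := by rw [real_inner_self_eq_norm_sq, hν]; norm_num
  have hd2 : ‖ν - c • a‖ ^ 2 = 1 - c ^ 2 := by
    rw [← real_inner_self_eq_norm_sq, inner_sub_left, inner_sub_right, inner_sub_right,
      real_inner_smul_left, real_inner_smul_left, real_inner_smul_right, real_inner_smul_right,
      hνν, haa, real_inner_comm a ν, ← hc]
    ring
  have hda : inner ℝ a (ν - c • a) = (0 : ℝ) := by
    rw [inner_sub_right, real_inner_smul_right, haa, ← hc]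
    ring
  have hα0 := Real.arccos_nonneg c
  have hα1 : Real.arccos c < Real.pi / 2 := Real.arccos_lt_pi_div_two.2 hc0
  have key : ∀ b : E3, ‖b‖ = 1 → inner ℝ a b = (0 : ℝ) → -ν = -c • a + ρ • b →
      V T = ‖v‖ • (Real.cos (deviationAngle (fun r => ε * shortRange f s r) ‖v‖ ρ) • a) +
      ‖v‖ • (Real.sin (deviationAngle (fun r => ε * shortRange f s r) ‖v‖ ρ) • b) := by
    intro b hb hab hνb
    have := h.velocity_exit (isBarrier_slope hs hf hε) hU1 hanti hT hα0 hα1 hna hb hab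
      (by rw [hX, hcos, hsin, hνb]) (by rw [hV]; exact hva)
    rw [this, hw', hsin, deviationAngle_eq_deflection, smul_smul, smul_smul]
  -- In a head-on collision the plane of motion is undetermined. The angle is π and its sine
  -- vanishes, so any unit vector orthogonal to a serves.
  rcases eq_or_ne ρ 0 with h0 | h0
  · have h1 : 1 - c ^ 2 = 0 := by
      rw [← Real.sq_sqrt hnn, ← hρ, h0]; norm_num
    have h2 : ν - c • a = 0 := by
      rw [h1] at hd2
      exact norm_eq_zero.1 ((pow_eq_zero_iff two_ne_zero).1 hd2)
    rw [key (frame₁ a) norm_frame₁ inner_frame₁ (by rw [h0, zero_smul, add_zero, neg_smul,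
      sub_eq_zero.1 h2]), h0, deviationAngle_zero]
    simp
  · have hρ0 : 0 < ρ := lt_of_le_of_ne (hρ ▸ Real.sqrt_nonneg _) h0.symm
    have hnorm : ‖ν - c • a‖ = ρ := by
      rw [hρ, ← hd2, Real.sqrt_sq (norm_nonneg _)]
    rw [key (-(ρ⁻¹ • (ν - c • a)))]
    · rw [smul_neg, smul_neg, ← sub_eq_add_neg, ← smul_sub]
    · rw [norm_neg, norm_smul, norm_inv, Real.norm_of_nonneg hρ0.le, hnorm, inv_mul_cancel₀ h0]
    · rw [inner_neg_right, real_inner_smul_right, hda]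
      ring
    · rw [smul_neg, smul_inv_smul₀ h0, neg_smul]
      abel

theorem continuousOn_force (hf : IsProfile f) :
    ContinuousOn (fun x : E3 => -(slope f s ε ‖x‖ / (2 * ‖x‖)) • x) {x | ‖x‖ ∈ Set.Ioo (0 : ℝ) 1} := by
  have h1 : ContinuousOn (fun x : E3 => slope f s ε ‖x‖) {x | ‖x‖ ∈ Set.Ioo (0 : ℝ) 1} :=
    (continuousOn_slope hf).comp continuous_norm.continuousOn fun x hx => hx
  have h2 : ∀ x ∈ {x : E3 | ‖x‖ ∈ Set.Ioo (0 : ℝ) 1}, 2 * ‖x‖ ≠ 0 := fun x hx =>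
    mul_ne_zero two_ne_zero (ne_of_gt hx.1)
  exact ((h1.div (by fun_prop) h2).neg).smul continuousOn_id

/-- Every solution of the relative equation of motion passes through the unit ball and then moves
with constant velocity. -/
theorem exists_passage (hs : 1 < s) (hf : IsProfile f) (hε : 0 < ε) (hν : ‖ν‖ = 1)
    (hv : 0 < inner ℝ v ν) {X V G : ℝ → E3} (hX0 : X 0 = -ν)
    (hne : ∀ t, 0 ≤ t → X t ≠ 0) (hX : ∀ t, 0 ≤ t → HasDerivWithinAt X (V t) (Set.Ici 0) t)
    (hG : ∀ t, 0 ≤ t → IntervalIntegrable G volume 0 t)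
    (hV : ∀ t, 0 ≤ t → V t = v + ∫ τ in (0 : ℝ)..t, G τ)
    (hG1 : ∀ t, 0 ≤ t → ‖X t‖ < 1 → G t = -(slope f s ε ‖X t‖ / (2 * ‖X t‖)) • X t)
    (hG2 : ∀ t, 0 ≤ t → 1 < ‖X t‖ → G t = 0) :
    ∃ T, IsPassage (slope f s ε) X V T ∧ ‖X T‖ = 1 ∧ ∀ t, T ≤ t → V t = V T := by
  have hU := isBarrier_slope hs hf hε
  have hV0 : V 0 = v := by rw [hV 0 le_rfl]; simp
  have hw : 0 < ‖v‖ := by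
    rw [norm_pos_iff]
    rintro rfl
    simp at hv
  have hXn0 : ‖X 0‖ = 1 := by rw [hX0, norm_neg, hν]
  have hin : inner ℝ (X 0) (V 0) < 0 := by
    rw [hX0, hV0, inner_neg_left, real_inner_comm]; linarith
  have hcX : ∀ B, ContinuousOn X (Set.Icc 0 B) := fun B t ht =>
    ((hX t ht.1).continuousWithinAt).mono Set.Icc_subset_Ici_self
  have hcV : ∀ B, 0 ≤ B → ContinuousOn V (Set.Icc 0 B) := fun B hB => by
    have h1 := intervalIntegral.continuousOn_primitive_interval' (hG B hB) Set.left_mem_uIcc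
    rw [Set.uIcc_of_le hB] at h1
    exact (continuousOn_const.add h1).congr fun t ht => hV t ht.1
  have hdX : ∀ t, 0 < t → HasDerivAt X (V t) t := fun t ht =>
    (hX t ht.le).hasDerivAt (Ici_mem_nhds ht)
  have hpass : ∀ B, 0 < B → (∀ t ∈ Set.Ioo 0 B, ‖X t‖ < 1) → IsPassage (slope f s ε) X V B := by
    intro B hB hlt
    refine ⟨hB, hcX B, hcV B hB.le, fun t ht => hdX t ht.1, fun t ht => ?_, hlt,
      fun t ht => hne t ht.1, hXn0, hin⟩
    have hmem : ∀ τ ∈ Set.Ioo 0 B, X τ ∈ {x : E3 | ‖x‖ ∈ Set.Ioo (0 : ℝ) 1} := fun τ hτ =>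
      ⟨norm_pos_iff.2 (hne τ hτ.1.le), hlt τ hτ⟩
    have hGc : ContinuousOn G (Set.Ioo 0 B) := by
      refine ((continuousOn_force (s := s) (ε := ε) hf).comp ((hcX B).mono Set.Ioo_subset_Icc_self) hmem).congr
        fun τ hτ => ?_
      exact hG1 τ hτ.1.le (hlt τ hτ)
    have h1 := intervalIntegral.integral_hasDerivAt_right (hG t ht.1.le)
      (hGc.stronglyMeasurableAtFilter isOpen_Ioo t ht) (hGc.continuousAt (isOpen_Ioo.mem_nhds ht))
    rw [hG1 t ht.1.le (hlt t ht)] at h1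
    refine (h1.const_add v).congr_of_eventuallyEq ?_
    filter_upwards [Ioi_mem_nhds ht.1] with τ hτ using hV τ (le_of_lt hτ)
  have hB : 0 < 4 / ‖v‖ + 1 := by positivity
  have hstart : ∀ᶠ t in 𝓝[>] 0, 0 < 1 - ‖X t‖ := by
    have h1 : HasDerivWithinAt (fun t => -‖X t‖ ^ 2) (-(2 * inner ℝ (X 0) (V 0))) (Set.Ici 0) 0 :=
      ((hX 0 le_rfl).norm_sq).neg
    have h2 : 0 < -(2 * inner ℝ (X 0) (V 0)) := by linarith
    filter_upwards [eventually_lt_of_hasDerivWithinAt_pos h1 h2] with t ht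
    rw [hXn0] at ht
    nlinarith [norm_nonneg (X t)]
  -- A passage lasts at most 4/‖v‖, so the ball is left before this slightly longer time.
  have hexit : ¬∀ t ∈ Set.Ioo 0 (4 / ‖v‖ + 1), 0 < 1 - ‖X t‖ := by
    intro hall
    have := (hpass _ hB fun t ht => by linarith [hall t ht]).time_le hU
    rw [hV0] at this
    linarith
  obtain ⟨T, hT, hTlt, hT1⟩ := exists_first_exit
    (F := fun t => 1 - ‖X t‖) (continuousOn_const.sub (hcX (4 / ‖v‖ + 1)).norm) hstart hexit
  have hp := hpass T hT.1 fun t ht => by linarith [hTlt t ht]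
  have hXT : ‖X T‖ = 1 := le_antisymm (hp.norm_le_one hp.right_mem) (by linarith)
  refine ⟨T, hp, hXT, ?_⟩
  have hmT : 0 < inner ℝ (X T) (V T) := by
    rw [hp.inner_exit hU hXT]; linarith
  have hconst : ∀ B, T ≤ B → (∀ t ∈ Set.Ioo T B, 1 < ‖X t‖) → V B = V T := by
    intro B hTB hlt
    have h1 : ∫ τ in T..B, G τ = 0 := by
      rw [intervalIntegral.integral_of_le hTB, integral_Ioc_eq_integral_Ioo,
        setIntegral_congr_fun measurableSet_Ioo (g := fun _ => (0 : E3))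
          fun τ hτ => hG2 τ (hT.1.trans hτ.1).le (hlt τ hτ)]
      simp
    have hB0 : 0 ≤ B := hT.1.le.trans hTB
    rw [hV B hB0, hV T hT.1.le, ← intervalIntegral.integral_interval_sub_left (hG B hB0)
      (hG T hT.1.le), sub_eq_zero] at *
    rw [h1]
  suffices hout : ∀ B, 0 < B → ∀ t ∈ Set.Ioo 0 B, 0 < ‖X (T + t)‖ ^ 2 - 1 by
    intro t ht
    refine hconst t ht fun τ hτ => ?_
    have h1 := hout (t - T) (by linarith [hτ.1, hτ.2]) (τ - T) ⟨by linarith [hτ.1], by linarith [hτ.2]⟩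
    rw [add_sub_cancel] at h1
    nlinarith [norm_nonneg (X τ)]
  -- There is no return: up to a first return time the velocity is constant with ⟨X,V⟩ > 0 at the
  -- exit, so ‖X‖ has strictly increased above 1.
  intro B hB
  by_contra hn
  have hcS : ContinuousOn (fun t => X (T + t)) (Set.Icc 0 B) :=
    ContinuousOn.comp (hcX (T + B)) (by fun_prop) fun t ht =>
      ⟨by linarith [ht.1, hT.1], by linarith [ht.2]⟩
  have hstart' : ∀ᶠ t in 𝓝[>] 0, 0 < ‖X (T + t)‖ ^ 2 - 1 := by
    have h1 : HasDerivAt (fun t => X (T + t)) (V T) 0 := by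
      have := hdX T hT.1
      rw [← add_zero T] at this
      simpa using this.comp_const_add T 0
    have h2 := (h1.norm_sq).hasDerivWithinAt (s := Set.Ici 0)
    have h3 : 0 < 2 * inner ℝ (X (T + 0)) (V T) := by rw [add_zero]; linarith
    filter_upwards [eventually_lt_of_hasDerivWithinAt_pos h2 h3] with t ht
    rw [add_zero, hXT] at ht
    linarith
  obtain ⟨S, hS, hSlt, hS0⟩ := exists_first_exit
    (F := fun t => ‖X (T + t)‖ ^ 2 - 1) ((hcS.norm.pow 2).sub continuousOn_const) hstart' hn
  have hVc : ∀ t ∈ Set.Ico 0 S, V (T + t) = V T := by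
    intro t ht
    refine hconst _ (by linarith [ht.1]) fun τ hτ => ?_
    have h1 := hSlt (τ - T) ⟨by linarith [hτ.1], by linarith [hτ.2, ht.2]⟩
    simp only [add_sub_cancel] at h1
    nlinarith [norm_nonneg (X τ)]
  have hlin : X (T + S) - S • V T = X (T + 0) - (0 : ℝ) • V T := by
    refine constant_of_has_deriv_right_zero (f := fun t => X (T + t) - t • V T) (a := 0) (b := S)
      ((hcS.mono (Set.Icc_subset_Icc_right hS.2.le)).sub (by fun_prop)) (fun t ht => ?_)
      S ⟨hS.1.le, le_rfl⟩
    have h1 : HasDerivAt (fun t => X (T + t)) (V (T + t)) t :=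
      (hdX (T + t) (by linarith [hT.1, ht.1])).comp_const_add T t
    have h2 := h1.sub ((hasDerivAt_id t).smul_const (V T))
    rw [hVc t ht, one_smul, sub_self] at h2
    exact h2.hasDerivWithinAt
  have hXS : X (T + S) = X T + S • V T := by
    rw [add_zero, zero_smul, sub_zero] at hlin
    rw [← hlin]
    abel
  rw [hXS, ← real_inner_self_eq_norm_sq, inner_add_left, inner_add_right, inner_add_right,
    real_inner_smul_left, real_inner_smul_left, real_inner_smul_right, real_inner_smul_right,
    real_inner_self_eq_norm_sq, real_inner_self_eq_norm_sq, hXT, real_inner_comm (X T) (V T)] at hS0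
  have h1 := mul_pos hS.1 hmT
  have h2 : 0 ≤ S * (S * ‖V T‖ ^ 2) := by have := hS.1; positivity
  linarith

/-- The sum of the velocities is conserved, and the difference solves the relative equation with
acceleration -2∇Φ, to which `exists_passage` applies. Both velocities are constant after the exit.
-/
theorem tendsto_of_isTrajectory (hs : 1 < s) (hf : IsProfile f) (hε : 0 < ε) {v₁ v₂ : E3}
    (hν : ‖ν‖ = 1) (hv : 0 < inner ℝ (v₁ - v₂) ν) {X₁ X₂ V₁ V₂ : ℝ → E3}
    (h : IsTrajectory (fun x => ε * pairPotential f s x) v₁ v₂ ν X₁ X₂ V₁ V₂) :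
    Tendsto V₁ atTop (𝓝 ((1 / 2 : ℝ) • (v₁ + v₂) +
        (1 / 2 : ℝ) • relOutgoing (fun r => ε * shortRange f s r) (v₁ - v₂) ν)) ∧
      Tendsto V₂ atTop (𝓝 ((1 / 2 : ℝ) • (v₁ + v₂) -
        (1 / 2 : ℝ) • relOutgoing (fun r => ε * shortRange f s r) (v₁ - v₂) ν)) := by
  set Φ : E3 → ℝ := fun x => ε * pairPotential f s x with hΦ
  have hodd : ∀ τ, gradient Φ (X₂ τ - X₁ τ) = -gradient Φ (X₁ τ - X₂ τ) := fun τ => by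
    rw [← neg_sub, gradient_pairPotential_neg]
  have hV₂ : ∀ t, 0 ≤ t → V₂ t = v₂ + ∫ τ in (0 : ℝ)..t, gradient Φ (X₁ τ - X₂ τ) := fun t ht => by
    rw [h.vel₂ t ht]
    simp only [hodd, intervalIntegral.integral_neg, sub_neg_eq_add]
  obtain ⟨T, hp, hT, hconst⟩ := exists_passage (v := v₁ - v₂) (ν := ν) (X := fun t => X₁ t - X₂ t)
    (V := fun t => V₁ t - V₂ t) (G := fun t => (-2 : ℝ) • gradient Φ (X₁ t - X₂ t)) hs hf hε hν hv
    (by rw [← h.init]; abel) (fun t ht => sub_ne_zero.2 (h.ne t ht))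
    (fun t ht => (h.pos₁ t ht).sub (h.pos₂ t ht)) (fun t ht => (h.int₁ t ht).smul (-2 : ℝ))
    (fun t ht => by
      rw [h.vel₁ t ht, hV₂ t ht, intervalIntegral.integral_smul]
      module)
    (fun t ht h1 => by
      have h0 : 0 < ‖X₁ t - X₂ t‖ := norm_pos_iff.2 (sub_ne_zero.2 (h.ne t ht))
      rw [gradient_pairPotential hf (sub_ne_zero.2 (h.ne t ht)) h1, smul_smul]
      congr 1
      field_simp
      ring)
    (fun t _ h1 => by
      rw [gradient_pairPotential_eq_zero hf h1, smul_zero])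
  have hr := velocity_exit_eq_relOutgoing hs hf hε hν hv hp (by rw [← h.init]; abel)
    (by rw [h.vel₁ 0 le_rfl, h.vel₂ 0 le_rfl]; simp) hT
  have hsum : ∀ t, 0 ≤ t → V₁ t + V₂ t = v₁ + v₂ := fun t ht => by
    rw [h.vel₁ t ht, hV₂ t ht]
    abel
  have hT0 := hp.pos
  have e : ∀ t, T ≤ t → V₁ t - V₂ t = relOutgoing (fun r => ε * shortRange f s r) (v₁ - v₂) ν :=
    fun t ht => by rw [← hr]; exact hconst t ht
  constructor
  · refine tendsto_const_nhds.congr' ?_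
    filter_upwards [eventually_ge_atTop T] with t ht
    rw [← e t ht, ← hsum t (by linarith)]
    module
  · refine tendsto_const_nhds.congr' ?_
    filter_upwards [eventually_ge_atTop T] with t ht
    rw [← e t ht, ← hsum t (by linarith)]
    module

end Scattering

theorem tendsto_shortRange_atTop {f : ℝ → ℝ} {s : ℝ} (hs : 1 < s) (hf : IsProfile f) :
    Tendsto (shortRange f s) (𝓝[>] 0) atTop := by
  have h1 : Tendsto f (𝓝[>] 0) (𝓝 (f 0)) :=
    (hf.continuous 0 (by simp)).mono_left
      (nhdsWithin_le_of_mem (mem_of_superset (Ioo_mem_nhdsGT one_pos) Set.Ioo_subset_Icc_self))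
  have h2 : Tendsto (fun r : ℝ => r ^ (-s)) (𝓝[>] 0) atTop :=
    tendsto_rpow_neg_nhdsGT_zero (by linarith)
  refine (h1.pos_mul_atTop hf.pos_zero h2).congr' ?_
  filter_upwards [Ioo_mem_nhdsGT one_pos] with r hr
  rw [shortRange_eq hr.1 hr.2.le]

/-! ### Existence and uniqueness of the outgoing velocities. -/

section Scattering

variable {f : ℝ → ℝ} {s ε : ℝ} {v ν : E3}

/-- A solution of the relative equation of motion up to the time when the particles leave the range
of the interaction. -/
theorem exists_crossing (hs : 1 < s) (hf : IsProfile f) (hε : 0 < ε) (hν : ‖ν‖ = 1)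
    (hv : 0 < inner ℝ v ν) :
    ∃ (X V k : ℝ → E3) (T : ℝ), IsPassage (slope f s ε) X V T ∧ X 0 = -ν ∧ V 0 = v ∧ ‖X T‖ = 1 ∧
      ContinuousOn k (Set.Icc 0 T) ∧ (∀ t ∈ Set.Ioo 0 T, HasDerivAt V (k t) t) ∧
      ∀ t ∈ Set.Ioo 0 T, k t = -(slope f s ε ‖X t‖ / (2 * ‖X t‖)) • X t := by
  have hU := isBarrier_slope hs hf hε
  have hw : 0 < ‖v‖ := by
    rw [norm_pos_iff]
    rintro rfl
    simp at hv
  -- The radius r₀ is so small that 4εφ(r₀) exceeds the energy ‖v‖². Changing the force below r₀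
  -- then cannot affect the motion.
  obtain ⟨r₀, hr₀U, hr₀⟩ : ∃ r₀, ‖v‖ ^ 2 / (4 * ε) < shortRange f s r₀ ∧ r₀ ∈ Set.Ioo (0 : ℝ) 1 :=
    (((tendsto_shortRange_atTop hs hf).eventually_gt_atTop _).and (Ioo_mem_nhdsGT one_pos)).exists
  rw [div_lt_iff₀ (by positivity)] at hr₀U
  obtain ⟨g, K, B, hg, hB, hgeq⟩ := exists_bounded_extension (s := s) (ε := ε) hf hr₀.1
  have hT₁ : 0 < 4 / ‖v‖ + 1 := by positivity
  obtain ⟨X, V, hX0, hV0, hX, hV⟩ := exists_newton_solution hg hB hT₁ (-ν) v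
  set T₁ := 4 / ‖v‖ + 1 with hT₁def
  have hcX : ContinuousOn X (Set.Icc 0 T₁) := fun t ht => (hX t ht).continuousWithinAt
  have hcV : ContinuousOn V (Set.Icc 0 T₁) := fun t ht => (hV t ht).continuousWithinAt
  have hXn0 : ‖X 0‖ = 1 := by rw [hX0, norm_neg, hν]
  have hin : inner ℝ (X 0) (V 0) < 0 := by
    rw [hX0, hV0, inner_neg_left, real_inner_comm]; linarith
  have hpass : ∀ B, 0 < B → B ≤ T₁ → X B ≠ 0 →
      (∀ t ∈ Set.Ioo 0 B, 0 < min (1 - ‖X t‖) (‖X t‖ - r₀)) → IsPassage (slope f s ε) X V B := by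
    intro B hB hBT hne hlt
    have hlt1 : ∀ t ∈ Set.Ioo 0 B, ‖X t‖ < 1 := fun t ht => by
      have := (lt_min_iff.1 (hlt t ht)).1; linarith
    have hlt2 : ∀ t ∈ Set.Ioo 0 B, r₀ < ‖X t‖ := fun t ht => by
      have := (lt_min_iff.1 (hlt t ht)).2; linarith
    have hsub : Set.Icc 0 B ⊆ Set.Icc 0 T₁ := Set.Icc_subset_Icc_right hBT
    refine ⟨hB, hcX.mono hsub, hcV.mono hsub, fun t ht => ?_, fun t ht => ?_, hlt1, fun t ht => ?_,
      hXn0, hin⟩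
    · exact (hX t (hsub (Set.Ioo_subset_Icc_self ht))).hasDerivAt
        (Icc_mem_nhds ht.1 (ht.2.trans_le hBT))
    · rw [← hgeq _ ⟨hlt2 t ht, hlt1 t ht⟩]
      exact (hV t (hsub (Set.Ioo_subset_Icc_self ht))).hasDerivAt
        (Icc_mem_nhds ht.1 (ht.2.trans_le hBT))
    · rcases ht.1.eq_or_lt with h | h
      · rw [← h, ← norm_pos_iff, hXn0]; exact one_pos
      rcases ht.2.eq_or_lt with h' | h'
      · rw [h']; exact hne
      · exact norm_pos_iff.1 (hr₀.1.trans (hlt2 t ⟨h, h'⟩))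
  have hcF : ContinuousOn (fun t => min (1 - ‖X t‖) (‖X t‖ - r₀)) (Set.Icc 0 T₁) :=
    ContinuousOn.inf (continuousOn_const.sub hcX.norm) (hcX.norm.sub continuousOn_const)
  have hstart : ∀ᶠ t in 𝓝[>] 0, 0 < min (1 - ‖X t‖) (‖X t‖ - r₀) := by
    have h1 : HasDerivWithinAt (fun t => -‖X t‖ ^ 2) (-(2 * inner ℝ (X 0) (V 0))) (Set.Ici 0) 0 :=
      (((hX 0 ⟨le_rfl, hT₁.le⟩).mono_of_mem_nhdsWithin (Icc_mem_nhdsGE hT₁)).norm_sq).neg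
    have h2 : 0 < -(2 * inner ℝ (X 0) (V 0)) := by linarith
    have h3 : Tendsto (fun t => ‖X t‖) (𝓝[>] 0) (𝓝 ‖X 0‖) :=
      (hcX.norm 0 ⟨le_rfl, hT₁.le⟩).mono_left (nhdsWithin_le_of_mem
        (mem_of_superset (Ioo_mem_nhdsGT hT₁) Set.Ioo_subset_Icc_self))
    filter_upwards [eventually_lt_of_hasDerivWithinAt_pos h1 h2,
      h3.eventually (lt_mem_nhds (show r₀ < ‖X 0‖ by rw [hXn0]; exact hr₀.2))] with t ht ht'
    rw [hXn0] at ht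
    refine lt_min ?_ (by linarith)
    nlinarith [norm_nonneg (X t)]
  have hexit : ¬∀ t ∈ Set.Ioo 0 T₁, 0 < min (1 - ‖X t‖) (‖X t‖ - r₀) := by
    intro hall
    have hb : 4 / ‖v‖ + 1 / 2 ∈ Set.Ioo 0 T₁ := ⟨by positivity, by rw [hT₁def]; linarith⟩
    have hne : X (4 / ‖v‖ + 1 / 2) ≠ 0 := norm_pos_iff.1 (hr₀.1.trans (by
      have := (lt_min_iff.1 (hall _ hb)).2; linarith))
    have := (hpass _ hb.1 hb.2.le hne fun t ht => hall t ⟨ht.1, ht.2.trans hb.2⟩).time_le hU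
    rw [hV0] at this
    linarith
  obtain ⟨T, hT, hTlt, hT1⟩ := exists_first_exit hcF hstart hexit
  have hFT : min (1 - ‖X T‖) (‖X T‖ - r₀) = 0 := by
    refine le_antisymm hT1 ?_
    have h1 := (hcF T ⟨hT.1.le, hT.2.le⟩).mono_left (nhdsWithin_mono T
      (show Set.Ioo 0 T ⊆ Set.Icc 0 T₁ from fun t ht => ⟨ht.1.le, (ht.2.trans hT.2).le⟩))
    have h2 : (𝓝[Set.Ioo 0 T] T).NeBot := by
      rw [nhdsWithin_Ioo_eq_nhdsLT hT.1]; infer_instance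
    refine ge_of_tendsto h1 ?_
    filter_upwards [self_mem_nhdsWithin] with t ht using (hTlt t ht).le
  have hge : r₀ ≤ ‖X T‖ := by
    have := min_le_right (1 - ‖X T‖) (‖X T‖ - r₀); linarith
  have hp := hpass T hT.1 hT.2.le (norm_pos_iff.1 (hr₀.1.trans_le hge)) hTlt
  -- At the first exit from the shell ‖X‖ is 1 or r₀, and conservation of energy excludes r₀.
  have hXT : ‖X T‖ = 1 := by
    rcases min_choice (1 - ‖X T‖) (‖X T‖ - r₀) with h | h
    · linarith
    · have h1 : ‖X T‖ = r₀ := by linarith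
      have h2 := hp.energy hU hp.right_mem
      rw [h1, hV0] at h2
      nlinarith [sq_nonneg ‖V T‖]
  refine ⟨X, V, fun t => g (X t), T, hp, hX0, hV0, hXT, ?_, fun t ht => ?_, fun t ht => ?_⟩
  · exact hg.continuous.comp_continuousOn (hcX.mono (Set.Icc_subset_Icc_right hT.2.le))
  · exact (hV t ⟨ht.1.le, (ht.2.trans hT.2).le⟩).hasDerivAt (Icc_mem_nhds ht.1 (ht.2.trans hT.2))
  · have := lt_min_iff.1 (hTlt t ht)
    exact hgeq _ ⟨by linarith, by linarith⟩

/-- The acceleration of the crossing is extended by zero and integrated twice, which joins the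
crossing to the straight motion after it. The time T is excepted because the gradient on the unit
sphere is not controlled; one instant does not matter to the integrals. -/
theorem exists_relative_motion (hs : 1 < s) (hf : IsProfile f) (hε : 0 < ε) (hν : ‖ν‖ = 1)
    (hv : 0 < inner ℝ v ν) :
    ∃ (X V G : ℝ → E3) (T : ℝ), X 0 = -ν ∧ (∀ t, 0 ≤ t → X t ≠ 0) ∧ Integrable G ∧
      (∀ t, HasDerivAt X (V t) t) ∧ (∀ t, V t = v + ∫ τ in (0 : ℝ)..t, G τ) ∧
      ∀ t, 0 < t → t ≠ T → G t = (-2 : ℝ) • gradient (fun x => ε * pairPotential f s x) (X t) := by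
  have hU := isBarrier_slope hs hf hε
  obtain ⟨Y, W, k, T, hp, hY0, hW0, hYT, hk, hWk, hkY⟩ := exists_crossing hs hf hε hν hv
  have hT := hp.pos
  set G : ℝ → E3 := (Set.Icc 0 T).indicator k with hG
  have hGi : Integrable G := (integrable_indicator_iff measurableSet_Icc).2 hk.integrableOn_Icc
  set V : ℝ → E3 := fun t => v + ∫ τ in (0 : ℝ)..t, G τ with hV
  have hVc : Continuous V :=
    continuous_const.add (intervalIntegral.continuous_primitive (fun a b => hGi.intervalIntegrable) 0)
  set X : ℝ → E3 := fun t => -ν + ∫ τ in (0 : ℝ)..t, V τ with hX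
  have hXd : ∀ t, HasDerivAt X (V t) t := fun t =>
    (intervalIntegral.integral_hasDerivAt_right (hVc.intervalIntegrable 0 t)
      hVc.aestronglyMeasurable.stronglyMeasurableAtFilter hVc.continuousAt).const_add _
  have hVW : ∀ t ∈ Set.Icc 0 T, V t = W t := fun t ht => by
    have h1 : ∫ τ in (0 : ℝ)..t, G τ = ∫ τ in (0 : ℝ)..t, k τ :=
      intervalIntegral.integral_congr fun τ hτ => by
        rw [Set.uIcc_of_le ht.1] at hτ
        exact Set.indicator_of_mem (show τ ∈ Set.Icc 0 T from ⟨hτ.1, hτ.2.trans ht.2⟩) k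
    have hsub : Set.Icc 0 t ⊆ Set.Icc 0 T := Set.Icc_subset_Icc_right ht.2
    have h2 := intervalIntegral.integral_eq_sub_of_hasDerivAt_of_le ht.1 (hp.contV.mono hsub)
      (fun τ hτ => hWk τ ⟨hτ.1, hτ.2.trans_le ht.2⟩)
      ((hk.mono hsub).intervalIntegrable_of_Icc ht.1)
    simp only [hV]
    rw [h1, h2, hW0]
    abel
  have hXY : ∀ t ∈ Set.Icc 0 T, X t = Y t := fun t ht => by
    have hsub : Set.Icc 0 t ⊆ Set.Icc 0 T := Set.Icc_subset_Icc_right ht.2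
    have h1 : ∫ τ in (0 : ℝ)..t, V τ = ∫ τ in (0 : ℝ)..t, W τ :=
      intervalIntegral.integral_congr fun τ hτ => by
        rw [Set.uIcc_of_le ht.1] at hτ
        exact hVW τ (hsub hτ)
    have h2 := intervalIntegral.integral_eq_sub_of_hasDerivAt_of_le ht.1 (hp.contX.mono hsub)
      (fun τ hτ => hp.derivX τ ⟨hτ.1, hτ.2.trans_le ht.2⟩)
      ((hp.contV.mono hsub).intervalIntegrable_of_Icc ht.1)
    simp only [hX]
    rw [h1, h2, hY0]
    abel
  have hVT : ∀ t, T ≤ t → V t = V T := fun t ht => by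
    have h1 : ∫ τ in T..t, G τ = 0 := by
      rw [intervalIntegral.integral_of_le ht]
      refine setIntegral_eq_zero_of_forall_eq_zero fun τ hτ => ?_
      exact Set.indicator_of_notMem (fun h => not_le.2 hτ.1 h.2) k
    have h2 := intervalIntegral.integral_add_adjacent_intervals
      (hGi.intervalIntegrable (a := 0) (b := T)) (hGi.intervalIntegrable (a := T) (b := t))
    simp only [hV]
    rw [← h2, h1, add_zero]
  have hXT : ∀ t, T ≤ t → X t = Y T + (t - T) • V T := fun t ht => by
    have h1 : ∫ τ in T..t, V τ = (t - T) • V T := by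
      rw [← intervalIntegral.integral_const]
      refine intervalIntegral.integral_congr fun τ hτ => ?_
      rw [Set.uIcc_of_le ht] at hτ
      exact hVT τ hτ.1
    have h2 := intervalIntegral.integral_add_adjacent_intervals
      (hVc.intervalIntegrable (μ := volume) 0 T) (hVc.intervalIntegrable (μ := volume) T t)
    rw [← hXY T hp.right_mem]
    simp only [hX]
    rw [← h2, h1, add_assoc]
  have hm : 0 < inner ℝ (Y T) (V T) := by
    rw [hVW T hp.right_mem, hp.inner_exit hU hYT]
    linarith [hp.incoming]
  have hgt : ∀ t, T < t → 1 < ‖X t‖ := fun t ht => by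
    have h1 : 1 < ‖X t‖ ^ 2 := by
      rw [hXT t ht.le, ← real_inner_self_eq_norm_sq, inner_add_left, inner_add_right,
        inner_add_right, real_inner_smul_left, real_inner_smul_left, real_inner_smul_right,
        real_inner_smul_right, real_inner_self_eq_norm_sq, real_inner_self_eq_norm_sq, hYT,
        real_inner_comm (Y T) (V T)]
      have h2 := mul_pos (sub_pos.2 ht) hm
      have h3 : 0 ≤ (t - T) * ((t - T) * ‖V T‖ ^ 2) := by
        have := (sub_pos.2 ht).le; positivity
      linarith
    nlinarith [norm_nonneg (X t)]
  refine ⟨X, V, G, T, by simp [hX], fun t ht => ?_, hGi, hXd, fun t => rfl, fun t ht htT => ?_⟩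
  · rcases le_or_gt t T with h | h
    · rw [hXY t ⟨ht, h⟩]
      exact hp.ne t ⟨ht, h⟩
    · exact norm_pos_iff.1 (one_pos.trans (hgt t h))
  · rcases lt_or_gt_of_ne htT with h | h
    · have h1 : G t = k t := Set.indicator_of_mem (show t ∈ Set.Icc 0 T from ⟨ht.le, h.le⟩) k
      have h2 := hp.mem_Ioo ⟨ht, h⟩
      rw [h1, hkY t ⟨ht, h⟩, hXY t ⟨ht.le, h.le⟩,
        gradient_pairPotential hf (norm_pos_iff.1 h2.1) h2.2, smul_smul]
      congr 1
      have := h2.1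
      field_simp
      ring
    · rw [gradient_pairPotential_eq_zero hf (hgt t h), smul_zero]
      exact Set.indicator_of_notMem (fun h' => not_le.2 h h'.2) k

theorem exists_isTrajectory (hs : 1 < s) (hf : IsProfile f) (hε : 0 < ε) {v₁ v₂ : E3}
    (hν : ‖ν‖ = 1) (hv : 0 < inner ℝ (v₁ - v₂) ν) :
    ∃ X₁ X₂ V₁ V₂ : ℝ → E3,
      IsTrajectory (fun x => ε * pairPotential f s x) v₁ v₂ ν X₁ X₂ V₁ V₂ := by
  obtain ⟨X, V, G, T, hX0, hne, hGi, hXd, hV, hG⟩ := exists_relative_motion hs hf hε hν hv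
  have hae : ∀ t, 0 ≤ t → (fun τ => (-(1 / 2) : ℝ) • G τ) =ᵐ[volume.restrict (Set.uIoc 0 t)]
      fun τ => gradient (fun x => ε * pairPotential f s x) (X τ) := fun t ht => by
    rw [Set.uIoc_of_le ht]
    have h1 : ∀ᵐ τ ∂volume.restrict (Set.Ioc 0 t), τ ≠ T := by
      refine ae_restrict_of_ae ?_
      simp [ae_iff]
    filter_upwards [h1, ae_restrict_mem measurableSet_Ioc] with τ hτ hτ'
    rw [hG τ hτ'.1 hτ, smul_smul]
    norm_num
  have hint : ∀ t, 0 ≤ t → IntervalIntegrable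
      (fun τ => gradient (fun x => ε * pairPotential f s x) (X τ)) volume 0 t := fun t ht =>
    ((hGi.smul (-(1 / 2) : ℝ)).intervalIntegrable).congr_ae (hae t ht)
  have hval : ∀ t, 0 ≤ t → ∫ τ in (0 : ℝ)..t,
      gradient (fun x => ε * pairPotential f s x) (X τ) = (-(1 / 2) : ℝ) • (V t - v₁ + v₂) :=
    fun t ht => by
      rw [← intervalIntegral.integral_congr_ae_restrict (hae t ht), intervalIntegral.integral_smul,
        hV t]
      congr 1
      abel
  have e₁ : ∀ t, (t / 2) • (v₁ + v₂) + (1 / 2 : ℝ) • X t - ((t / 2) • (v₁ + v₂) - (1 / 2 : ℝ) • X t)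
      = X t := fun t => by module
  have e₂ : ∀ t, (t / 2) • (v₁ + v₂) - (1 / 2 : ℝ) • X t - ((t / 2) • (v₁ + v₂) + (1 / 2 : ℝ) • X t)
      = -X t := fun t => by module
  have hlin : ∀ t : ℝ, HasDerivAt (fun t : ℝ => (t / 2) • (v₁ + v₂)) ((1 / 2 : ℝ) • (v₁ + v₂)) t :=
    fun t => ((hasDerivAt_id t).div_const 2).smul_const _
  refine ⟨fun t => (t / 2) • (v₁ + v₂) + (1 / 2 : ℝ) • X t,
    fun t => (t / 2) • (v₁ + v₂) - (1 / 2 : ℝ) • X t,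
    fun t => (1 / 2 : ℝ) • (v₁ + v₂) + (1 / 2 : ℝ) • V t,
    fun t => (1 / 2 : ℝ) • (v₁ + v₂) - (1 / 2 : ℝ) • V t, ?_, fun t ht => ?_, fun t ht => ?_,
    fun t ht => ?_, fun t ht => ?_, fun t ht => ?_, fun t ht => ?_, fun t ht => ?_⟩
  · rw [e₂, hX0, neg_neg]
  · rw [← sub_ne_zero, e₁]
    exact hne t ht
  · exact ((hlin t).add ((hXd t).const_smul (1 / 2 : ℝ))).hasDerivWithinAt
  · exact ((hlin t).sub ((hXd t).const_smul (1 / 2 : ℝ))).hasDerivWithinAt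
  · simp only [e₁]
    exact hint t ht
  · simp only [e₂, gradient_pairPotential_neg]
    exact (hint t ht).neg
  · simp only [e₁]
    rw [hval t ht]
    module
  · simp only [e₂, gradient_pairPotential_neg, intervalIntegral.integral_neg]
    rw [hval t ht]
    module

/-- The limit is the same explicit value for every trajectory. Uniqueness of the outgoing velocities
thus follows without uniqueness of trajectories. -/
theorem isOutgoing_iff (hs : 1 < s) (hf : IsProfile f) (hε : 0 < ε) {v₁ v₂ : E3} {p : E3 × E3}
    (hν : ‖ν‖ = 1) (hv : 0 < inner ℝ (v₁ - v₂) ν) :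
    IsOutgoing (fun x => ε * pairPotential f s x) v₁ v₂ ν p ↔
      p = ((1 / 2 : ℝ) • (v₁ + v₂) +
          (1 / 2 : ℝ) • relOutgoing (fun r => ε * shortRange f s r) (v₁ - v₂) ν,
        (1 / 2 : ℝ) • (v₁ + v₂) -
          (1 / 2 : ℝ) • relOutgoing (fun r => ε * shortRange f s r) (v₁ - v₂) ν) := by
  constructor
  · rintro ⟨X₁, X₂, V₁, V₂, h, h₁, h₂⟩
    obtain ⟨h₁', h₂'⟩ := tendsto_of_isTrajectory hs hf hε hν hv h
    exact Prod.ext (tendsto_nhds_unique h₁ h₁') (tendsto_nhds_unique h₂ h₂')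
  · rintro rfl
    obtain ⟨X₁, X₂, V₁, V₂, h⟩ := exists_isTrajectory hs hf hε hν hv
    exact ⟨X₁, X₂, V₁, V₂, h, tendsto_of_isTrajectory hs hf hε hν hv h⟩

theorem existsUnique_isOutgoing (hs : 1 < s) (hf : IsProfile f) (hε : 0 < ε) {v₁ v₂ : E3}
    (hν : ‖ν‖ = 1) (hv : 0 < inner ℝ (v₁ - v₂) ν) :
    ∃! p : E3 × E3, IsOutgoing (fun x => ε * pairPotential f s x) v₁ v₂ ν p := by
  simp only [isOutgoing_iff hs hf hε hν hv]
  exact existsUnique_eq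

theorem outgoing_eq (hs : 1 < s) (hf : IsProfile f) (hε : 0 < ε) {v₁ v₂ : E3}
    (hν : ‖ν‖ = 1) (hv : 0 < inner ℝ (v₁ - v₂) ν) :
    outgoing (fun x => ε * pairPotential f s x) v₁ v₂ ν =
      ((1 / 2 : ℝ) • (v₁ + v₂) +
          (1 / 2 : ℝ) • relOutgoing (fun r => ε * shortRange f s r) (v₁ - v₂) ν,
        (1 / 2 : ℝ) • (v₁ + v₂) -
          (1 / 2 : ℝ) • relOutgoing (fun r => ε * shortRange f s r) (v₁ - v₂) ν) := by
  have h : ∃ p, IsOutgoing (fun x => ε * pairPotential f s x) v₁ v₂ ν p :=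
    (existsUnique_isOutgoing hs hf hε hν hv).exists
  rw [outgoing, dif_pos h]
  exact (isOutgoing_iff hs hf hε hν hv).1 h.choose_spec

end Scattering

/-! ### Spherical coordinates -/

theorem norm_frame₂ {η : E3} (hη : ‖η‖ = 1) : ‖frame₂ η‖ = 1 := by
  have h1 : η 0 ^ 2 + η 1 ^ 2 + η 2 ^ 2 = 1 := by
    have := EuclideanSpace.norm_sq_eq η
    rw [Fin.sum_univ_three, hη] at this
    simpa using this.symm
  have h2 : frame₁ η 0 ^ 2 + frame₁ η 1 ^ 2 + frame₁ η 2 ^ 2 = 1 := by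
    have := EuclideanSpace.norm_sq_eq (frame₁ η)
    rw [Fin.sum_univ_three, norm_frame₁] at this
    simpa using this.symm
  have h3 : η 0 * frame₁ η 0 + η 1 * frame₁ η 1 + η 2 * frame₁ η 2 = 0 := by
    have := inner_frame₁ (η := η)
    rw [PiLp.inner_apply, Fin.sum_univ_three] at this
    simp only [RCLike.inner_apply, conj_trivial] at this
    linarith
  have h : ‖frame₂ η‖ ^ 2 = 1 := by
    rw [EuclideanSpace.norm_sq_eq, Fin.sum_univ_three]
    simp only [frame₂, Real.norm_eq_abs, sq_abs]
    simp
    -- Lagrange's identity |η × e|² = |η|²|e|² - ⟨η,e⟩².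
    linear_combination (frame₁ η 0 ^ 2 + frame₁ η 1 ^ 2 + frame₁ η 2 ^ 2) * h1 + h2 -
      (η 0 * frame₁ η 0 + η 1 * frame₁ η 1 + η 2 * frame₁ η 2) * h3
  exact (pow_eq_one_iff_of_nonneg (norm_nonneg _) two_ne_zero).1 h

theorem inner_frame₂ {η : E3} : inner ℝ η (frame₂ η) = 0 := by
  rw [PiLp.inner_apply, Fin.sum_univ_three]
  simp [frame₂]
  ring

theorem inner_frame₁_frame₂ {η : E3} : inner ℝ (frame₁ η) (frame₂ η) = 0 := by
  rw [PiLp.inner_apply, Fin.sum_univ_three]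
  simp [frame₂]
  ring

theorem orthonormal_frame {η : E3} (hη : ‖η‖ = 1) :
    Orthonormal ℝ ![η, frame₁ η, frame₂ η] := by
  refine ⟨fun i => ?_, fun i j hij => ?_⟩
  · fin_cases i
    · exact hη
    · exact norm_frame₁
    · exact norm_frame₂ hη
  · have h1 := inner_frame₁ (η := η)
    have h2 := inner_frame₂ (η := η)
    have h3 := inner_frame₁_frame₂ (η := η)
    have h1' := (real_inner_comm _ _).trans h1
    have h2' := (real_inner_comm _ _).trans h2
    have h3' := (real_inner_comm _ _).trans h3
    fin_cases i <;> fin_cases j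
    exacts [absurd rfl hij, h1, h2, h1', absurd rfl hij, h3, h2', h3', absurd rfl hij]

/-- The unit vector orthogonal to `η` with azimuth `ϕ`. -/
def azimuthVector (η : E3) (ϕ : ℝ) : E3 := Real.cos ϕ • frame₁ η + Real.sin ϕ • frame₂ η

theorem sphericalPoint_eq (η : E3) (θ ϕ : ℝ) :
    sphericalPoint η θ ϕ = Real.cos θ • η + Real.sin θ • azimuthVector η ϕ := rfl

theorem norm_azimuthVector {η : E3} (hη : ‖η‖ = 1) (ϕ : ℝ) : ‖azimuthVector η ϕ‖ = 1 := by
  have h : ‖azimuthVector η ϕ‖ ^ 2 = 1 := by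
    rw [azimuthVector, norm_add_sq_real, norm_smul, norm_smul, norm_frame₁, norm_frame₂ hη,
      real_inner_smul_left, real_inner_smul_right, inner_frame₁_frame₂]
    simp
  exact (pow_eq_one_iff_of_nonneg (norm_nonneg _) two_ne_zero).1 h

theorem inner_azimuthVector {η : E3} (ϕ : ℝ) : inner ℝ η (azimuthVector η ϕ) = 0 := by
  rw [azimuthVector, inner_add_right, real_inner_smul_right, real_inner_smul_right, inner_frame₁,
    inner_frame₂]
  ring

theorem azimuthVector_add_pi (η : E3) (ϕ : ℝ) :
    azimuthVector η (ϕ + Real.pi) = -azimuthVector η ϕ := by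
  simp only [azimuthVector, Real.cos_add_pi, Real.sin_add_pi]
  module

theorem norm_sphericalPoint {η : E3} (hη : ‖η‖ = 1) (θ ϕ : ℝ) : ‖sphericalPoint η θ ϕ‖ = 1 := by
  have h : ‖sphericalPoint η θ ϕ‖ ^ 2 = 1 := by
    rw [sphericalPoint_eq, norm_add_sq_real, norm_smul, norm_smul, hη, norm_azimuthVector hη,
      real_inner_smul_left, real_inner_smul_right, inner_azimuthVector]
    simp
  exact (pow_eq_one_iff_of_nonneg (norm_nonneg _) two_ne_zero).1 h

theorem inner_sphericalPoint {η : E3} (hη : ‖η‖ = 1) (θ ϕ : ℝ) :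
    inner ℝ η (sphericalPoint η θ ϕ) = Real.cos θ := by
  rw [sphericalPoint_eq, inner_add_right, real_inner_smul_right, real_inner_smul_right,
    inner_azimuthVector, real_inner_self_eq_norm_sq, hη]
  ring

theorem continuous_sphericalPoint (η : E3) :
    Continuous fun p : ℝ × ℝ => sphericalPoint η p.1 p.2 := by
  unfold sphericalPoint
  fun_prop

theorem measurePreserving_frame {η : E3} (hη : ‖η‖ = 1) :
    MeasurePreserving (fun p : ℝ × ℝ × ℝ => p.1 • η + p.2.1 • frame₁ η + p.2.2 • frame₂ η)
      volume volume := by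
  set b := (basisOfOrthonormalOfCardEqFinrank (orthonormal_frame hη) (by simp)).toOrthonormalBasis
    (by rw [coe_basisOfOrthonormalOfCardEqFinrank]; exact orthonormal_frame hη) with hb
  have hbc : (b : Fin 3 → E3) = ![η, frame₁ η, frame₂ η] := by
    rw [hb, Module.Basis.coe_toOrthonormalBasis, coe_basisOfOrthonormalOfCardEqFinrank]
  have h1 : MeasurePreserving (MeasurableEquiv.piFinSuccAbove (fun _ : Fin 3 => ℝ) 0).symm :=
    (volume_preserving_piFinSuccAbove (fun _ : Fin 3 => ℝ) 0).symm
  have h2 : MeasurePreserving (Prod.map id (MeasurableEquiv.finTwoArrow (α := ℝ)).symm :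
      ℝ × ℝ × ℝ → ℝ × (Fin 2 → ℝ)) :=
    (MeasurePreserving.id volume).prod (volume_preserving_finTwoArrow ℝ).symm
  have h3 := b.measurePreserving_repr_symm.comp
    ((PiLp.volume_preserving_toLp (Fin 3)).comp (h1.comp h2))
  have e : (fun p : ℝ × ℝ × ℝ => p.1 • η + p.2.1 • frame₁ η + p.2.2 • frame₂ η) =
      b.repr.symm ∘ WithLp.toLp 2 ∘ (MeasurableEquiv.piFinSuccAbove (fun _ : Fin 3 => ℝ) 0).symm ∘
        Prod.map id (MeasurableEquiv.finTwoArrow (α := ℝ)).symm := by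
    funext p
    rw [Function.comp_apply, ← b.sum_repr (b.repr.symm _), Fin.sum_univ_three, hbc]
    simp [MeasurableEquiv.piFinSuccAbove, MeasurableEquiv.finTwoArrow]
  rw [e]
  exact h3

theorem lintegral_polar (f : ℝ × ℝ → ENNReal) (hf : Measurable f) :
    ∫⁻ p, f p = ∫⁻ r in Set.Ioi (0 : ℝ), ∫⁻ ϕ in Set.Ioo (-Real.pi) Real.pi,
      ENNReal.ofReal r * f (r * Real.cos ϕ, r * Real.sin ϕ) := by
  rw [← lintegral_comp_polarCoord_symm]
  simp only [polarCoord_target, polarCoord_symm_apply, smul_eq_mul]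
  rw [Measure.volume_eq_prod, ← Measure.prod_restrict, lintegral_prod]
  exact (by fun_prop : Measurable _).aemeasurable

/-- Polar coordinates are used twice: in the plane orthogonal to η with radius q, then in the
half-plane formed by the axis and q. The Jacobian is r·q = r² sin θ. The half-plane is completed by
zero, and q > 0 selects θ in (0,π). -/
theorem lintegral_spherical {η : E3} (hη : ‖η‖ = 1) {F : E3 → ENNReal} (hF : Measurable F) :
    ∫⁻ x, F x = ∫⁻ r in Set.Ioi (0 : ℝ), ∫⁻ θ in Set.Ioo 0 Real.pi,
      ∫⁻ ϕ in Set.Ioo (-Real.pi) Real.pi,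
        ENNReal.ofReal (r ^ 2 * Real.sin θ) * F (r • sphericalPoint η θ ϕ) := by
  set Ψ : ℝ × ℝ × ℝ → E3 := fun p => p.1 • η + p.2.1 • frame₁ η + p.2.2 • frame₂ η with hΨ
  have hFΨ : Measurable fun p => F (Ψ p) := hF.comp (measurePreserving_frame hη).measurable
  set K : ℝ × ℝ → ENNReal := fun p => ∫⁻ ϕ in Set.Ioo (-Real.pi) Real.pi,
    ENNReal.ofReal p.2 * F (Ψ (p.1, p.2 * Real.cos ϕ, p.2 * Real.sin ϕ)) with hK
  have hKm : Measurable K := by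
    have : Measurable fun q : (ℝ × ℝ) × ℝ => ENNReal.ofReal q.1.2 *
        F (Ψ (q.1.1, q.1.2 * Real.cos q.2, q.1.2 * Real.sin q.2)) :=
      (by fun_prop : Measurable fun q : (ℝ × ℝ) × ℝ => ENNReal.ofReal q.1.2).mul
        (hFΨ.comp (by fun_prop))
    exact this.lintegral_prod_right'
  have h1 : ∫⁻ x, F x = ∫⁻ a : ℝ, ∫⁻ q in Set.Ioi (0 : ℝ), K (a, q) := by
    rw [← (measurePreserving_frame hη).lintegral_comp hF, Measure.volume_eq_prod,
      lintegral_prod _ hFΨ.aemeasurable]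
    refine lintegral_congr fun a => ?_
    exact lintegral_polar (fun p => F (Ψ (a, p))) (hFΨ.comp measurable_prodMk_left)
  have h2 : ∫⁻ a : ℝ, ∫⁻ q in Set.Ioi (0 : ℝ), K (a, q) =
      ∫⁻ p : ℝ × ℝ, {p : ℝ × ℝ | 0 < p.2}.indicator K p := by
    have hm : MeasurableSet {p : ℝ × ℝ | 0 < p.2} := measurableSet_lt measurable_const measurable_snd
    rw [Measure.volume_eq_prod, lintegral_prod _ (hKm.indicator hm).aemeasurable]
    refine lintegral_congr fun a => ?_
    rw [← lintegral_indicator measurableSet_Ioi]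
    rfl
  have hm : MeasurableSet {p : ℝ × ℝ | 0 < p.2} := measurableSet_lt measurable_const measurable_snd
  rw [h1, h2, lintegral_polar _ (hKm.indicator hm)]
  refine setLIntegral_congr_fun measurableSet_Ioi fun r hr => ?_
  have hr' : (0 : ℝ) < r := hr
  have h3 : ∀ θ ∈ Set.Ioo (-Real.pi) Real.pi, ENNReal.ofReal r *
      {p : ℝ × ℝ | 0 < p.2}.indicator K (r * Real.cos θ, r * Real.sin θ) =
      (Set.Ioo 0 Real.pi).indicator (fun θ => ENNReal.ofReal r * K (r * Real.cos θ, r * Real.sin θ))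
        θ := by
    intro θ hθ
    rcases lt_or_ge 0 θ with h | h
    · rw [Set.indicator_of_mem (show θ ∈ Set.Ioo 0 Real.pi from ⟨h, hθ.2⟩), Set.indicator_of_mem]
      exact mul_pos hr' (Real.sin_pos_of_pos_of_lt_pi h hθ.2)
    · rw [Set.indicator_of_notMem (s := Set.Ioo 0 Real.pi) (fun h' => not_lt.2 h h'.1), Set.indicator_of_notMem, mul_zero]
      intro h'
      have h'' : 0 < r * Real.sin θ := h'
      have := Real.sin_nonpos_of_nonpos_of_neg_pi_le h hθ.1.le
      nlinarith
  rw [setLIntegral_congr_fun measurableSet_Ioo h3, setLIntegral_indicator measurableSet_Ioo,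
    Set.inter_eq_left.2 (Set.Ioo_subset_Ioo_left (by linarith [Real.pi_pos]))]
  refine setLIntegral_congr_fun measurableSet_Ioo fun θ hθ => ?_
  simp only [hK]
  rw [← lintegral_const_mul' _ _ ENNReal.ofReal_ne_top]
  refine lintegral_congr fun ϕ => ?_
  rw [← mul_assoc, ← ENNReal.ofReal_mul hr'.le]
  congr 2
  · ring
  · simp only [hΨ, sphericalPoint]
    module

/-- Surface measure in the coordinates `(θ, ϕ)`. -/
def angularMeasure : Measure (ℝ × ℝ) :=
  ((volume.restrict (Set.Ioo 0 Real.pi)).prod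
    (volume.restrict (Set.Ioo (-Real.pi) Real.pi))).withDensity
      fun p => ENNReal.ofReal (Real.sin p.1)

theorem lintegral_angularMeasure {h : ℝ × ℝ → ENNReal} (hh : Measurable h) :
    ∫⁻ p, h p ∂angularMeasure = ∫⁻ θ in Set.Ioo 0 Real.pi, ∫⁻ ϕ in Set.Ioo (-Real.pi) Real.pi,
      ENNReal.ofReal (Real.sin θ) * h (θ, ϕ) := by
  rw [angularMeasure, lintegral_withDensity_eq_lintegral_mul _ (by fun_prop) hh, lintegral_prod]
  · rfl
  · exact (by fun_prop : Measurable _).aemeasurable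

/-- The point of the sphere with polar angle and azimuth `p`. -/
def spherePoint {η : E3} (hη : ‖η‖ = 1) (p : ℝ × ℝ) : S2 :=
  ⟨sphericalPoint η p.1 p.2, by simp [norm_sphericalPoint hη]⟩

theorem measurable_spherePoint {η : E3} (hη : ‖η‖ = 1) : Measurable (spherePoint hη) :=
  ((continuous_sphericalPoint η).subtype_mk _).measurable

/-- The surface measure of S is three times the volume of the cone over S. In spherical coordinates
the radial integral splits off as ∫₀¹ r² dr = 1/3. -/
theorem measurePreserving_spherePoint {η : E3} (hη : ‖η‖ = 1) :
    MeasurePreserving (spherePoint hη) angularMeasure surface := by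
  refine ⟨measurable_spherePoint hη, ?_⟩
  classical
  ext S hS
  have hne : ∀ r θ ϕ : ℝ, 0 < r → (r • sphericalPoint η θ ϕ ∈ Set.Ioo (0 : ℝ) 1 • ((↑) '' S : Set E3) ↔
      r < 1 ∧ spherePoint hη (θ, ϕ) ∈ S) := by
    intro r θ ϕ hr
    constructor
    · rintro ⟨ρ, hρ, _, ⟨ν, hν, rfl⟩, h⟩
      have h' : ρ • (ν : E3) = r • sphericalPoint η θ ϕ := h
      have hνn : ‖(ν : E3)‖ = 1 := by simp
      have h1 : ρ = r := by
        have := congrArg norm h'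
        rwa [norm_smul, norm_smul, hνn, norm_sphericalPoint hη, mul_one, mul_one,
          Real.norm_of_nonneg hρ.1.le, Real.norm_of_nonneg hr.le] at this
      rw [h1] at h'
      have h2 : (ν : E3) = sphericalPoint η θ ϕ := smul_right_injective E3 hr.ne' h'
      refine ⟨h1 ▸ hρ.2, ?_⟩
      have h3 : spherePoint hη (θ, ϕ) = ν := Subtype.ext h2.symm
      rwa [h3]
    · rintro ⟨h1, h2⟩
      exact ⟨r, ⟨hr, h1⟩, _, ⟨_, h2, rfl⟩, rfl⟩
  have hcone : MeasurableSet (Set.Ioo (0 : ℝ) 1 • ((↑) '' S : Set E3)) := by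
    have h1 : Set.Ioo (0 : ℝ) 1 • ((↑) '' S : Set E3) =
        {x | ‖x‖ ∈ Set.Ioo (0 : ℝ) 1} ∩ (fun x : E3 => ‖x‖⁻¹ • x) ⁻¹' ((↑) '' S) := by
      ext x
      constructor
      · rintro ⟨ρ, hρ, _, ⟨ν, hν, rfl⟩, rfl⟩
        have hνn : ‖(ν : E3)‖ = 1 := by simp
        have h2 : ‖ρ • (ν : E3)‖ = ρ := by
          rw [norm_smul, hνn, mul_one, Real.norm_of_nonneg hρ.1.le]
        refine ⟨?_, ν, hν, ?_⟩
        · show ‖ρ • (ν : E3)‖ ∈ Set.Ioo (0 : ℝ) 1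
          rwa [h2]
        · show (ν : E3) = ‖ρ • (ν : E3)‖⁻¹ • ρ • (ν : E3)
          rw [h2, inv_smul_smul₀ hρ.1.ne']
      · rintro ⟨h2, h3⟩
        have h2' : ‖x‖ ∈ Set.Ioo (0 : ℝ) 1 := h2
        exact ⟨‖x‖, h2, _, h3, smul_inv_smul₀ h2'.1.ne' x⟩
    rw [h1]
    refine (measurable_norm measurableSet_Ioo).inter ?_
    exact (by fun_prop : Measurable fun x : E3 => ‖x‖⁻¹ • x)
      ((MeasurableEmbedding.subtype_coe Metric.isClosed_sphere.measurableSet).measurableSet_image.2 hS)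
  rw [Measure.map_apply (measurable_spherePoint hη) hS, surface, Measure.toSphere_apply' _ hS,
    ← lintegral_indicator_one hcone, lintegral_spherical hη (measurable_one.indicator hcone),
    ← lintegral_indicator_one (measurable_spherePoint hη hS),
    lintegral_angularMeasure (measurable_one.indicator (measurable_spherePoint hη hS))]
  set A := ∫⁻ θ in Set.Ioo 0 Real.pi, ∫⁻ ϕ in Set.Ioo (-Real.pi) Real.pi,
      ENNReal.ofReal (Real.sin θ) * (spherePoint hη ⁻¹' S).indicator 1 (θ, ϕ) with hA
  have h1 : ∀ r ∈ Set.Ioi (0 : ℝ), (∫⁻ θ in Set.Ioo 0 Real.pi, ∫⁻ ϕ in Set.Ioo (-Real.pi) Real.pi,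
        ENNReal.ofReal (r ^ 2 * Real.sin θ) *
          (Set.Ioo (0 : ℝ) 1 • ((↑) '' S : Set E3)).indicator 1 (r • sphericalPoint η θ ϕ)) =
      (Set.Ioo (0 : ℝ) 1).indicator (fun r => ENNReal.ofReal (r ^ 2) * A) r := by
    intro r hr
    have hr' : (0 : ℝ) < r := hr
    by_cases h : r < 1
    · rw [Set.indicator_of_mem (show r ∈ Set.Ioo (0 : ℝ) 1 from ⟨hr', h⟩), hA,
        ← lintegral_const_mul' _ _ ENNReal.ofReal_ne_top]
      refine lintegral_congr fun θ => ?_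
      rw [← lintegral_const_mul' _ _ ENNReal.ofReal_ne_top]
      refine lintegral_congr fun ϕ => ?_
      rw [← mul_assoc, ← ENNReal.ofReal_mul (by positivity)]
      congr 1
      simp only [Set.indicator_apply, hne r θ ϕ hr', h, true_and, Set.mem_preimage, Pi.one_apply]
    · rw [Set.indicator_of_notMem (fun h' => h h'.2)]
      simp only [Set.indicator_apply, hne r _ _ hr', h, false_and, if_false, mul_zero,
        lintegral_zero]
  rw [setLIntegral_congr_fun measurableSet_Ioi h1, setLIntegral_indicator measurableSet_Ioo,
    Set.inter_eq_left.2 Set.Ioo_subset_Ioi_self, lintegral_mul_const _ (by fun_prop), ← mul_assoc]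
  have h2 : ∫⁻ r in Set.Ioo (0 : ℝ) 1, ENNReal.ofReal (r ^ 2) = ENNReal.ofReal (1 / 3) := by
    rw [← ofReal_integral_eq_lintegral_ofReal]
    · rw [← integral_Ioc_eq_integral_Ioo, ← intervalIntegral.integral_of_le zero_le_one,
        integral_pow]
      norm_num
    · exact ((continuous_pow 2).integrableOn_Icc (a := (0 : ℝ)) (b := 1)).mono_set
        Set.Ioo_subset_Icc_self
    · exact ae_of_all _ fun r => by positivity
  rw [h2]
  have h3 : ((Module.finrank ℝ E3 : ℕ) : ENNReal) * ENNReal.ofReal (1 / 3) = 1 := by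
    rw [finrank_euclideanSpace_fin, ← ENNReal.ofReal_natCast, ← ENNReal.ofReal_mul (by norm_num)]
    norm_num
  rw [h3, one_mul]

/-! ### Estimates of the collision difference -/

/-- A bounded differentiable function with Lipschitz continuous derivative. -/
structure IsBoundedC11 (A L : ℝ) (ψ : E3 → ℝ) : Prop where
  bound : ∀ v, |ψ v| ≤ A
  diff : Differentiable ℝ ψ
  lip : ∀ x y, ‖fderiv ℝ ψ x - fderiv ℝ ψ y‖ ≤ L * ‖x - y‖

theorem IsC3b.exists_isBoundedC11 {ψ : E3 → ℝ} (h : IsC3b ψ) : ∃ A L, IsBoundedC11 A L ψ := by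
  obtain ⟨A, hA⟩ := h.2 0 (by norm_num)
  obtain ⟨L, hL⟩ := h.2 2 (by norm_num)
  have h1 : ContDiff ℝ 2 (fderiv ℝ ψ) := h.1.fderiv_right (by norm_num)
  refine ⟨A, L, fun v => ?_, h.1.differentiable (by norm_num), fun x y => ?_⟩
  · simpa [norm_iteratedFDeriv_zero] using hA v
  · refine Convex.norm_image_sub_le_of_norm_hasFDerivWithin_le (s := Set.univ)
      (fun z _ => (h1.differentiable (by norm_num) z).hasFDerivAt.hasFDerivWithinAt)
      (fun z _ => ?_) convex_univ (Set.mem_univ y) (Set.mem_univ x)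
    rw [← norm_iteratedFDeriv_one, norm_iteratedFDeriv_fderiv]
    exact hL z

/-- The sum of the values of `ψ` at two antipodal points. -/
def antipodalSum (ψ : E3 → ℝ) (c q : E3) : ℝ := ψ (c + q) + ψ (c - q)

section Bounds

variable {A L : ℝ} {ψ : E3 → ℝ}

theorem IsBoundedC11.lip_nonneg (h : IsBoundedC11 A L ψ) : 0 ≤ L := by
  have h1 := (norm_nonneg _).trans (h.lip (EuclideanSpace.single 0 1) 0)
  simpa using h1

theorem IsBoundedC11.bound_nonneg (h : IsBoundedC11 A L ψ) : 0 ≤ A := (abs_nonneg _).trans (h.bound 0)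

/-- The derivative in q is Dψ(c+q) - Dψ(c-q), of size at most 2L|q|. Symmetry gains one factor R
over the plain Lipschitz bound. -/
theorem IsBoundedC11.abs_antipodalSum_sub_le (h : IsBoundedC11 A L ψ) (c : E3) {q q' : E3} {R : ℝ}
    (hq : ‖q‖ ≤ R) (hq' : ‖q'‖ ≤ R) :
    |antipodalSum ψ c q - antipodalSum ψ c q'| ≤ 2 * L * R * ‖q - q'‖ := by
  have hd : ∀ x : E3, HasFDerivAt (antipodalSum ψ c)
      (fderiv ℝ ψ (c + x) - fderiv ℝ ψ (c - x)) x := fun x => by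
    have h1 : HasFDerivAt (fun x => ψ (c + x)) (fderiv ℝ ψ (c + x)) x :=
      (hasFDerivAt_comp_add_left c).2 (h.diff (c + x)).hasFDerivAt
    have h2 : HasFDerivAt (fun x => ψ (c - x)) (-fderiv ℝ ψ (c - x)) x := by
      have := (h.diff (c - x)).hasFDerivAt.comp x ((hasFDerivAt_id x).const_sub c)
      refine this.congr_fderiv ?_
      ext y
      simp
    exact (h1.add h2).congr_fderiv (sub_eq_add_neg _ _).symm
  refine Convex.norm_image_sub_le_of_norm_hasFDerivWithin_le (s := Metric.closedBall (0 : E3) R)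
    (fun z _ => (hd z).hasFDerivWithinAt) (fun z hz => ?_) (convex_closedBall 0 R)
    (by simpa using hq') (by simpa using hq)
  have hz' : ‖z‖ ≤ R := by simpa using hz
  have h1 := h.lip (c + z) (c - z)
  have h2 : c + z - (c - z) = (2 : ℝ) • z := by module
  rw [h2, norm_smul, Real.norm_of_nonneg zero_le_two] at h1
  have := mul_le_mul_of_nonneg_left hz' h.lip_nonneg
  linarith

theorem collisionDifference_eq (v₁ v₂ σ : E3) :
    collisionDifference ψ v₁ v₂ σ =
      antipodalSum ψ ((1 / 2 : ℝ) • (v₁ + v₂)) ((‖v₁ - v₂‖ / 2) • σ) - ψ v₁ - ψ v₂ := rfl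

theorem norm_direction {v₁ v₂ : E3} (hv : v₁ ≠ v₂) : ‖direction v₁ v₂‖ = 1 := by
  have : ‖v₁ - v₂‖ ≠ 0 := norm_ne_zero_iff.2 (sub_ne_zero.2 hv)
  rw [direction, norm_smul, norm_inv, norm_norm, inv_mul_cancel₀ this]

theorem norm_smul_direction {v₁ v₂ : E3} (hv : v₁ ≠ v₂) :
    ‖v₁ - v₂‖ • direction v₁ v₂ = v₁ - v₂ := by
  rw [direction, smul_inv_smul₀ (norm_ne_zero_iff.2 (sub_ne_zero.2 hv))]

theorem collisionDifference_direction {v₁ v₂ : E3} (hv : v₁ ≠ v₂) :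
    collisionDifference ψ v₁ v₂ (direction v₁ v₂) = 0 := by
  have h1 : (‖v₁ - v₂‖ / 2) • direction v₁ v₂ = (1 / 2 : ℝ) • (v₁ - v₂) := by
    rw [← norm_smul_direction hv, smul_smul, norm_smul_direction hv]
    congr 1
    ring
  rw [collisionDifference, h1]
  have e1 : (1 / 2 : ℝ) • (v₁ + v₂) + (1 / 2 : ℝ) • (v₁ - v₂) = v₁ := by module
  have e2 : (1 / 2 : ℝ) • (v₁ + v₂) - (1 / 2 : ℝ) • (v₁ - v₂) = v₂ := by module
  rw [e1, e2]
  ring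

/-- One factor of the relative speed comes from the radius in the antipodal bound, the other from
the displacement. The square is needed against w^{1-4/s} at small speeds. -/
theorem IsBoundedC11.abs_collisionDifference_sub_le (h : IsBoundedC11 A L ψ) (v₁ v₂ : E3)
    {σ σ' : E3} (hσ : ‖σ‖ ≤ 1) (hσ' : ‖σ'‖ ≤ 1) :
    |collisionDifference ψ v₁ v₂ σ - collisionDifference ψ v₁ v₂ σ'| ≤
      L / 2 * ‖v₁ - v₂‖ ^ 2 * ‖σ - σ'‖ := by
  have hb : ∀ σ : E3, ‖σ‖ ≤ 1 → ‖(‖v₁ - v₂‖ / 2) • σ‖ ≤ ‖v₁ - v₂‖ / 2 := fun σ hσ => by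
    rw [norm_smul, Real.norm_of_nonneg (by positivity)]
    exact mul_le_of_le_one_right (by positivity) hσ
  have h1 := h.abs_antipodalSum_sub_le ((1 / 2 : ℝ) • (v₁ + v₂)) (hb σ hσ) (hb σ' hσ')
  rw [← smul_sub, norm_smul, Real.norm_of_nonneg (by positivity)] at h1
  rw [collisionDifference_eq, collisionDifference_eq]
  convert h1 using 1
  · congr 1
    ring
  · ring

/-- A point and its reflection in the axis `η`. -/
theorem IsBoundedC11.abs_collisionDifference_add_le (h : IsBoundedC11 A L ψ) {v₁ v₂ : E3}
    (hv : v₁ ≠ v₂) (θ ϕ : ℝ) :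
    |collisionDifference ψ v₁ v₂ (sphericalPoint (direction v₁ v₂) θ ϕ) +
      collisionDifference ψ v₁ v₂ (sphericalPoint (direction v₁ v₂) θ (ϕ + Real.pi))| ≤
      2 * L * ‖v₁ - v₂‖ ^ 2 * θ ^ 2 := by
  have hL := h.lip_nonneg
  set η := direction v₁ v₂ with hη
  have hηn : ‖η‖ = 1 := norm_direction hv
  have hη0 : collisionDifference ψ v₁ v₂ η = 0 := collisionDifference_direction hv
  set w := ‖v₁ - v₂‖ with hw
  set u := (1 / 2 : ℝ) • (v₁ + v₂) with hu
  have hw0 : 0 ≤ w := norm_nonneg _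
  set c : E3 := Real.cos θ • η with hc
  set q : E3 := Real.sin θ • azimuthVector η ϕ with hq
  have hqn : ‖(w / 2) • q‖ ≤ w / 2 * |θ| := by
    rw [norm_smul, Real.norm_of_nonneg (by positivity), hq, norm_smul, norm_azimuthVector hηn,
      mul_one, Real.norm_eq_abs]
    exact mul_le_mul_of_nonneg_left Real.abs_sin_le_abs (by positivity)
  have hsec : ∀ a : E3, |antipodalSum ψ a ((w / 2) • q) - 2 * ψ a| ≤ L / 2 * w ^ 2 * θ ^ 2 := by
    intro a
    have h1 := h.abs_antipodalSum_sub_le a hqn (q' := 0) (by rw [norm_zero]; positivity)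
    rw [sub_zero] at h1
    have h2 : antipodalSum ψ a 0 = 2 * ψ a := by simp [antipodalSum]; ring
    rw [h2] at h1
    refine h1.trans ((mul_le_mul_of_nonneg_left hqn (by positivity)).trans_eq ?_)
    rw [← sq_abs θ]
    ring
  have hc1 : ‖c‖ ≤ 1 := by
    rw [hc, norm_smul, hηn, mul_one]
    exact Real.abs_cos_le_one θ
  have hcη : ‖c - η‖ ≤ θ ^ 2 / 2 := by
    have : c - η = (Real.cos θ - 1) • η := by rw [hc]; module
    rw [this, norm_smul, hηn, mul_one, Real.norm_eq_abs, abs_le]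
    have := Real.one_sub_sq_div_two_le_cos (x := θ)
    have := Real.cos_le_one θ
    constructor <;> nlinarith
  have hcd := h.abs_collisionDifference_sub_le v₁ v₂ hc1 hηn.le
  rw [hη0, sub_zero, ← hw] at hcd
  have hcd' : |collisionDifference ψ v₁ v₂ c| ≤ L / 4 * w ^ 2 * θ ^ 2 :=
    hcd.trans ((mul_le_mul_of_nonneg_left hcη (by positivity)).trans_eq (by ring))
  -- The four values of ψ are paired around u ± (w/2)c. Two second differences with increment of
  -- order wθ remain, and the value at c, which lies within θ²/2 of the axis, where the collision
  -- difference vanishes.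
  have e : collisionDifference ψ v₁ v₂ (sphericalPoint η θ ϕ) +
      collisionDifference ψ v₁ v₂ (sphericalPoint η θ (ϕ + Real.pi)) =
      (antipodalSum ψ (u + (w / 2) • c) ((w / 2) • q) - 2 * ψ (u + (w / 2) • c)) +
      (antipodalSum ψ (u - (w / 2) • c) ((w / 2) • q) - 2 * ψ (u - (w / 2) • c)) +
      2 * collisionDifference ψ v₁ v₂ c := by
    rw [sphericalPoint_eq, sphericalPoint_eq, azimuthVector_add_pi, smul_neg, ← hc, ← hq]
    simp only [collisionDifference, antipodalSum, ← hw, ← hu]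
    have a1 : u + (w / 2) • (c + q) = u + (w / 2) • c + (w / 2) • q := by module
    have a2 : u - (w / 2) • (c + q) = u - (w / 2) • c - (w / 2) • q := by module
    have a3 : u + (w / 2) • (c + -q) = u + (w / 2) • c - (w / 2) • q := by module
    have a4 : u - (w / 2) • (c + -q) = u - (w / 2) • c + (w / 2) • q := by module
    rw [a1, a2, a3, a4]
    ring
  rw [e]
  have h1 := abs_le.1 (hsec (u + (w / 2) • c))
  have h2 := abs_le.1 (hsec (u - (w / 2) • c))
  have h3 := abs_le.1 hcd'
  have h4 : 0 ≤ L * w ^ 2 * θ ^ 2 := by positivity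
  rw [abs_le]
  constructor <;> nlinarith

theorem norm_sphericalPoint_sub_le {η : E3} (hη : ‖η‖ = 1) (θ θ' ϕ : ℝ) :
    ‖sphericalPoint η θ ϕ - sphericalPoint η θ' ϕ‖ ≤ |θ - θ'| := by
  have h1 : ‖sphericalPoint η θ ϕ - sphericalPoint η θ' ϕ‖ ^ 2 = 2 - 2 * Real.cos (θ - θ') := by
    have e : sphericalPoint η θ ϕ - sphericalPoint η θ' ϕ =
        (Real.cos θ - Real.cos θ') • η + (Real.sin θ - Real.sin θ') • azimuthVector η ϕ := by
      rw [sphericalPoint_eq, sphericalPoint_eq]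
      module
    rw [e, norm_add_sq_real, norm_smul, norm_smul, hη, norm_azimuthVector hη,
      real_inner_smul_left, real_inner_smul_right, inner_azimuthVector, Real.cos_sub,
      Real.norm_eq_abs, Real.norm_eq_abs, mul_one, mul_one, sq_abs, sq_abs]
    linear_combination Real.sin_sq_add_cos_sq θ + Real.sin_sq_add_cos_sq θ'
  refine le_of_sq_le_sq ?_ (abs_nonneg _)
  rw [h1, sq_abs]
  linarith [Real.one_sub_sq_div_two_le_cos (x := θ - θ')]

/-- The collision difference, integrated over the azimuth. -/
def azimuthIntegral (ψ : E3 → ℝ) (v₁ v₂ : E3) (θ : ℝ) : ℝ :=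
  ∫ ϕ in (0 : ℝ)..(2 * Real.pi),
    collisionDifference ψ v₁ v₂ (sphericalPoint (direction v₁ v₂) θ ϕ)

theorem continuous_collisionDifference (h : Continuous ψ) (v₁ v₂ : E3) :
    Continuous (collisionDifference ψ v₁ v₂) := by
  unfold collisionDifference
  exact (((h.comp (by fun_prop)).add (h.comp (by fun_prop))).sub continuous_const).sub
    continuous_const

theorem IsBoundedC11.continuous (h : IsBoundedC11 A L ψ) : Continuous ψ := h.diff.continuous

theorem IsBoundedC11.continuous_azimuth (h : IsBoundedC11 A L ψ) (v₁ v₂ : E3) (θ : ℝ) :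
    Continuous fun ϕ => collisionDifference ψ v₁ v₂ (sphericalPoint (direction v₁ v₂) θ ϕ) := by
  have h1 : Continuous fun ϕ : ℝ => sphericalPoint (direction v₁ v₂) θ ϕ := by
    unfold sphericalPoint
    fun_prop
  exact (continuous_collisionDifference h.continuous v₁ v₂).comp h1

theorem IsBoundedC11.abs_azimuthIntegral_sub_le (h : IsBoundedC11 A L ψ) {v₁ v₂ : E3} (hv : v₁ ≠ v₂)
    (θ θ' : ℝ) :
    |azimuthIntegral ψ v₁ v₂ θ - azimuthIntegral ψ v₁ v₂ θ'| ≤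
      Real.pi * L * ‖v₁ - v₂‖ ^ 2 * |θ - θ'| := by
  have hη := norm_direction hv
  have hL := h.lip_nonneg
  rw [azimuthIntegral, azimuthIntegral, ← intervalIntegral.integral_sub
    ((h.continuous_azimuth v₁ v₂ θ).intervalIntegrable _ _)
    ((h.continuous_azimuth v₁ v₂ θ').intervalIntegrable _ _)]
  have h1 : ∀ ϕ ∈ Set.uIoc 0 (2 * Real.pi),
      ‖collisionDifference ψ v₁ v₂ (sphericalPoint (direction v₁ v₂) θ ϕ) -
        collisionDifference ψ v₁ v₂ (sphericalPoint (direction v₁ v₂) θ' ϕ)‖ ≤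
      L / 2 * ‖v₁ - v₂‖ ^ 2 * |θ - θ'| := fun ϕ _ =>
    (h.abs_collisionDifference_sub_le v₁ v₂ (norm_sphericalPoint hη θ ϕ).le
      (norm_sphericalPoint hη θ' ϕ).le).trans
    (mul_le_mul_of_nonneg_left (norm_sphericalPoint_sub_le hη θ θ' ϕ) (by positivity))
  refine (intervalIntegral.norm_integral_le_of_norm_le_const h1).trans_eq ?_
  rw [sub_zero, abs_of_pos Real.two_pi_pos]
  ring

/-- By periodicity each azimuth may be paired with the opposite one, which removes the first order
in θ. The resulting θ² is what makes the operator without cutoff converge. -/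
theorem IsBoundedC11.abs_azimuthIntegral_le (h : IsBoundedC11 A L ψ) {v₁ v₂ : E3} (hv : v₁ ≠ v₂)
    (θ : ℝ) :
    |azimuthIntegral ψ v₁ v₂ θ| ≤ 2 * Real.pi * L * ‖v₁ - v₂‖ ^ 2 * θ ^ 2 := by
  set g : ℝ → ℝ := fun ϕ => collisionDifference ψ v₁ v₂ (sphericalPoint (direction v₁ v₂) θ ϕ)
    with hg
  have hgc : Continuous g := h.continuous_azimuth v₁ v₂ θ
  have hper : Function.Periodic g (2 * Real.pi) := fun ϕ => by
    simp only [hg, sphericalPoint, Real.cos_add_two_pi, Real.sin_add_two_pi]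
  have hshift : ∫ ϕ in (0 : ℝ)..(2 * Real.pi), g (ϕ + Real.pi) =
      ∫ ϕ in (0 : ℝ)..(2 * Real.pi), g ϕ := by
    rw [intervalIntegral.integral_comp_add_right, zero_add, add_comm (2 * Real.pi),
      hper.intervalIntegral_add_eq Real.pi 0, zero_add]
  have h2 : 2 * azimuthIntegral ψ v₁ v₂ θ =
      ∫ ϕ in (0 : ℝ)..(2 * Real.pi), (g ϕ + g (ϕ + Real.pi)) := by
    have h4 : Continuous fun ϕ => g (ϕ + Real.pi) := hgc.comp (continuous_add_const Real.pi)
    rw [intervalIntegral.integral_add (hgc.intervalIntegrable _ _) (h4.intervalIntegrable _ _),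
      hshift, two_mul]
    rfl
  have h3 : |2 * azimuthIntegral ψ v₁ v₂ θ| ≤
      2 * L * ‖v₁ - v₂‖ ^ 2 * θ ^ 2 * |2 * Real.pi - 0| := by
    have h4 : ∀ ϕ ∈ Set.uIoc 0 (2 * Real.pi), ‖g ϕ + g (ϕ + Real.pi)‖ ≤
        2 * L * ‖v₁ - v₂‖ ^ 2 * θ ^ 2 := fun ϕ _ => h.abs_collisionDifference_add_le hv θ ϕ
    rw [h2]
    exact intervalIntegral.norm_integral_le_of_norm_le_const h4
  rw [abs_mul, abs_of_pos two_pos, sub_zero, abs_of_pos Real.two_pi_pos] at h3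
  linarith

theorem IsBoundedC11.azimuthIntegral_zero (h : IsBoundedC11 A L ψ) {v₁ v₂ : E3} (hv : v₁ ≠ v₂) :
    azimuthIntegral ψ v₁ v₂ 0 = 0 := by
  have := h.abs_azimuthIntegral_le hv 0
  simpa using this

theorem IsBoundedC11.continuous_azimuthIntegral (h : IsBoundedC11 A L ψ) {v₁ v₂ : E3}
    (hv : v₁ ≠ v₂) : Continuous (azimuthIntegral ψ v₁ v₂) := by
  have hL := h.lip_nonneg
  refine (LipschitzWith.of_dist_le_mul (K := (Real.pi * L * ‖v₁ - v₂‖ ^ 2).toNNReal)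
    fun θ θ' => ?_).continuous
  rw [Real.coe_toNNReal _ (by positivity)]
  exact h.abs_azimuthIntegral_sub_le hv θ θ'

end Bounds

/-! ### The Boltzmann operator of the short-range potential -/

section Boltzmann

variable {f : ℝ → ℝ} {s ε A L : ℝ} {ψ : E3 → ℝ}

theorem exists_isRepulsive_div (hs : 1 < s) (hf : IsProfile f) (hε : 0 < ε) (w : ℝ) :
    ∃ C, IsRepulsive C s (fun r => 4 * (ε * shortRange f s r) / w ^ 2) := by
  obtain ⟨C, hC⟩ := exists_isRepulsive_shortRange hs hf
  refine ⟨4 * ε / w ^ 2 * C, ?_⟩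
  have h := hC.const_mul (a := 4 * ε / w ^ 2) (by positivity)
  have e : (fun r => 4 * (ε * shortRange f s r) / w ^ 2) =
      fun r => 4 * ε / w ^ 2 * shortRange f s r := by
    funext r
    ring
  rw [e]
  exact h

theorem deviationAngle_eq_integral_Ioi_zero (hs : 1 < s) (hf : IsProfile f) (hε : 0 < ε) (w : ℝ)
    {ρ : ℝ} (hρ : 0 ≤ ρ) :
    deviationAngle (fun r => ε * shortRange f s r) w ρ = Real.pi - 2 * ∫ r in Set.Ioi 0,
      ρ / (r ^ 2 * Real.sqrt (1 - ρ ^ 2 / r ^ 2 - 4 * (ε * shortRange f s r) / w ^ 2)) := by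
  rcases hρ.eq_or_lt with rfl | hρ
  · simp [deviationAngle_zero]
  · obtain ⟨C, hC⟩ := exists_isRepulsive_div hs hf hε w
    rw [deviationAngle_eq_deflection, deflection_eq_integral_Ioi_zero (by linarith) hC hρ]
    rfl

theorem measurable_shortRange (hs : 1 < s) (hf : IsProfile f) : Measurable (shortRange f s) := by
  obtain ⟨C, hC⟩ := exists_isRepulsive_shortRange hs hf
  have h1 : shortRange f s = (Set.Ioi 0).indicator (shortRange f s) := by
    funext r
    rcases lt_or_ge 0 r with h | h
    · rw [Set.indicator_of_mem (show r ∈ Set.Ioi 0 from h)]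
    · rw [Set.indicator_of_notMem (show r ∉ Set.Ioi 0 from not_lt.2 h), shortRange,
        if_neg fun h' => not_lt.2 h h'.1]
  rw [h1]
  classical
  rw [← Set.piecewise_eq_indicator]
  exact hC.cont.measurable_piecewise continuousOn_const measurableSet_Ioi

/-- With the fixed range (0,∞) the angle is a parameter integral of a jointly measurable function,
so the turning point need not be discussed. -/
theorem measurable_deviationAngle (hs : 1 < s) (hf : IsProfile f) (hε : 0 < ε) {α : Type*}
    [MeasurableSpace α] {w ρ : α → ℝ} (hw : Measurable w) (hρ : Measurable ρ) (h0 : ∀ x, 0 ≤ ρ x) :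
    Measurable fun x => deviationAngle (fun r => ε * shortRange f s r) (w x) (ρ x) := by
  simp only [fun x => deviationAngle_eq_integral_Ioi_zero hs hf hε (w x) (h0 x)]
  refine measurable_const.sub (measurable_const.mul ?_)
  have hφ := measurable_shortRange hs hf
  refine (StronglyMeasurable.integral_prod_right (f := fun x r => ρ x /
    (r ^ 2 * Real.sqrt (1 - ρ x ^ 2 / r ^ 2 - 4 * (ε * shortRange f s r) / w x ^ 2))) ?_).measurable
  have h1 : Measurable fun p : α × ℝ => shortRange f s p.2 := hφ.comp measurable_snd
  have h2 : Measurable fun p : α × ℝ => ρ p.1 := hρ.comp measurable_fst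
  have h3 : Measurable fun p : α × ℝ => w p.1 := hw.comp measurable_fst
  refine Measurable.stronglyMeasurable ?_
  simp only [Function.uncurry_def]
  fun_prop

theorem measurable_relOutgoing (hs : 1 < s) (hf : IsProfile f) (hε : 0 < ε) {α : Type*}
    [MeasurableSpace α] {v ν : α → E3} (hv : Measurable v) (hν : Measurable ν) :
    Measurable fun x => relOutgoing (fun r => ε * shortRange f s r) (v x) (ν x) := by
  have h1 : Measurable fun x => Real.sqrt (1 - inner ℝ (‖v x‖⁻¹ • v x) (ν x) ^ 2) := by fun_prop
  have h2 := measurable_deviationAngle hs hf hε hv.norm h1 fun x => Real.sqrt_nonneg _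
  have h3 : Measurable fun x => inner ℝ (‖v x‖⁻¹ • v x) (ν x) := by fun_prop
  simp only [relOutgoing]
  exact hv.norm.smul (((h2.cos).smul (hv.norm.inv.smul hv)).sub
    ((h2.sin).smul (h1.inv.smul (hν.sub (h3.smul (hv.norm.inv.smul hv))))))

/-- For tangential ν the scattering analysis says nothing about the outgoing velocities, but there
the factor (v₁ - v₂)·ν vanishes. -/
theorem boltzmannIntegrand_eq (hs : 1 < s) (hf : IsProfile f) (hε : 0 < ε) (v₁ v₂ : E3) (ν : S2) :
    boltzmannIntegrand (fun x => ε * pairPotential f s x) ψ v₁ v₂ ν =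
      {x : ℝ | 0 < x}.indicator (fun x =>
        (antipodalSum ψ ((1 / 2 : ℝ) • (v₁ + v₂))
          ((1 / 2 : ℝ) • relOutgoing (fun r => ε * shortRange f s r) (v₁ - v₂) ν) - ψ v₁ - ψ v₂) *
        maxwellian v₂ * x) (inner ℝ (v₁ - v₂) (ν : E3)) := by
  have hν : ‖(ν : E3)‖ = 1 := by simp
  rw [boltzmannIntegrand]
  rcases lt_trichotomy 0 (inner ℝ (v₁ - v₂) (ν : E3)) with h | h | h
  · rw [if_pos h.le, Set.indicator_of_mem (show _ ∈ {x : ℝ | 0 < x} from h),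
      outgoing_eq hs hf hε hν h]
    rfl
  · rw [← h, mul_zero, ite_self, Set.indicator_of_notMem (show (0 : ℝ) ∉ {x : ℝ | 0 < x} by simp)]
  · rw [if_neg (not_le.2 h), Set.indicator_of_notMem (show _ ∉ {x : ℝ | 0 < x} from not_lt.2 h.le)]

theorem measurable_maxwellian : Measurable maxwellian := by
  unfold maxwellian
  fun_prop

theorem maxwellian_nonneg (v : E3) : 0 ≤ maxwellian v := by
  unfold maxwellian
  positivity

theorem measurable_boltzmannIntegrand (hs : 1 < s) (hf : IsProfile f) (hε : 0 < ε)
    (h : Continuous ψ) (v₁ : E3) : Measurable fun q : E3 × S2 =>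
      boltzmannIntegrand (fun x => ε * pairPotential f s x) ψ v₁ q.1 q.2 := by
  simp only [boltzmannIntegrand_eq hs hf hε]
  have hv : Measurable fun q : E3 × S2 => v₁ - q.1 := by fun_prop
  have hν : Measurable fun q : E3 × S2 => (q.2 : E3) := measurable_subtype_coe.comp measurable_snd
  have hr := measurable_relOutgoing hs hf hε hv hν
  have hi : Measurable fun q : E3 × S2 => inner ℝ (v₁ - q.1) (q.2 : E3) := hv.inner hν
  have hψ := h.measurable
  have ha : Measurable fun q : E3 × S2 => antipodalSum ψ ((1 / 2 : ℝ) • (v₁ + q.1))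
      ((1 / 2 : ℝ) • relOutgoing (fun r => ε * shortRange f s r) (v₁ - q.1) q.2) := by
    unfold antipodalSum
    have h1 : Measurable fun q : E3 × S2 => (1 / 2 : ℝ) • (v₁ + q.1) := by fun_prop
    exact (hψ.comp (h1.add (hr.const_smul (1 / 2 : ℝ)))).add (hψ.comp (h1.sub (hr.const_smul (1 / 2 : ℝ))))
  have hF : Measurable fun q : E3 × S2 => (antipodalSum ψ ((1 / 2 : ℝ) • (v₁ + q.1))
      ((1 / 2 : ℝ) • relOutgoing (fun r => ε * shortRange f s r) (v₁ - q.1) q.2) - ψ v₁ - ψ q.1) *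
      maxwellian q.1 * inner ℝ (v₁ - q.1) (q.2 : E3) :=
    (((ha.sub_const _).sub (hψ.comp measurable_fst)).mul
      (measurable_maxwellian.comp measurable_fst)).mul hi
  exact hF.indicator (measurableSet_lt measurable_const hi)

theorem IsBoundedC11.abs_boltzmannIntegrand_le (h : IsBoundedC11 A L ψ) (hs : 1 < s)
    (hf : IsProfile f) (hε : 0 < ε) (v₁ v₂ : E3) (ν : S2) :
    |boltzmannIntegrand (fun x => ε * pairPotential f s x) ψ v₁ v₂ ν| ≤
      4 * A * (maxwellian v₂ * ‖v₁ - v₂‖) := by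
  have hA := h.bound_nonneg
  have hM := maxwellian_nonneg v₂
  have hν : ‖(ν : E3)‖ = 1 := by simp
  rw [boltzmannIntegrand_eq hs hf hε]
  rcases lt_or_ge 0 (inner ℝ (v₁ - v₂) (ν : E3)) with hi | hi
  · rw [Set.indicator_of_mem (show _ ∈ {x : ℝ | 0 < x} from hi), mul_assoc, abs_mul]
    refine mul_le_mul ?_ ?_ (abs_nonneg _) (by positivity)
    · unfold antipodalSum
      have h1 := abs_le.1 (h.bound v₁)
      have h2 := abs_le.1 (h.bound v₂)
      have h3 := fun x => abs_le.1 (h.bound x)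
      rw [abs_le]
      constructor
      · linarith [h1.2, h2.2, (h3 ((1 / 2 : ℝ) • (v₁ + v₂) +
          (1 / 2 : ℝ) • relOutgoing (fun r => ε * shortRange f s r) (v₁ - v₂) ν)).1,
          (h3 ((1 / 2 : ℝ) • (v₁ + v₂) -
          (1 / 2 : ℝ) • relOutgoing (fun r => ε * shortRange f s r) (v₁ - v₂) ν)).1]
      · linarith [h1.1, h2.1, (h3 ((1 / 2 : ℝ) • (v₁ + v₂) +
          (1 / 2 : ℝ) • relOutgoing (fun r => ε * shortRange f s r) (v₁ - v₂) ν)).2,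
          (h3 ((1 / 2 : ℝ) • (v₁ + v₂) -
          (1 / 2 : ℝ) • relOutgoing (fun r => ε * shortRange f s r) (v₁ - v₂) ν)).2]
    · rw [abs_mul, abs_of_nonneg hM]
      have := abs_real_inner_le_norm (v₁ - v₂) (ν : E3)
      rw [hν, mul_one] at this
      exact mul_le_mul_of_nonneg_left this hM
  · rw [Set.indicator_of_notMem (show _ ∉ {x : ℝ | 0 < x} from not_lt.2 hi), abs_zero]
    positivity

theorem integrable_maxwellian_mul_norm_rpow {p : ℝ} (hp : -3 < p) :
    Integrable fun v : E3 => maxwellian v * ‖v‖ ^ p := by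
  have h1 := (integrable_fun_norm_addHaar (volume : Measure E3)
    (f := fun r : ℝ => r ^ p * Real.exp (-(1 / 2) * r ^ 2))).2 ?_
  · refine (h1.div_const ((2 * Real.pi) ^ (3 / 2 : ℝ))).congr (ae_of_all _ fun v => ?_)
    simp only [maxwellian]
    have : -(1 / 2) * ‖v‖ ^ 2 = -(‖v‖ ^ 2 / 2) := by ring
    rw [this]
    ring
  · have h2 := integrableOn_rpow_mul_exp_neg_mul_sq (b := 1 / 2) (by norm_num) (s := p + 2)
      (by linarith)
    refine h2.congr_fun (fun r hr => ?_) measurableSet_Ioi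
    have hr' : (0 : ℝ) < r := hr
    simp only [finrank_euclideanSpace_fin, smul_eq_mul]
    rw [Real.rpow_add hr', ← mul_assoc]
    norm_num
    ring

theorem integrable_maxwellian_mul_norm_pow (k : ℕ) :
    Integrable fun v : E3 => maxwellian v * ‖v‖ ^ k := by
  have := integrable_maxwellian_mul_norm_rpow (p := k) (by
    have : (0 : ℝ) ≤ k := Nat.cast_nonneg k
    linarith)
  simpa only [Real.rpow_natCast] using this

theorem integrable_maxwellian : Integrable maxwellian := by
  simpa using integrable_maxwellian_mul_norm_pow 0

theorem integrable_maxwellian_mul_relSpeed_pow (v₁ : E3) (k : ℕ) :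
    Integrable fun v : E3 => maxwellian v * ‖v₁ - v‖ ^ k := by
  have h1 : Integrable fun v : E3 =>
      maxwellian v * (2 ^ (k - 1) * (‖v₁‖ ^ k + ‖v‖ ^ k)) := by
    have h2 := ((integrable_maxwellian.mul_const (‖v₁‖ ^ k)).add
      (integrable_maxwellian_mul_norm_pow k)).const_mul (2 ^ (k - 1) : ℝ)
    refine h2.congr (ae_of_all _ fun v => ?_)
    simp only [Pi.add_apply]
    ring
  refine h1.mono' ((measurable_maxwellian.mul (by fun_prop)).aestronglyMeasurable)
    (ae_of_all _ fun v => ?_)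
  have hM := maxwellian_nonneg v
  rw [Real.norm_of_nonneg (by positivity)]
  refine mul_le_mul_of_nonneg_left ?_ hM
  exact (pow_le_pow_left₀ (norm_nonneg _) (norm_sub_le _ _) k).trans
    (add_pow_le (norm_nonneg _) (norm_nonneg _) k)

instance : IsFiniteMeasure surface := inferInstanceAs (IsFiniteMeasure (volume : Measure E3).toSphere)

theorem IsBoundedC11.integrable_boltzmannIntegrand (h : IsBoundedC11 A L ψ) (hs : 1 < s)
    (hf : IsProfile f) (hε : 0 < ε) (v₁ : E3) :
    Integrable (fun q : E3 × S2 =>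
      boltzmannIntegrand (fun x => ε * pairPotential f s x) ψ v₁ q.1 q.2)
      (volume.prod surface) := by
  have h1 : Integrable (fun q : E3 × S2 => 4 * A * (maxwellian q.1 * ‖v₁ - q.1‖) * (1 : ℝ))
      (volume.prod surface) := by
    have := (integrable_maxwellian_mul_relSpeed_pow v₁ 1).const_mul (4 * A)
    simp only [pow_one] at this
    exact this.mul_prod (integrable_const (1 : ℝ))
  refine h1.mono' (measurable_boltzmannIntegrand hs hf hε h.continuous v₁).aestronglyMeasurable
    (ae_of_all _ fun q => ?_)
  rw [mul_one]
  exact h.abs_boltzmannIntegrand_le hs hf hε v₁ q.1 q.2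

/-- Repulsion turns the relative velocity away from ν, hence the shift of the azimuth by π. -/
theorem relOutgoing_sphericalPoint {φ : ℝ → ℝ} {v₁ v₂ : E3} (hv : v₁ ≠ v₂) {α : ℝ}
    (hα : α ∈ Set.Ioo 0 (Real.pi / 2)) (ϕ : ℝ) :
    relOutgoing φ (v₁ - v₂) (sphericalPoint (direction v₁ v₂) α ϕ) =
      ‖v₁ - v₂‖ • sphericalPoint (direction v₁ v₂)
        (deviationAngle φ ‖v₁ - v₂‖ (Real.sin α)) (ϕ + Real.pi) := by
  have hη := norm_direction hv
  have hsin : 0 < Real.sin α :=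
    Real.sin_pos_of_pos_of_lt_pi hα.1 (by linarith [hα.2, Real.pi_pos])
  have h1 : Real.sqrt (1 - Real.cos α ^ 2) = Real.sin α := by
    rw [← Real.sin_sq, Real.sqrt_sq hsin.le]
  have h2 : (Real.sin α)⁻¹ • (sphericalPoint (direction v₁ v₂) α ϕ -
      Real.cos α • direction v₁ v₂) = azimuthVector (direction v₁ v₂) ϕ := by
    rw [sphericalPoint_eq, add_sub_cancel_left, inv_smul_smul₀ hsin.ne']
  have h3 := inner_sphericalPoint hη α ϕ
  rw [relOutgoing]
  change ‖v₁ - v₂‖ • (Real.cos (deviationAngle φ ‖v₁ - v₂‖ (Real.sqrt (1 -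
    inner ℝ (direction v₁ v₂) (sphericalPoint (direction v₁ v₂) α ϕ) ^ 2))) • direction v₁ v₂ -
    Real.sin (deviationAngle φ ‖v₁ - v₂‖ (Real.sqrt (1 -
      inner ℝ (direction v₁ v₂) (sphericalPoint (direction v₁ v₂) α ϕ) ^ 2))) •
    ((Real.sqrt (1 - inner ℝ (direction v₁ v₂) (sphericalPoint (direction v₁ v₂) α ϕ) ^ 2))⁻¹ •
      (sphericalPoint (direction v₁ v₂) α ϕ -
        inner ℝ (direction v₁ v₂) (sphericalPoint (direction v₁ v₂) α ϕ) • direction v₁ v₂))) = _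
  rw [h3, h1, h2, sphericalPoint_eq, azimuthVector_add_pi, smul_neg, ← sub_eq_add_neg]

theorem boltzmannIntegrand_sphericalPoint (hs : 1 < s) (hf : IsProfile f) (hε : 0 < ε) {v₁ v₂ : E3}
    (hv : v₁ ≠ v₂) {α : ℝ} (hα : α ∈ Set.Ioo 0 (Real.pi / 2)) (ϕ : ℝ) :
    boltzmannIntegrand (fun x => ε * pairPotential f s x) ψ v₁ v₂
        (spherePoint (norm_direction hv) (α, ϕ)) =
      collisionDifference ψ v₁ v₂ (sphericalPoint (direction v₁ v₂)
        (deviationAngle (fun r => ε * shortRange f s r) ‖v₁ - v₂‖ (Real.sin α)) (ϕ + Real.pi)) *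
      maxwellian v₂ * (‖v₁ - v₂‖ * Real.cos α) := by
  have hw : 0 < ‖v₁ - v₂‖ := norm_pos_iff.2 (sub_ne_zero.2 hv)
  have hi : inner ℝ (v₁ - v₂) (sphericalPoint (direction v₁ v₂) α ϕ) =
      ‖v₁ - v₂‖ * Real.cos α := by
    rw [← inner_sphericalPoint (norm_direction hv) α ϕ, ← real_inner_smul_left,
      norm_smul_direction hv]
  have hcos : 0 < Real.cos α :=
    Real.cos_pos_of_mem_Ioo ⟨by linarith [hα.1, Real.pi_pos], hα.2⟩
  rw [boltzmannIntegrand_eq hs hf hε]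
  change {x : ℝ | 0 < x}.indicator _ (inner ℝ (v₁ - v₂) (sphericalPoint (direction v₁ v₂) α ϕ)) = _
  rw [hi, Set.indicator_of_mem (show _ ∈ {x : ℝ | 0 < x} from mul_pos hw hcos),
    collisionDifference_eq]
  change (antipodalSum ψ _ ((1 / 2 : ℝ) • relOutgoing _ (v₁ - v₂)
    (sphericalPoint (direction v₁ v₂) α ϕ)) - _ - _) * _ * _ = _
  rw [relOutgoing_sphericalPoint hv hα, smul_smul]
  congr 6
  ring

theorem boltzmannIntegrand_sphericalPoint_eq_zero (hs : 1 < s) (hf : IsProfile f) (hε : 0 < ε)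
    {v₁ v₂ : E3} (hv : v₁ ≠ v₂) {α : ℝ} (hα : α ∈ Set.Icc (Real.pi / 2) Real.pi) (ϕ : ℝ) :
    boltzmannIntegrand (fun x => ε * pairPotential f s x) ψ v₁ v₂
        (spherePoint (norm_direction hv) (α, ϕ)) = 0 := by
  have hi : inner ℝ (v₁ - v₂) (sphericalPoint (direction v₁ v₂) α ϕ) =
      ‖v₁ - v₂‖ * Real.cos α := by
    rw [← inner_sphericalPoint (norm_direction hv) α ϕ, ← real_inner_smul_left,
      norm_smul_direction hv]
  have hcos : Real.cos α ≤ 0 :=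
    Real.cos_nonpos_of_pi_div_two_le_of_le hα.1 (by linarith [hα.2, Real.pi_pos])
  rw [boltzmannIntegrand_eq hs hf hε]
  refine Set.indicator_of_notMem (fun h' => ?_) _
  have h1 : 0 < inner ℝ (v₁ - v₂) (sphericalPoint (direction v₁ v₂) α ϕ) := h'
  rw [hi] at h1
  nlinarith [norm_nonneg (v₁ - v₂)]

theorem integral_surface_eq {η : E3} (hη : ‖η‖ = 1) {h : S2 → ℝ} (hm : Measurable h) {B : ℝ}
    (hB : ∀ ν, |h ν| ≤ B) :
    ∫ ν, h ν ∂surface = ∫ θ in Set.Ioo 0 Real.pi, Real.sin θ *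
      ∫ ϕ in Set.Ioo (-Real.pi) Real.pi, h (spherePoint hη (θ, ϕ)) := by
  have hmp := measurePreserving_spherePoint hη
  have hhm : Measurable fun p => h (spherePoint hη p) := hm.comp hmp.measurable
  have h1 : Integrable (fun p : ℝ × ℝ => Real.sin p.1 * h (spherePoint hη p))
      ((volume.restrict (Set.Ioo 0 Real.pi)).prod
        (volume.restrict (Set.Ioo (-Real.pi) Real.pi))) := by
    have hfin : IsFiniteMeasure ((volume.restrict (Set.Ioo 0 Real.pi)).prod
        (volume.restrict (Set.Ioo (-Real.pi) Real.pi))) := inferInstance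
    refine Integrable.of_bound (C := B)
      (((by fun_prop : Measurable fun p : ℝ × ℝ => Real.sin p.1).mul hhm).aestronglyMeasurable)
      (ae_of_all _ fun p => ?_)
    rw [Real.norm_eq_abs, abs_mul]
    exact (mul_le_of_le_one_left (abs_nonneg _) (Real.abs_sin_le_one _)).trans (hB _)
  rw [← hmp.map_eq, integral_map hmp.measurable.aemeasurable hm.aestronglyMeasurable,
    angularMeasure, integral_withDensity_eq_integral_toReal_smul (by fun_prop)
      (ae_of_all _ fun _ => ENNReal.ofReal_lt_top)]
  have h2 : (fun p : ℝ × ℝ => (ENNReal.ofReal (Real.sin p.1)).toReal • h (spherePoint hη p)) =ᵐ[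
      (volume.restrict (Set.Ioo 0 Real.pi)).prod (volume.restrict (Set.Ioo (-Real.pi) Real.pi))]
      fun p => Real.sin p.1 * h (spherePoint hη p) := by
    rw [Measure.prod_restrict]
    filter_upwards [ae_restrict_mem (measurableSet_Ioo.prod measurableSet_Ioo)] with p hp
    rw [ENNReal.toReal_ofReal (Real.sin_pos_of_mem_Ioo hp.1).le, smul_eq_mul]
  rw [integral_congr_ae h2, integral_prod _ h1]
  simp only [integral_const_mul]

theorem image_sin_Ioo : Real.sin '' Set.Ioo 0 (Real.pi / 2) = Set.Ioo 0 1 := by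
  have h := image_Ioo_of_strictMonoOn (g := Real.sin) (a := 0) (b := Real.pi / 2)
    (by positivity) Real.continuous_sin.continuousOn
    (Real.strictMonoOn_sin.mono (Set.Icc_subset_Icc_left (by linarith [Real.pi_pos])))
  rwa [Real.sin_zero, Real.sin_pi_div_two] at h

theorem integral_azimuth_boltzmannIntegrand (hs : 1 < s) (hf : IsProfile f) (hε : 0 < ε)
    {v₁ v₂ : E3} (hv : v₁ ≠ v₂) {α : ℝ} (hα : α ∈ Set.Ioo 0 (Real.pi / 2)) :
    ∫ ϕ in Set.Ioo (-Real.pi) Real.pi, boltzmannIntegrand (fun x => ε * pairPotential f s x) ψ v₁ v₂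
        (spherePoint (norm_direction hv) (α, ϕ)) =
      azimuthIntegral ψ v₁ v₂
        (deviationAngle (fun r => ε * shortRange f s r) ‖v₁ - v₂‖ (Real.sin α)) *
        maxwellian v₂ * (‖v₁ - v₂‖ * Real.cos α) := by
  simp only [boltzmannIntegrand_sphericalPoint hs hf hε hv hα, integral_mul_const]
  rw [← integral_Ioc_eq_integral_Ioo, ← intervalIntegral.integral_of_le (by linarith [Real.pi_pos]),
    intervalIntegral.integral_comp_add_right (fun ϕ => collisionDifference ψ v₁ v₂
      (sphericalPoint (direction v₁ v₂) (deviationAngle (fun r => ε * shortRange f s r)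
        ‖v₁ - v₂‖ (Real.sin α)) ϕ)), neg_add_cancel, ← two_mul]
  rfl

theorem setIntegral_sin_cos (g : ℝ → ℝ) :
    ∫ α in Set.Ioo 0 (Real.pi / 2), Real.cos α * g (Real.sin α) = ∫ ρ in Set.Ioo 0 1, g ρ := by
  rw [← image_sin_Ioo, integral_image_eq_integral_deriv_smul_of_monotoneOn measurableSet_Ioo
    (fun α _ => (Real.hasDerivAt_sin α).hasDerivWithinAt)
    (Real.strictMonoOn_sin.monotoneOn.mono
      (fun α hα => ⟨by linarith [hα.1, Real.pi_pos], hα.2.le⟩))]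
  rfl

/-- With ρ = sin α the density sin α cos α dα is ρ dρ on (0,1). The range extends to all ρ > 0
because beyond the potential the deflection, and with it the azimuthal integral, is zero. -/
theorem IsBoundedC11.integral_boltzmannIntegrand (h : IsBoundedC11 A L ψ) (hs : 1 < s)
    (hf : IsProfile f) (hε : 0 < ε) {v₁ v₂ : E3} (hv : v₁ ≠ v₂) :
    ∫ ν, boltzmannIntegrand (fun x => ε * pairPotential f s x) ψ v₁ v₂ ν ∂surface =
      maxwellian v₂ * ‖v₁ - v₂‖ * ∫ ρ in Set.Ioi 0, ρ * azimuthIntegral ψ v₁ v₂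
        (deviationAngle (fun r => ε * shortRange f s r) ‖v₁ - v₂‖ ρ) := by
  have hpi := Real.pi_pos
  have hm : Measurable fun ν => boltzmannIntegrand (fun x => ε * pairPotential f s x) ψ v₁ v₂ ν := by
    have h1 : Measurable fun ν : S2 => (v₂, ν) := measurable_prodMk_left
    have h2 := (measurable_boltzmannIntegrand hs hf hε h.continuous v₁).comp h1
    exact h2
  rw [integral_surface_eq (norm_direction hv) hm (h.abs_boltzmannIntegrand_le hs hf hε v₁ v₂)]
  have h0 : ∀ ρ, 1 ≤ ρ → deviationAngle (fun r => ε * shortRange f s r) ‖v₁ - v₂‖ ρ = 0 := by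
    intro ρ hρ1
    obtain ⟨C, hC⟩ := exists_isRepulsive_div hs hf hε ‖v₁ - v₂‖
    rw [deviationAngle_eq_deflection]
    refine deflection_eq_zero (by linarith) hC (by linarith) fun r hr => ?_
    rw [shortRange_eq_zero hf (hρ1.trans hr)]
    ring
  have h1 := fun α hα => integral_azimuth_boltzmannIntegrand (ψ := ψ) hs hf hε hv (α := α) hα
  set D : ℝ → ℝ := deviationAngle (fun r => ε * shortRange f s r) ‖v₁ - v₂‖ with hD
  clear_value D
  set J : ℝ → ℝ := fun θ => ∫ ϕ in Set.Ioo (-Real.pi) Real.pi, boltzmannIntegrand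
    (fun x => ε * pairPotential f s x) ψ v₁ v₂ (spherePoint (norm_direction hv) (θ, ϕ)) with hJ
  have h2 : ∀ θ ∈ Set.Icc (Real.pi / 2) Real.pi, J θ = 0 := fun θ hθ => by
    simp only [hJ, boltzmannIntegrand_sphericalPoint_eq_zero hs hf hε hv hθ, integral_zero]
  have h3 : ∫ θ in Set.Ioo 0 Real.pi, Real.sin θ * J θ =
      ∫ θ in Set.Ioo 0 (Real.pi / 2), Real.sin θ * J θ :=
    setIntegral_eq_of_subset_of_forall_sdiff_eq_zero
      measurableSet_Ioo (Set.Ioo_subset_Ioo_right (by linarith)) fun θ hθ => by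
        rw [h2 θ ⟨not_lt.1 fun h' => hθ.2 ⟨hθ.1.1, h'⟩, hθ.1.2.le⟩, mul_zero]
  have h4 : ∫ θ in Set.Ioo 0 (Real.pi / 2), Real.sin θ * J θ =
      ∫ α in Set.Ioo 0 (Real.pi / 2), Real.cos α * (maxwellian v₂ * ‖v₁ - v₂‖ *
        (Real.sin α * azimuthIntegral ψ v₁ v₂ (D (Real.sin α)))) :=
    setIntegral_congr_fun measurableSet_Ioo fun α hα => by
      have h5 : J α = _ := h1 α hα
      rw [h5]
      ring
  have h6 : ∫ ρ in Set.Ioi 0, ρ * azimuthIntegral ψ v₁ v₂ (D ρ) =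
      ∫ ρ in Set.Ioo 0 1, ρ * azimuthIntegral ψ v₁ v₂ (D ρ) :=
    setIntegral_eq_of_subset_of_forall_sdiff_eq_zero measurableSet_Ioi
      Set.Ioo_subset_Ioi_self fun ρ hρ => by
        rw [h0 ρ (not_lt.1 fun h' => hρ.2 ⟨hρ.1, h'⟩), h.azimuthIntegral_zero hv, mul_zero]
  rw [h6, ← integral_const_mul]
  exact h3.trans (h4.trans (setIntegral_sin_cos (fun ρ => maxwellian v₂ * ‖v₁ - v₂‖ *
      (ρ * azimuthIntegral ψ v₁ v₂ (D ρ)))))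

end Boltzmann

/-! ### Convergence of the deflection in the mean -/

section Mean

variable {C C' s : ℝ} {Ψ Ψ₀ : ℝ → ℝ}

theorem IsRepulsive.mono (h : IsRepulsive C s Ψ) (hC : C ≤ C') : IsRepulsive C' s Ψ where
  nonneg := h.nonneg
  anti := h.anti
  cont := h.cont
  le r hr := (h.le r hr).trans
    (mul_le_mul_of_nonneg_right hC (Real.rpow_nonneg hr.le _))
  sub_le r u hr hu hu1 := (h.sub_le r u hr hu hu1).trans <|
    mul_le_mul_of_nonneg_right (mul_le_mul_of_nonneg_right hC (Real.rpow_nonneg hr.le _))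
      (sub_nonneg.2 hu1.le)

/-- By scaling, the deflection at b is the deflection at 1 for the potential Ψ(b·). Continuity in b
is then continuity in the potential. -/
theorem continuousOn_deflection (hs : 0 < s) (h : IsRepulsive C s Ψ) :
    ContinuousOn (deflection Ψ) (Set.Ioi 0) := by
  intro b hb
  have hb0 : (0 : ℝ) < b := hb
  refine ContinuousAt.continuousWithinAt ?_
  have h1 : Tendsto (fun l : ℝ => C * l ^ (-s)) (𝓝 b) (𝓝 (C * b ^ (-s))) :=
    (Real.continuousAt_rpow_const b (-s) (Or.inl hb0.ne')).tendsto.const_mul C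
  have h2 : ∀ᶠ l in 𝓝 b, IsRepulsive (C * b ^ (-s) + 1) s (fun r => Ψ (l * r)) := by
    filter_upwards [h1.eventually_le_const (lt_add_one _), lt_mem_nhds hb0] with l hl hl0
    exact (h.scale hl0).mono hl
  have h3 : ∀ r, 0 < r → Tendsto (fun l => Ψ (l * r)) (𝓝 b) (𝓝 (Ψ (b * r))) := fun r hr => by
    have h4 : ContinuousAt Ψ (b * r) := h.cont.continuousAt (Ioi_mem_nhds (mul_pos hb0 hr))
    exact h4.tendsto.comp ((continuous_mul_const r).tendsto b)
  have h5 := tendsto_deflection hs h2 ((h.scale hb0).mono (lt_add_one _).le) h3 one_pos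
  rw [deflection_scale hs h one_pos hb0, mul_one] at h5
  refine h5.congr' ?_
  filter_upwards [lt_mem_nhds hb0] with l hl
  rw [deflection_scale hs h one_pos hl, mul_one]

/-- At infinity the integrand is of order b^{1-2s}, and 1 - 2s < -1 by s > 1. -/
theorem integrableOn_mul_min (hs : 1 < s) {a K : ℝ} (ha : 0 ≤ a) (hK : 0 ≤ K) :
    IntegrableOn (fun b : ℝ => b * min a (K * b ^ (-(2 * s)))) (Set.Ioi 0) := by
  have hmeas : ∀ t : Set ℝ, AEStronglyMeasurable (fun b : ℝ => b * min a (K * b ^ (-(2 * s))))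
      (volume.restrict t) := fun t => by
    refine Measurable.aestronglyMeasurable ?_
    fun_prop
  have hnn : ∀ b : ℝ, 0 < b → 0 ≤ b * min a (K * b ^ (-(2 * s))) := fun b hb =>
    mul_nonneg hb.le (le_min ha (mul_nonneg hK (Real.rpow_nonneg hb.le _)))
  rw [← Set.Ioc_union_Ioi_eq_Ioi (zero_le_one (α := ℝ))]
  refine IntegrableOn.union ?_ ?_
  · have h1 : IntegrableOn (fun _ : ℝ => a) (Set.Ioc 0 1) := integrableOn_const (by simp)
    refine h1.mono' (hmeas _) ?_
    filter_upwards [ae_restrict_mem measurableSet_Ioc] with b hb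
    rw [Real.norm_of_nonneg (hnn b hb.1)]
    exact (mul_le_mul_of_nonneg_left (min_le_left _ _) hb.1.le).trans
      (mul_le_of_le_one_left ha hb.2)
  · have h1 : IntegrableOn (fun b : ℝ => K * b ^ (1 - 2 * s)) (Set.Ioi 1) :=
      (integrableOn_Ioi_rpow_of_lt (by linarith) one_pos).const_mul K
    refine h1.mono' (hmeas _) ?_
    filter_upwards [ae_restrict_mem measurableSet_Ioi] with b hb
    have hb0 : (0 : ℝ) < b := one_pos.trans hb
    rw [Real.norm_of_nonneg (hnn b hb0)]
    refine (mul_le_mul_of_nonneg_left (min_le_right _ _) hb0.le).trans_eq ?_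
    rw [sub_eq_add_neg, Real.rpow_add hb0, Real.rpow_one]
    ring

/-- A bound for the square of the deflection angle. -/
def deflectionBound (C s b : ℝ) : ℝ := min (Real.pi ^ 2) ((2 * Real.pi * C) ^ 2 * b ^ (-(2 * s)))

theorem deflection_sq_le (hs : 0 < s) (h : IsRepulsive C s Ψ) {b : ℝ} (hb : 0 < b) :
    deflection Ψ b ^ 2 ≤ deflectionBound C s b := by
  have h0 := deflection_nonneg hs h hb
  refine le_min (pow_le_pow_left₀ h0 (deflection_le_pi hs h hb) 2) ?_
  refine (pow_le_pow_left₀ h0 (deflection_le hs h hb) 2).trans_eq ?_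
  rw [mul_pow, ← Real.rpow_natCast (b ^ (-s)), ← Real.rpow_mul hb.le]
  congr 2
  push_cast
  ring

theorem integrableOn_mul_deflectionBound (hs : 1 < s) (C : ℝ) :
    IntegrableOn (fun b => b * deflectionBound C s b) (Set.Ioi 0) :=
  integrableOn_mul_min hs (sq_nonneg _) (sq_nonneg _)

/-- The distance of two deflection functions that controls the collision operators. -/
def deflectionGap (Ψ Ψ₀ : ℝ → ℝ) (b : ℝ) : ℝ :=
  min |deflection Ψ b - deflection Ψ₀ b| (deflection Ψ b ^ 2 + deflection Ψ₀ b ^ 2)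

theorem deflectionGap_nonneg (b : ℝ) : 0 ≤ deflectionGap Ψ Ψ₀ b :=
  le_min (abs_nonneg _) (by positivity)

theorem deflectionGap_le (hs : 0 < s) (h : IsRepulsive C s Ψ) (h₀ : IsRepulsive C s Ψ₀) {b : ℝ}
    (hb : 0 < b) : deflectionGap Ψ Ψ₀ b ≤ 2 * deflectionBound C s b :=
  (min_le_right _ _).trans
    (by linarith [deflection_sq_le hs h hb, deflection_sq_le hs h₀ hb])

theorem integrableOn_mul_deflectionGap (hs : 1 < s) (h : IsRepulsive C s Ψ)
    (h₀ : IsRepulsive C s Ψ₀) : IntegrableOn (fun b => b * deflectionGap Ψ Ψ₀ b) (Set.Ioi 0) := by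
  have hc := continuousOn_deflection (by linarith) h
  have hc₀ := continuousOn_deflection (by linarith) h₀
  have hcont : ContinuousOn (fun b => b * deflectionGap Ψ Ψ₀ b) (Set.Ioi 0) :=
    continuousOn_id.mul (ContinuousOn.inf (hc.sub hc₀).abs ((hc.pow 2).add (hc₀.pow 2)))
  refine ((integrableOn_mul_deflectionBound hs C).const_mul 2).mono'
    (hcont.aestronglyMeasurable measurableSet_Ioi) ?_
  filter_upwards [ae_restrict_mem measurableSet_Ioi] with b hb
  have hb0 : (0 : ℝ) < b := hb
  rw [Real.norm_of_nonneg (mul_nonneg hb0.le (deflectionGap_nonneg b))]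
  nlinarith [deflectionGap_le (by linarith) h h₀ hb0]

theorem integral_deflectionGap_le (hs : 1 < s) (h : IsRepulsive C s Ψ) (h₀ : IsRepulsive C s Ψ₀) :
    ∫ b in Set.Ioi 0, b * deflectionGap Ψ Ψ₀ b ≤
      ∫ b in Set.Ioi 0, 2 * (b * deflectionBound C s b) := by
  refine setIntegral_mono_on (integrableOn_mul_deflectionGap hs h h₀)
    ((integrableOn_mul_deflectionBound hs C).const_mul 2) measurableSet_Ioi fun b hb => ?_
  have hb0 : (0 : ℝ) < b := hb
  nlinarith [deflectionGap_le (by linarith) h h₀ hb0]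

/-- In the minimum the difference of angles gives pointwise convergence, while the sum of squares
gives the integrable majorant. -/
theorem tendsto_integral_deflectionGap {ι : Type*} {l : Filter ι} [l.IsCountablyGenerated]
    {Ψ : ι → ℝ → ℝ} (hs : 1 < s) (h : ∀ᶠ i in l, IsRepulsive C s (Ψ i)) (h₀ : IsRepulsive C s Ψ₀)
    (hlim : ∀ r, 0 < r → Tendsto (fun i => Ψ i r) l (𝓝 (Ψ₀ r))) :
    Tendsto (fun i => ∫ b in Set.Ioi 0, b * deflectionGap (Ψ i) Ψ₀ b) l (𝓝 0) := by
  have key : Tendsto (fun i => ∫ b in Set.Ioi 0, b * deflectionGap (Ψ i) Ψ₀ b) l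
      (𝓝 (∫ b in Set.Ioi (0 : ℝ), (0 : ℝ))) := by
    refine tendsto_integral_filter_of_dominated_convergence (fun b => 2 * (b * deflectionBound C s b))
      ?_ ?_ ((integrableOn_mul_deflectionBound hs C).const_mul 2) ?_
    · filter_upwards [h] with i hi using (integrableOn_mul_deflectionGap hs hi h₀).aestronglyMeasurable
    · filter_upwards [h] with i hi
      filter_upwards [ae_restrict_mem measurableSet_Ioi] with b hb
      have hb0 : (0 : ℝ) < b := hb
      rw [Real.norm_of_nonneg (mul_nonneg hb0.le (deflectionGap_nonneg b))]
      nlinarith [deflectionGap_le (by linarith) hi h₀ hb0]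
    · filter_upwards [ae_restrict_mem measurableSet_Ioi] with b hb
      have h1 := tendsto_deflection (by linarith) h h₀ hlim hb
      have h2 : Tendsto (fun i => |deflection (Ψ i) b - deflection Ψ₀ b|) l (𝓝 0) := by
        have := (h1.sub_const (deflection Ψ₀ b)).abs
        rwa [sub_self, abs_zero] at this
      have h3 : Tendsto (fun i => deflectionGap (Ψ i) Ψ₀ b) l (𝓝 0) :=
        squeeze_zero (fun i => deflectionGap_nonneg b) (fun i => min_le_left _ _) h2
      simpa using h3.const_mul b
  simpa using key

theorem integral_deflection_scale (hs : 0 < s) (h : IsRepulsive C s Ψ) {l : ℝ} (hl : 0 < l)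
    (G : ℝ → ℝ) :
    ∫ b in Set.Ioi 0, b * G (deflection (fun r => Ψ (l * r)) b) =
      (l ^ 2)⁻¹ * ∫ b in Set.Ioi 0, b * G (deflection Ψ b) := by
  have h1 := integral_comp_mul_left_Ioi (fun x => x * G (deflection Ψ x)) 0 hl
  rw [mul_zero, smul_eq_mul] at h1
  have h2 : ∫ b in Set.Ioi 0, b * G (deflection (fun r => Ψ (l * r)) b) =
      ∫ b in Set.Ioi 0, l⁻¹ * (l * b * G (deflection Ψ (l * b))) :=
    setIntegral_congr_fun measurableSet_Ioi fun b hb => by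
      rw [deflection_scale hs h hb hl]
      field_simp
  rw [h2, integral_const_mul, h1, ← mul_assoc, ← mul_inv, ← sq]

end Mean

/-! ### Collision integrals estimated by the deflection gap. -/

section Comparison

variable {A L C s : ℝ} {ψ : E3 → ℝ} {Ψ Ψ₀ : ℝ → ℝ} {v₁ v₂ : E3}

theorem IsBoundedC11.integrableOn_azimuthIntegral (h : IsBoundedC11 A L ψ) (hv : v₁ ≠ v₂)
    (hs : 1 < s) (hΨ : IsRepulsive C s Ψ) :
    IntegrableOn (fun b => b * azimuthIntegral ψ v₁ v₂ (deflection Ψ b)) (Set.Ioi 0) := by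
  have hL := h.lip_nonneg
  have hc : ContinuousOn (fun b => b * azimuthIntegral ψ v₁ v₂ (deflection Ψ b)) (Set.Ioi 0) :=
    continuousOn_id.mul ((h.continuous_azimuthIntegral hv).comp_continuousOn
      (continuousOn_deflection (by linarith) hΨ))
  refine ((integrableOn_mul_deflectionBound hs C).const_mul
    (2 * Real.pi * L * ‖v₁ - v₂‖ ^ 2)).mono' (hc.aestronglyMeasurable measurableSet_Ioi) ?_
  filter_upwards [ae_restrict_mem measurableSet_Ioi] with b hb
  have hb0 : (0 : ℝ) < b := hb
  rw [Real.norm_eq_abs, abs_mul, abs_of_pos hb0]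
  calc b * |azimuthIntegral ψ v₁ v₂ (deflection Ψ b)|
      ≤ b * (2 * Real.pi * L * ‖v₁ - v₂‖ ^ 2 * deflectionBound C s b) := by
        refine mul_le_mul_of_nonneg_left ((h.abs_azimuthIntegral_le hv _).trans
          (mul_le_mul_of_nonneg_left (deflection_sq_le (by linarith) hΨ hb0) (by positivity))) hb0.le
    _ = _ := by ring

theorem IsBoundedC11.abs_integral_azimuthIntegral_le (h : IsBoundedC11 A L ψ) (hv : v₁ ≠ v₂)
    (hs : 1 < s) (hΨ : IsRepulsive C s Ψ) :
    |∫ b in Set.Ioi 0, b * azimuthIntegral ψ v₁ v₂ (deflection Ψ b)| ≤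
      2 * Real.pi * L * ‖v₁ - v₂‖ ^ 2 * ∫ b in Set.Ioi 0, b * deflectionBound C s b := by
  have hL := h.lip_nonneg
  rw [← integral_const_mul, ← Real.norm_eq_abs]
  refine norm_integral_le_of_norm_le ((integrableOn_mul_deflectionBound hs C).const_mul _) ?_
  filter_upwards [ae_restrict_mem measurableSet_Ioi] with b hb
  have hb0 : (0 : ℝ) < b := hb
  rw [Real.norm_eq_abs, abs_mul, abs_of_pos hb0]
  calc b * |azimuthIntegral ψ v₁ v₂ (deflection Ψ b)|
      ≤ b * (2 * Real.pi * L * ‖v₁ - v₂‖ ^ 2 * deflectionBound C s b) := by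
        refine mul_le_mul_of_nonneg_left ((h.abs_azimuthIntegral_le hv _).trans
          (mul_le_mul_of_nonneg_left (deflection_sq_le (by linarith) hΨ hb0) (by positivity))) hb0.le
    _ = _ := by ring

/-- The azimuthal integral is Lipschitz in θ and also of order θ², both with a factor w². The gap
takes the better of the two bounds at each b. -/
theorem IsBoundedC11.abs_integral_azimuthIntegral_sub_le (h : IsBoundedC11 A L ψ) (hv : v₁ ≠ v₂)
    (hs : 1 < s) (hΨ : IsRepulsive C s Ψ) (hΨ₀ : IsRepulsive C s Ψ₀) :
    |(∫ b in Set.Ioi 0, b * azimuthIntegral ψ v₁ v₂ (deflection Ψ b)) -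
      ∫ b in Set.Ioi 0, b * azimuthIntegral ψ v₁ v₂ (deflection Ψ₀ b)| ≤
      2 * Real.pi * L * ‖v₁ - v₂‖ ^ 2 * ∫ b in Set.Ioi 0, b * deflectionGap Ψ Ψ₀ b := by
  have hL := h.lip_nonneg
  rw [← integral_sub (h.integrableOn_azimuthIntegral hv hs hΨ)
    (h.integrableOn_azimuthIntegral hv hs hΨ₀), ← integral_const_mul, ← Real.norm_eq_abs]
  refine norm_integral_le_of_norm_le ((integrableOn_mul_deflectionGap hs hΨ hΨ₀).const_mul _) ?_
  filter_upwards [ae_restrict_mem measurableSet_Ioi] with b hb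
  have hb0 : (0 : ℝ) < b := hb
  rw [← mul_sub, Real.norm_eq_abs, abs_mul, abs_of_pos hb0, mul_left_comm]
  refine mul_le_mul_of_nonneg_left ?_ hb0.le
  have h0 : 0 ≤ Real.pi * L * ‖v₁ - v₂‖ ^ 2 := by positivity
  unfold deflectionGap
  rcases min_choice |deflection Ψ b - deflection Ψ₀ b| (deflection Ψ b ^ 2 + deflection Ψ₀ b ^ 2)
    with hm | hm
  · rw [hm]
    have h1 := h.abs_azimuthIntegral_sub_le hv (deflection Ψ b) (deflection Ψ₀ b)
    nlinarith [mul_nonneg h0 (abs_nonneg (deflection Ψ b - deflection Ψ₀ b))]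
  · rw [hm]
    have h1 := abs_le.1 (h.abs_azimuthIntegral_le hv (deflection Ψ b))
    have h2 := abs_le.1 (h.abs_azimuthIntegral_le hv (deflection Ψ₀ b))
    rw [abs_le]
    constructor <;> linarith [h1.1, h1.2, h2.1, h2.2]

end Comparison

/-! ### The grazing limit -/

section Limit

variable {A L s ε : ℝ} {f : ℝ → ℝ} {ψ : E3 → ℝ} {v₁ v₂ : E3}

theorem impactParameter_hom (s w : ℝ) :
    impactParameter (fun r => 1 / r ^ s) w = homInverse (4 / w ^ 2) s := by
  have h : deviationAngle (fun r => 1 / r ^ s) w = deflection fun r => 4 / w ^ 2 * r ^ (-s) := by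
    funext ρ
    rw [deviationAngle_eq_deflection]
    refine deflection_congr (fun r hr => ?_) ρ
    rw [Real.rpow_neg hr.le]
    ring
  funext θ
  rw [impactParameter, homInverse, h]

theorem angularIntegrand_eq {θ : ℝ} (hθ : θ ∈ Set.Ioo 0 Real.pi) :
    angularIntegrand s ψ v₁ v₂ θ = maxwellian v₂ * ‖v₁ - v₂‖ * (azimuthIntegral ψ v₁ v₂ θ *
      (homInverse (4 / ‖v₁ - v₂‖ ^ 2) s θ * |deriv (homInverse (4 / ‖v₁ - v₂‖ ^ 2) s) θ|)) := by
  have hsin := Real.sin_pos_of_mem_Ioo hθ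
  rw [angularIntegrand, homogeneousKernel, collisionKernel, impactParameter_hom,
    Real.arccos_cos hθ.1.le hθ.2.le, ← azimuthIntegral]
  field_simp

theorem div_sq_pos (hv : v₁ ≠ v₂) : 0 < 4 / ‖v₁ - v₂‖ ^ 2 := by
  have := norm_pos_iff.2 (sub_ne_zero.2 hv)
  positivity

theorem IsBoundedC11.integrableOn_angularIntegrand (h : IsBoundedC11 A L ψ) (hs : 1 < s)
    (hv : v₁ ≠ v₂) : IntegrableOn (angularIntegrand s ψ v₁ v₂) (Set.Ioo 0 Real.pi) := by
  have h1 := (integrableOn_homInverse_iff hs (div_sq_pos hv) (azimuthIntegral ψ v₁ v₂)).1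
    (h.integrableOn_azimuthIntegral hv hs ((isRepulsive_rpow hs).const_mul (div_sq_pos hv).le))
  exact IntegrableOn.congr_fun (h1.const_mul (maxwellian v₂ * ‖v₁ - v₂‖))
    (fun θ hθ => (angularIntegrand_eq hθ).symm) measurableSet_Ioo

/-- The integral over all impact parameters, for the normalized potential `Ψ`. -/
def impactIntegral (ψ : E3 → ℝ) (v₁ v₂ : E3) (Ψ : ℝ → ℝ) : ℝ :=
  ∫ b in Set.Ioi 0, b * azimuthIntegral ψ v₁ v₂ (deflection Ψ b)

/-- The normalized limit potential. -/
def limitPotential (f : ℝ → ℝ) (s r : ℝ) : ℝ := 4 * f 0 * r ^ (-s)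

theorem isRepulsive_limitPotential (hs : 1 < s) (hf : IsProfile f) :
    IsRepulsive (4 * f 0 * s) s (limitPotential f s) :=
  (isRepulsive_rpow hs).const_mul (by linarith [hf.pos_zero])

/-- With l = (f(0)w²)^{1/s} the potential 4r^{-s}/w² is the limit potential at lr. The factor l^{-2}
= f(0)^{-2/s} w^{-4/s} produces the constant of the theorem. -/
theorem sphereIntegral_eq (hs : 1 < s) (hf : IsProfile f) (hv : v₁ ≠ v₂) :
    f 0 ^ (2 / s) * sphereIntegral s ψ v₁ v₂ =
      maxwellian v₂ * ‖v₁ - v₂‖ ^ (1 - 4 / s) * impactIntegral ψ v₁ v₂ (limitPotential f s) := by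
  have hs0 : s ≠ 0 := by linarith
  have hw : 0 < ‖v₁ - v₂‖ := norm_pos_iff.2 (sub_ne_zero.2 hv)
  have hf0 := hf.pos_zero
  have h1 : sphereIntegral s ψ v₁ v₂ = maxwellian v₂ * ‖v₁ - v₂‖ *
      impactIntegral ψ v₁ v₂ (fun r => 4 / ‖v₁ - v₂‖ ^ 2 * r ^ (-s)) := by
    rw [impactIntegral, ← integral_homInverse hs (div_sq_pos hv), ← integral_const_mul]
    exact setIntegral_congr_fun measurableSet_Ioo fun θ hθ => angularIntegrand_eq hθ
  set w := ‖v₁ - v₂‖ with hwdef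
  set l := (f 0 * w ^ 2) ^ (1 / s) with hl
  have hl0 : 0 < l := by positivity
  have h2 : impactIntegral ψ v₁ v₂ (fun r => 4 / w ^ 2 * r ^ (-s)) =
      (l ^ 2)⁻¹ * impactIntegral ψ v₁ v₂ (limitPotential f s) := by
    rw [impactIntegral, impactIntegral, ← integral_deflection_scale (by linarith)
      (isRepulsive_limitPotential hs hf) hl0]
    refine setIntegral_congr_fun measurableSet_Ioi fun b _ => ?_
    rw [deflection_congr (Ψ₂ := fun r => limitPotential f s (l * r)) fun r hr => ?_]
    rw [limitPotential, Real.mul_rpow hl0.le hr.le, hl, ← Real.rpow_mul (by positivity)]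
    have : 1 / s * -s = -1 := by field_simp
    rw [this, Real.rpow_neg_one]
    field_simp
  have h3 : (l ^ 2)⁻¹ = f 0 ^ (-(2 / s)) * w ^ (-(4 / s)) := by
    rw [hl, ← Real.rpow_natCast, ← Real.rpow_mul (by positivity), ← Real.rpow_neg (by positivity),
      Real.mul_rpow hf0.le (by positivity), ← Real.rpow_natCast w, ← Real.rpow_mul hw.le]
    congr 2 <;> push_cast <;> ring
  have h4 : f 0 ^ (2 / s) * f 0 ^ (-(2 / s)) = 1 := by
    rw [← Real.rpow_add hf0, add_neg_cancel, Real.rpow_zero]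
  rw [h1, h2, h3, sub_eq_add_neg, Real.rpow_add hw, Real.rpow_one]
  linear_combination (maxwellian v₂ * w * w ^ (-(4 / s)) *
    impactIntegral ψ v₁ v₂ (limitPotential f s)) * h4

/-- The same dilation as for the limit operator, now by (ε/w²)^{1/s}. Both operators acquire the
same prefactor and differ only in the potential inside `impactIntegral`. -/
theorem IsBoundedC11.boltzmann_sphere_eq (h : IsBoundedC11 A L ψ) (hs : 1 < s) (hf : IsProfile f)
    (hε : 0 < ε) (hv : v₁ ≠ v₂) :
    1 / ε ^ (2 / s) * ∫ ν, boltzmannIntegrand (fun x => ε * pairPotential f s x) ψ v₁ v₂ ν ∂surface =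
      maxwellian v₂ * ‖v₁ - v₂‖ ^ (1 - 4 / s) *
        impactIntegral ψ v₁ v₂ (scaledPotential f s (ε / ‖v₁ - v₂‖ ^ 2)) := by
  have hs0 : s ≠ 0 := by linarith
  have hw : 0 < ‖v₁ - v₂‖ := norm_pos_iff.2 (sub_ne_zero.2 hv)
  rw [h.integral_boltzmannIntegrand hs hf hε hv]
  obtain ⟨C, hC⟩ := exists_isRepulsive_div hs hf hε ‖v₁ - v₂‖
  set w := ‖v₁ - v₂‖ with hwdef
  set κ := ε / w ^ 2 with hκ
  have hκ0 : 0 < κ := by positivity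
  have h1 : impactIntegral ψ v₁ v₂ (scaledPotential f s κ) = ((κ ^ (1 / s)) ^ 2)⁻¹ *
      ∫ ρ in Set.Ioi 0, ρ * azimuthIntegral ψ v₁ v₂
        (deviationAngle (fun r => ε * shortRange f s r) w ρ) := by
    simp only [deviationAngle_eq_deflection]
    rw [impactIntegral, ← integral_deflection_scale (by linarith) hC (Real.rpow_pos_of_pos hκ0 _)]
    have e : scaledPotential f s κ =
        fun r => 4 * (ε * shortRange f s (κ ^ (1 / s) * r)) / w ^ 2 := by
      funext r
      rw [scaledPotential, hκ]
      ring
    rw [e]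
  have h2 : ((κ ^ (1 / s)) ^ 2)⁻¹ = (ε ^ (2 / s))⁻¹ * w ^ (4 / s) := by
    rw [← Real.rpow_natCast, ← Real.rpow_mul hκ0.le, hκ, Real.div_rpow hε.le (by positivity),
      ← Real.rpow_natCast w, ← Real.rpow_mul hw.le, inv_div, div_eq_mul_inv, mul_comm]
    congr 2
    · congr 1
      push_cast
      ring
    · push_cast
      ring
  have h3 : w ^ (1 - 4 / s) * w ^ (4 / s) = w := by
    rw [← Real.rpow_add hw, sub_add_cancel, Real.rpow_one]
  rw [h1, h2]
  linear_combination (-(maxwellian v₂ * (ε ^ (2 / s))⁻¹ * ∫ ρ in Set.Ioi 0, ρ *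
    azimuthIntegral ψ v₁ v₂ (deviationAngle (fun r => ε * shortRange f s r) w ρ))) * h3

/-- The exponent 3 - 4/s lies between -1 and 3. -/
theorem rpow_le_inv_add_pow (hs : 1 < s) {w : ℝ} (hw : 0 < w) :
    w ^ (1 - 4 / s) * w ^ 2 ≤ w⁻¹ + w ^ 3 := by
  have hs0 : 0 < s := by linarith
  have h4 : 4 / s < 4 := by rw [div_lt_iff₀ hs0]; linarith
  have h4' : 0 < 4 / s := by positivity
  have e : w ^ (1 - 4 / s) * w ^ 2 = w ^ (3 - 4 / s) := by
    rw [← Real.rpow_natCast, ← Real.rpow_add hw]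
    congr 1
    push_cast
    ring
  rw [e]
  rcases le_total w 1 with h | h
  · have h1 : w ^ (3 - 4 / s) ≤ w ^ (-1 : ℝ) := Real.rpow_le_rpow_of_exponent_ge hw h (by linarith)
    rw [Real.rpow_neg_one] at h1
    have : 0 ≤ w ^ 3 := by positivity
    linarith
  · have h1 : w ^ (3 - 4 / s) ≤ w ^ (3 : ℝ) := Real.rpow_le_rpow_of_exponent_le h (by linarith)
    have h2 : w ^ (3 : ℝ) = w ^ 3 := by exact_mod_cast Real.rpow_natCast w 3
    rw [h2] at h1
    have : 0 ≤ w⁻¹ := by positivity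
    linarith

/-- The mean distance between the deflection by the scaled potential and by its limit. -/
def meanGap (f : ℝ → ℝ) (s κ : ℝ) : ℝ :=
  ∫ b in Set.Ioi 0, b * deflectionGap (scaledPotential f s κ) (limitPotential f s) b

theorem exists_isRepulsive_uniform (hs : 1 < s) (hf : IsProfile f) :
    ∃ C, (∀ κ, 0 < κ → IsRepulsive C s (scaledPotential f s κ)) ∧
      IsRepulsive C s (limitPotential f s) := by
  obtain ⟨C, hC⟩ := exists_isRepulsive_shortRange hs hf
  exact ⟨max (4 * C) (4 * f 0 * s),
    fun κ hκ => (isRepulsive_scaledPotential hs hC hκ).mono (le_max_left _ _),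
    (isRepulsive_limitPotential hs hf).mono (le_max_right _ _)⟩

theorem meanGap_nonneg (κ : ℝ) : 0 ≤ meanGap f s κ :=
  setIntegral_nonneg measurableSet_Ioi fun b hb =>
    mul_nonneg (le_of_lt hb) (deflectionGap_nonneg b)

theorem exists_meanGap_le (hs : 1 < s) (hf : IsProfile f) :
    ∃ E, 0 ≤ E ∧ ∀ κ, 0 < κ → meanGap f s κ ≤ E := by
  obtain ⟨C, hC, hC₀⟩ := exists_isRepulsive_uniform hs hf
  have h1 : ∀ κ, 0 < κ → meanGap f s κ ≤ ∫ b in Set.Ioi 0, 2 * (b * deflectionBound C s b) :=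
    fun κ hκ => integral_deflectionGap_le hs (hC κ hκ) hC₀
  exact ⟨_, (meanGap_nonneg 1).trans (h1 1 one_pos), h1⟩

theorem tendsto_meanGap (hs : 1 < s) (hf : IsProfile f) :
    Tendsto (meanGap f s) (𝓝[>] 0) (𝓝 0) := by
  obtain ⟨C, hC, hC₀⟩ := exists_isRepulsive_uniform hs hf
  refine tendsto_integral_deflectionGap hs ?_ hC₀ fun r hr => tendsto_scaledPotential hs hf hr
  filter_upwards [self_mem_nhdsWithin] with κ hκ using hC κ hκ

/-- The collision integrals for fixed velocities differ by at most the mean gap. -/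
theorem IsBoundedC11.abs_sphere_sub_le (h : IsBoundedC11 A L ψ) (hs : 1 < s) (hf : IsProfile f)
    (hε : 0 < ε) (hv : v₁ ≠ v₂) :
    |1 / ε ^ (2 / s) * (∫ ν, boltzmannIntegrand (fun x => ε * pairPotential f s x) ψ v₁ v₂ ν
        ∂surface) - f 0 ^ (2 / s) * sphereIntegral s ψ v₁ v₂| ≤
      2 * Real.pi * L * (maxwellian v₂ * (‖v₁ - v₂‖⁻¹ + ‖v₁ - v₂‖ ^ 3)) *
        meanGap f s (ε / ‖v₁ - v₂‖ ^ 2) := by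
  have hw : 0 < ‖v₁ - v₂‖ := norm_pos_iff.2 (sub_ne_zero.2 hv)
  have hL := h.lip_nonneg
  have hM := maxwellian_nonneg v₂
  obtain ⟨C, hC, hC₀⟩ := exists_isRepulsive_uniform hs hf
  have hκ : 0 < ε / ‖v₁ - v₂‖ ^ 2 := by positivity
  have h1 := h.abs_integral_azimuthIntegral_sub_le hv hs (hC _ hκ) hC₀
  have h2 := rpow_le_inv_add_pow hs hw
  have h3 : 0 ≤ maxwellian v₂ * ‖v₁ - v₂‖ ^ (1 - 4 / s) := by positivity
  have hE := meanGap_nonneg (f := f) (s := s) (ε / ‖v₁ - v₂‖ ^ 2)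
  rw [h.boltzmann_sphere_eq hs hf hε hv, sphereIntegral_eq hs hf hv, ← mul_sub, abs_mul,
    abs_of_nonneg h3]
  calc _ ≤ maxwellian v₂ * ‖v₁ - v₂‖ ^ (1 - 4 / s) * (2 * Real.pi * L * ‖v₁ - v₂‖ ^ 2 *
        meanGap f s (ε / ‖v₁ - v₂‖ ^ 2)) := mul_le_mul_of_nonneg_left h1 h3
    _ = 2 * Real.pi * L * (maxwellian v₂ * (‖v₁ - v₂‖ ^ (1 - 4 / s) * ‖v₁ - v₂‖ ^ 2)) *
        meanGap f s (ε / ‖v₁ - v₂‖ ^ 2) := by ring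
    _ ≤ _ := by gcongr

theorem IsBoundedC11.exists_abs_sphereIntegral_le (h : IsBoundedC11 A L ψ) (hs : 1 < s)
    (hf : IsProfile f) : ∃ K, ∀ v₁ v₂ : E3, v₁ ≠ v₂ → |sphereIntegral s ψ v₁ v₂| ≤
      K * (maxwellian v₂ * (‖v₁ - v₂‖⁻¹ + ‖v₁ - v₂‖ ^ 3)) := by
  have hL := h.lip_nonneg
  have hf0 := hf.pos_zero
  have hC₀ := isRepulsive_limitPotential hs hf
  set E := ∫ b in Set.Ioi 0, b * deflectionBound (4 * f 0 * s) s b with hE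
  have hE0 : 0 ≤ E := setIntegral_nonneg measurableSet_Ioi fun b hb =>
    mul_nonneg (le_of_lt hb) (le_min (by positivity)
      (mul_nonneg (by positivity) (Real.rpow_nonneg (le_of_lt hb) _)))
  refine ⟨(f 0 ^ (2 / s))⁻¹ * (2 * Real.pi * L * E), fun v₁ v₂ hv => ?_⟩
  have hw : 0 < ‖v₁ - v₂‖ := norm_pos_iff.2 (sub_ne_zero.2 hv)
  have hM := maxwellian_nonneg v₂
  have hfp : 0 < f 0 ^ (2 / s) := by positivity
  have h1 := h.abs_integral_azimuthIntegral_le hv hs hC₀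
  have h2 := rpow_le_inv_add_pow hs hw
  have h3 : 0 ≤ maxwellian v₂ * ‖v₁ - v₂‖ ^ (1 - 4 / s) := by positivity
  rw [mul_assoc, ← div_eq_inv_mul, le_div_iff₀ hfp, ← abs_of_pos hfp, ← abs_mul, mul_comm,
    sphereIntegral_eq hs hf hv, abs_mul, abs_of_nonneg h3]
  calc _ ≤ maxwellian v₂ * ‖v₁ - v₂‖ ^ (1 - 4 / s) * (2 * Real.pi * L * ‖v₁ - v₂‖ ^ 2 * E) :=
        mul_le_mul_of_nonneg_left h1 h3
    _ = 2 * Real.pi * L * E *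
        (maxwellian v₂ * (‖v₁ - v₂‖ ^ (1 - 4 / s) * ‖v₁ - v₂‖ ^ 2)) := by ring
    _ ≤ _ := by gcongr

/-! ### Integration against the Maxwellian -/

theorem maxwellian_le_one (v : E3) : maxwellian v ≤ 1 := by
  have h1 : (1 : ℝ) ≤ (2 * Real.pi) ^ (3 / 2 : ℝ) :=
    Real.one_le_rpow (by linarith [Real.pi_gt_three]) (by norm_num)
  rw [maxwellian, div_le_one (by linarith)]
  exact (Real.exp_le_one_iff.2 (by
    have := sq_nonneg ‖v‖
    linarith)).trans h1

/-- The function `1/r`, cut off at `r₀`. -/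
def cutInv (r₀ r : ℝ) : ℝ := (Set.Iio r₀).indicator (fun r => r⁻¹) r

theorem cutInv_nonneg (r₀ : ℝ) {r : ℝ} (hr : 0 ≤ r) : 0 ≤ cutInv r₀ r :=
  Set.indicator_apply_nonneg fun _ => inv_nonneg.2 hr

theorem pow_smul_cutInv {r₀ r : ℝ} (hr : 0 < r) :
    r ^ (Module.finrank ℝ E3 - 1) • cutInv r₀ r = (Set.Iio r₀).indicator (fun r => r) r := by
  rw [finrank_euclideanSpace_fin, smul_eq_mul, cutInv]
  by_cases h : r ∈ Set.Iio r₀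
  · rw [Set.indicator_of_mem h, Set.indicator_of_mem h]
    field_simp
  · rw [Set.indicator_of_notMem h, Set.indicator_of_notMem h, mul_zero]

theorem integrable_cutInv (r₀ : ℝ) : Integrable fun x : E3 => cutInv r₀ ‖x‖ := by
  refine (integrable_fun_norm_addHaar (volume : Measure E3)).2 ?_
  have h1 : IntegrableOn (fun r : ℝ => r) (Set.Icc 0 r₀) := continuous_id.integrableOn_Icc
  have h2 : IntegrableOn ((Set.Iio r₀).indicator fun r : ℝ => r) (Set.Ioi 0) := by
    rw [IntegrableOn, integrable_indicator_iff measurableSet_Iio, IntegrableOn,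
      Measure.restrict_restrict measurableSet_Iio]
    exact h1.mono_set fun r hr => ⟨le_of_lt hr.2, le_of_lt hr.1⟩
  exact h2.congr_fun (fun r hr => (pow_smul_cutInv hr).symm) measurableSet_Ioi

theorem tendsto_integral_cutInv :
    Tendsto (fun r₀ => ∫ x : E3, cutInv r₀ ‖x‖) (𝓝[>] 0) (𝓝 0) := by
  have key : Tendsto (fun r₀ => ∫ x : E3, cutInv r₀ ‖x‖) (𝓝[>] 0) (𝓝 (∫ _ : E3, (0 : ℝ))) := by
    refine tendsto_integral_filter_of_dominated_convergence (fun x => cutInv 1 ‖x‖)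
      (Eventually.of_forall fun r₀ => (integrable_cutInv r₀).aestronglyMeasurable) ?_
      (integrable_cutInv 1) ?_
    · filter_upwards [Ioo_mem_nhdsGT one_pos] with r₀ hr₀
      refine ae_of_all _ fun x => ?_
      rw [Real.norm_of_nonneg (cutInv_nonneg r₀ (norm_nonneg x))]
      exact Set.indicator_le_indicator_apply_of_subset (Set.Iio_subset_Iio hr₀.2.le)
        (inv_nonneg.2 (norm_nonneg x))
    · have h0 : ∀ᵐ x : E3, x ≠ 0 := by simp [ae_iff]
      filter_upwards [h0] with x hx
      refine tendsto_const_nhds.congr' ?_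
      filter_upwards [Ioo_mem_nhdsGT (norm_pos_iff.2 hx)] with r₀ hr₀
      exact (Set.indicator_of_notMem (show ‖x‖ ∉ Set.Iio r₀ from not_lt.2 hr₀.2.le) _).symm
  simpa using key

theorem maxwellian_mul_inv_le (v : E3) {w : ℝ} (hw : 0 ≤ w) :
    maxwellian v * w⁻¹ ≤ cutInv 1 w + maxwellian v := by
  have hM := maxwellian_nonneg v
  rcases lt_or_ge w 1 with h | h
  · have h1 : cutInv 1 w = w⁻¹ := Set.indicator_of_mem (show w ∈ Set.Iio 1 from h) _
    have h2 := mul_le_mul_of_nonneg_right (maxwellian_le_one v) (inv_nonneg.2 hw)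
    linarith
  · have h1 := cutInv_nonneg 1 hw
    have h2 := mul_le_mul_of_nonneg_left (inv_le_one_of_one_le₀ h) hM
    linarith

theorem integrable_cutInv_sub (r₀ : ℝ) (v₁ : E3) : Integrable fun v : E3 => cutInv r₀ ‖v₁ - v‖ :=
  (integrable_cutInv r₀).comp_sub_left v₁

theorem integral_cutInv_sub (r₀ : ℝ) (v₁ : E3) :
    ∫ v : E3, cutInv r₀ ‖v₁ - v‖ = ∫ v : E3, cutInv r₀ ‖v‖ :=
  integral_sub_left_eq_self (fun v : E3 => cutInv r₀ ‖v‖) volume v₁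

theorem integrable_weight (v₁ : E3) : Integrable fun v : E3 =>
    cutInv 1 ‖v₁ - v‖ + maxwellian v + maxwellian v * ‖v₁ - v‖ ^ 3 :=
  ((integrable_cutInv_sub 1 v₁).add integrable_maxwellian).add
    (integrable_maxwellian_mul_relSpeed_pow v₁ 3)

theorem exists_integral_weight_le : ∃ K, 0 ≤ K ∧ ∀ v₁ : E3,
    ∫ v : E3, (cutInv 1 ‖v₁ - v‖ + maxwellian v + maxwellian v * ‖v₁ - v‖ ^ 3) ≤
      K * (1 + ‖v₁‖ ^ 3) := by
  set a := ∫ v : E3, cutInv 1 ‖v‖ with ha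
  set b := ∫ v : E3, maxwellian v with hb
  set c := ∫ v : E3, maxwellian v * ‖v‖ ^ 3 with hc
  have ha0 : 0 ≤ a := integral_nonneg fun v => cutInv_nonneg 1 (norm_nonneg v)
  have hb0 : 0 ≤ b := integral_nonneg maxwellian_nonneg
  have hc0 : 0 ≤ c := integral_nonneg fun v => by
    have := maxwellian_nonneg v
    positivity
  -- From |v₁ - v|³ ≤ 4(|v₁|³ + |v|³) the integral is at most a + b + 4(|v₁|³ b + c).
  refine ⟨a + 5 * b + 4 * c, by positivity, fun v₁ => ?_⟩
  have h1 : ∫ v : E3, maxwellian v * ‖v₁ - v‖ ^ 3 ≤ 4 * (‖v₁‖ ^ 3 * b + c) := by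
    have h2 : Integrable fun v : E3 => 4 * (‖v₁‖ ^ 3 * maxwellian v + maxwellian v * ‖v‖ ^ 3) :=
      ((integrable_maxwellian.const_mul _).add (integrable_maxwellian_mul_norm_pow 3)).const_mul 4
    have h3 := integral_mono (integrable_maxwellian_mul_relSpeed_pow v₁ 3) h2 fun v => by
      have hM := maxwellian_nonneg v
      have h4 : ‖v₁ - v‖ ^ 3 ≤ 2 ^ (3 - 1) * (‖v₁‖ ^ 3 + ‖v‖ ^ 3) :=
        (pow_le_pow_left₀ (norm_nonneg _) (norm_sub_le _ _) 3).trans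
          (add_pow_le (norm_nonneg _) (norm_nonneg _) 3)
      norm_num at h4
      nlinarith [mul_le_mul_of_nonneg_left h4 hM]
    rwa [integral_const_mul, integral_add (integrable_maxwellian.const_mul _)
      (integrable_maxwellian_mul_norm_pow 3), integral_const_mul] at h3
  have h5 : Integrable fun v : E3 => cutInv 1 ‖v₁ - v‖ + maxwellian v :=
    (integrable_cutInv_sub 1 v₁).add integrable_maxwellian
  rw [integral_add h5 (integrable_maxwellian_mul_relSpeed_pow v₁ 3), integral_add (integrable_cutInv_sub 1 v₁)
    integrable_maxwellian, integral_cutInv_sub, ← ha, ← hb]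
  have hn : 0 ≤ ‖v₁‖ ^ 3 := by positivity
  nlinarith [mul_nonneg ha0 hn, mul_nonneg hb0 hn, mul_nonneg hc0 hn]

end Limit

/-! ### Integrability in v₂ and the uniform limit. -/

section Limit

variable {A L s ε : ℝ} {f : ℝ → ℝ} {ψ : E3 → ℝ} {v₁ v₂ : E3}

theorem ae_ne_const (v₁ : E3) : ∀ᵐ v : E3, v₁ ≠ v := by
  have : ∀ᵐ v : E3, v ≠ v₁ := by simp [ae_iff]
  filter_upwards [this] with v hv using hv.symm

theorem maxwellian_mul_le_weight {v₁ v₂ : E3} :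
    maxwellian v₂ * (‖v₁ - v₂‖⁻¹ + ‖v₁ - v₂‖ ^ 3) ≤
      cutInv 1 ‖v₁ - v₂‖ + maxwellian v₂ + maxwellian v₂ * ‖v₁ - v₂‖ ^ 3 := by
  rw [mul_add]
  linarith [maxwellian_mul_inv_le v₂ (norm_nonneg (v₁ - v₂))]

theorem IsBoundedC11.integrable_boltzmann_sphere (h : IsBoundedC11 A L ψ) (hs : 1 < s)
    (hf : IsProfile f) (hε : 0 < ε) (v₁ : E3) : Integrable fun v₂ : E3 => 1 / ε ^ (2 / s) *
      ∫ ν, boltzmannIntegrand (fun x => ε * pairPotential f s x) ψ v₁ v₂ ν ∂surface :=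
  (h.integrable_boltzmannIntegrand hs hf hε v₁).integral_prod_left.const_mul _

/-- Up to a positive constant the function is an almost everywhere limit of the short-range
collision integrals along ε = 1/(n+1). This bypasses the measurability of the inverse function and
its derivative. -/
theorem IsBoundedC11.aestronglyMeasurable_sphereIntegral (h : IsBoundedC11 A L ψ) (hs : 1 < s)
    (hf : IsProfile f) (v₁ : E3) : AEStronglyMeasurable (sphereIntegral s ψ v₁) volume := by
  have hfp : 0 < f 0 ^ (2 / s) := Real.rpow_pos_of_pos hf.pos_zero _
  have hlim : ∀ᵐ v₂ : E3, Tendsto (fun ε : ℝ => 1 / ε ^ (2 / s) *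
      ∫ ν, boltzmannIntegrand (fun x => ε * pairPotential f s x) ψ v₁ v₂ ν ∂surface) (𝓝[>] 0)
      (𝓝 (f 0 ^ (2 / s) * sphereIntegral s ψ v₁ v₂)) := by
    filter_upwards [ae_ne_const v₁] with v₂ hv
    have hw : 0 < ‖v₁ - v₂‖ := norm_pos_iff.2 (sub_ne_zero.2 hv)
    have h1 : Tendsto (fun ε : ℝ => ε / ‖v₁ - v₂‖ ^ 2) (𝓝[>] 0) (𝓝[>] 0) := by
      refine tendsto_nhdsWithin_iff.2 ⟨?_, ?_⟩
      · have := (continuous_id.div_const (‖v₁ - v₂‖ ^ 2)).tendsto (0 : ℝ)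
        rw [id, zero_div] at this
        exact this.mono_left nhdsWithin_le_nhds
      · filter_upwards [self_mem_nhdsWithin] with ε hε
        have hε' : (0 : ℝ) < ε := hε
        exact div_pos hε' (by positivity)
    have h2 := ((tendsto_meanGap hs hf).comp h1).const_mul
      (2 * Real.pi * L * (maxwellian v₂ * (‖v₁ - v₂‖⁻¹ + ‖v₁ - v₂‖ ^ 3)))
    rw [mul_zero] at h2
    rw [tendsto_iff_norm_sub_tendsto_zero]
    refine squeeze_zero' (Eventually.of_forall fun _ => norm_nonneg _) ?_ h2
    filter_upwards [self_mem_nhdsWithin] with ε hε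
    exact h.abs_sphere_sub_le hs hf hε hv
  have hu : Tendsto (fun n : ℕ => 1 / ((n : ℝ) + 1)) atTop (𝓝[>] 0) :=
    tendsto_nhdsWithin_iff.2 ⟨tendsto_one_div_add_atTop_nhds_zero_nat,
      Eventually.of_forall fun n => by
        show (0 : ℝ) < 1 / ((n : ℝ) + 1)
        positivity⟩
  have h3 : AEStronglyMeasurable (fun v₂ : E3 => f 0 ^ (2 / s) * sphereIntegral s ψ v₁ v₂) volume := by
    refine aestronglyMeasurable_of_tendsto_ae atTop (f := fun (n : ℕ) (v₂ : E3) =>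
      1 / (1 / ((n : ℝ) + 1)) ^ (2 / s) * ∫ ν, boltzmannIntegrand
        (fun x => 1 / ((n : ℝ) + 1) * pairPotential f s x) ψ v₁ v₂ ν ∂surface)
      (fun n => (h.integrable_boltzmann_sphere hs hf (by positivity) v₁).aestronglyMeasurable) ?_
    filter_upwards [hlim] with v₂ hv₂
    exact hv₂.comp hu
  have h4 := h3.const_mul (f 0 ^ (2 / s))⁻¹
  simpa only [inv_mul_cancel_left₀ hfp.ne'] using h4

theorem IsBoundedC11.integrable_sphereIntegral (h : IsBoundedC11 A L ψ) (hs : 1 < s)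
    (hf : IsProfile f) (v₁ : E3) : Integrable (sphereIntegral s ψ v₁) := by
  obtain ⟨K, hK⟩ := h.exists_abs_sphereIntegral_le hs hf
  refine ((integrable_weight v₁).const_mul |K|).mono'
    (h.aestronglyMeasurable_sphereIntegral hs hf v₁) ?_
  filter_upwards [ae_ne_const v₁] with v₂ hv
  have hM := maxwellian_nonneg v₂
  exact (hK v₁ v₂ hv).trans (mul_le_mul (le_abs_self K) maxwellian_mul_le_weight (by positivity)
    (abs_nonneg K))

/-- Splitting of the error into small and large relative speeds. -/
theorem IsBoundedC11.abs_sphere_sub_le_split (h : IsBoundedC11 A L ψ) (hs : 1 < s)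
    (hf : IsProfile f) {E δ κ₀ w₀ : ℝ} (hE : ∀ κ, 0 < κ → meanGap f s κ ≤ E) (hδ : 0 ≤ δ)
    (hκ₀ : ∀ κ ∈ Set.Ioo 0 κ₀, meanGap f s κ ≤ δ) (hw₀ : 0 < w₀) (hw₁ : w₀ ≤ 1) (hε : 0 < ε)
    (hε₀ : ε < κ₀ * w₀ ^ 2) (hv : v₁ ≠ v₂) :
    |1 / ε ^ (2 / s) * (∫ ν, boltzmannIntegrand (fun x => ε * pairPotential f s x) ψ v₁ v₂ ν
        ∂surface) - f 0 ^ (2 / s) * sphereIntegral s ψ v₁ v₂| ≤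
      2 * Real.pi * L * (2 * E * cutInv w₀ ‖v₁ - v₂‖ +
        δ * (cutInv 1 ‖v₁ - v₂‖ + maxwellian v₂ + maxwellian v₂ * ‖v₁ - v₂‖ ^ 3)) := by
  have hw : 0 < ‖v₁ - v₂‖ := norm_pos_iff.2 (sub_ne_zero.2 hv)
  have hL := h.lip_nonneg
  have hM := maxwellian_nonneg v₂
  have hκ : 0 < ε / ‖v₁ - v₂‖ ^ 2 := by positivity
  have hg := meanGap_nonneg (f := f) (s := s) (ε / ‖v₁ - v₂‖ ^ 2)
  have hE0 : 0 ≤ E := hg.trans (hE _ hκ)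
  refine (h.abs_sphere_sub_le hs hf hε hv).trans ?_
  rw [mul_assoc]
  refine mul_le_mul_of_nonneg_left ?_ (by positivity)
  have hc1 := cutInv_nonneg 1 hw.le
  have hc0 := cutInv_nonneg w₀ hw.le
  -- Below w₀ only the uniform bound E is available, and w³ ≤ 1/w leaves a multiple of the cut-off
  -- 1/w. Above w₀ the parameter κ = ε/w² stays below κ₀, so the gap is at most δ.
  rcases lt_or_ge ‖v₁ - v₂‖ w₀ with hlt | hge
  · have h1 : cutInv w₀ ‖v₁ - v₂‖ = ‖v₁ - v₂‖⁻¹ :=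
      Set.indicator_of_mem (show ‖v₁ - v₂‖ ∈ Set.Iio w₀ from hlt) _
    have h2 : ‖v₁ - v₂‖ ^ 3 ≤ ‖v₁ - v₂‖⁻¹ :=
      (pow_le_one₀ hw.le (hlt.le.trans hw₁)).trans ((one_le_inv₀ hw).2 (hlt.le.trans hw₁))
    calc _ ≤ 1 * (‖v₁ - v₂‖⁻¹ + ‖v₁ - v₂‖⁻¹) * E := by
          gcongr
          · exact maxwellian_le_one v₂
          · exact hE _ hκ
      _ = 2 * E * cutInv w₀ ‖v₁ - v₂‖ := by rw [h1]; ring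
      _ ≤ _ := le_add_of_nonneg_right (by positivity)
  · have h1 : meanGap f s (ε / ‖v₁ - v₂‖ ^ 2) ≤ δ := by
      refine hκ₀ _ ⟨hκ, ?_⟩
      rw [div_lt_iff₀ (by positivity)]
      have hκ0 : 0 < κ₀ := by
        by_contra hn
        nlinarith [sq_nonneg w₀, not_lt.1 hn]
      exact hε₀.trans_le (mul_le_mul_of_nonneg_left (pow_le_pow_left₀ hw₀.le hge 2) hκ0.le)
    have hX : 0 ≤ maxwellian v₂ * (‖v₁ - v₂‖⁻¹ + ‖v₁ - v₂‖ ^ 3) := by positivity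
    calc _ ≤ (cutInv 1 ‖v₁ - v₂‖ + maxwellian v₂ + maxwellian v₂ * ‖v₁ - v₂‖ ^ 3) * δ :=
          mul_le_mul maxwellian_mul_le_weight h1 hg (hX.trans maxwellian_mul_le_weight)
      _ ≤ _ := by
        rw [mul_comm]
        exact le_add_of_nonneg_left (by positivity)

theorem IsBoundedC11.grazing_limit (h : IsBoundedC11 A L ψ) (hs : 1 < s) (hf : IsProfile f)
    {δ : ℝ} (hδ : 0 < δ) : ∃ ε₀ : ℝ, 0 < ε₀ ∧ ∀ ε : ℝ, 0 < ε → ε < ε₀ → ∀ v₁ : E3,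
      |1 / ε ^ (2 / s) * linBoltzmann (fun x => ε * pairPotential f s x) ψ v₁
        - f 0 ^ (2 / s) * nonCutoff s ψ v₁| ≤ δ * (1 + ‖v₁‖ ^ 3) := by
  have hL := h.lip_nonneg
  obtain ⟨E, hE0, hE⟩ := exists_meanGap_le hs hf
  obtain ⟨K, hK0, hK⟩ := exists_integral_weight_le
  set c := 2 * Real.pi * L with hc
  have hc0 : 0 ≤ c := by positivity
  -- Half of δ is reserved for large speeds. The summand 1 keeps the denominator positive when c K =
  -- 0.
  set δ' := δ / (2 * (c * K + 1)) with hδ'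
  have hδ'0 : 0 < δ' := by positivity
  have hδ'K : c * (δ' * K) ≤ δ / 2 := by
    rw [hδ', div_mul_eq_mul_div, mul_div_assoc', div_le_div_iff₀ (by positivity) two_pos]
    nlinarith [mul_nonneg hc0 hK0]
  obtain ⟨κ₀, hκ₀0, hκ₀⟩ : ∃ κ₀ > 0, ∀ κ ∈ Set.Ioo 0 κ₀, meanGap f s κ ≤ δ' := by
    obtain ⟨κ₀, hκ₀, hsub⟩ := (mem_nhdsGT_iff_exists_Ioo_subset).1
      ((tendsto_meanGap hs hf).eventually_le_const hδ'0)
    exact ⟨κ₀, hκ₀, fun κ hκ => hsub hκ⟩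
  obtain ⟨w₀, hw₀, hw⟩ : ∃ w₀ : ℝ, c * (2 * E * ∫ x : E3, cutInv w₀ ‖x‖) ≤ δ / 2 ∧
      w₀ ∈ Set.Ioo (0 : ℝ) 1 := by
    have h1 := (tendsto_integral_cutInv.const_mul (2 * E)).const_mul c
    rw [mul_zero, mul_zero] at h1
    exact ((h1.eventually_le_const (half_pos hδ)).and (Ioo_mem_nhdsGT one_pos)).exists
  -- This ε₀ ensures ε/w² < κ₀ for all w ≥ w₀. It does not depend on v₁, because the integral of the
  -- cut-off 1/w is translation invariant.
  refine ⟨κ₀ * w₀ ^ 2, by have := hw.1; positivity, fun ε hε hεlt v₁ => ?_⟩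
  have hi := h.integrable_boltzmann_sphere hs hf hε v₁
  have hi₀ := (h.integrable_sphereIntegral hs hf v₁).const_mul (f 0 ^ (2 / s))
  have hb : Integrable fun v₂ : E3 => c * (2 * E * cutInv w₀ ‖v₁ - v₂‖ + δ' *
      (cutInv 1 ‖v₁ - v₂‖ + maxwellian v₂ + maxwellian v₂ * ‖v₁ - v₂‖ ^ 3)) :=
    (((integrable_cutInv_sub w₀ v₁).const_mul (2 * E)).add
      ((integrable_weight v₁).const_mul δ')).const_mul c
  have e1 : ∫ v₂ : E3, c * (2 * E * cutInv w₀ ‖v₁ - v₂‖ + δ' *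
      (cutInv 1 ‖v₁ - v₂‖ + maxwellian v₂ + maxwellian v₂ * ‖v₁ - v₂‖ ^ 3)) =
      c * (2 * E * (∫ x : E3, cutInv w₀ ‖x‖) + δ' *
        ∫ v₂ : E3, (cutInv 1 ‖v₁ - v₂‖ + maxwellian v₂ + maxwellian v₂ * ‖v₁ - v₂‖ ^ 3)) := by
    rw [integral_const_mul, integral_add ((integrable_cutInv_sub w₀ v₁).const_mul (2 * E))
      ((integrable_weight v₁).const_mul δ'), integral_const_mul, integral_const_mul,
      integral_cutInv_sub]
  rw [linBoltzmann, nonCutoff, ← integral_const_mul, ← integral_const_mul, ← integral_sub hi hi₀,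
    ← Real.norm_eq_abs]
  refine (norm_integral_le_of_norm_le hb ?_).trans ?_
  · filter_upwards [ae_ne_const v₁] with v₂ hv
    exact h.abs_sphere_sub_le_split hs hf hE hδ'0.le hκ₀ hw.1 hw.2.le hε hεlt hv
  · rw [e1]
    have h1 := mul_le_mul_of_nonneg_left (mul_le_mul_of_nonneg_left (hK v₁) hδ'0.le) hc0
    have hn : 0 ≤ ‖v₁‖ ^ 3 := by positivity
    nlinarith [mul_nonneg hδ.le hn, mul_le_mul_of_nonneg_right hδ'K (show 0 ≤ 1 + ‖v₁‖ ^ 3 by linarith)]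

end Limit

end GrazingLimit

end

theorem theorem2 (s : ℝ) (hs : 1 < s) (f : ℝ → ℝ) (hf : GrazingLimit.IsProfile f) :
    -- the scattering problem for `ε Φ` is well posed for all incoming configurations
    (∀ ε : ℝ, 0 < ε → ∀ (v₁ v₂ : GrazingLimit.E3) (ν : GrazingLimit.S2),
      0 < inner ℝ (v₁ - v₂) (ν : GrazingLimit.E3) →
        ∃! p : GrazingLimit.E3 × GrazingLimit.E3,
          GrazingLimit.IsOutgoing (fun x => ε * GrazingLimit.pairPotential f s x) v₁ v₂ ν p) ∧
    ∀ ψ : GrazingLimit.E3 → ℝ, GrazingLimit.IsC3b ψ →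
      -- the integral that defines the Boltzmann operator of `ε Φ` converges absolutely
      (∀ ε : ℝ, 0 < ε → ∀ v₁ : GrazingLimit.E3,
        MeasureTheory.Integrable
          (fun q : GrazingLimit.E3 × GrazingLimit.S2 =>
            GrazingLimit.boltzmannIntegrand
              (fun x => ε * GrazingLimit.pairPotential f s x) ψ v₁ q.1 q.2)
          (MeasureTheory.volume.prod GrazingLimit.surface)) ∧
      -- the integrals that define the limit operator converge
      (∀ v₁ v₂ : GrazingLimit.E3, v₁ ≠ v₂ →
        MeasureTheory.IntegrableOn (GrazingLimit.angularIntegrand s ψ v₁ v₂)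
          (Set.Ioo 0 Real.pi) MeasureTheory.volume) ∧
      (∀ v₁ : GrazingLimit.E3,
        MeasureTheory.Integrable (GrazingLimit.sphereIntegral s ψ v₁)
          MeasureTheory.volume) ∧
      -- convergence, uniformly in `v₁` with respect to the weight `1 + |v₁|³`
      (∀ δ : ℝ, 0 < δ → ∃ ε₀ : ℝ, 0 < ε₀ ∧ ∀ ε : ℝ, 0 < ε → ε < ε₀ →
        ∀ v₁ : GrazingLimit.E3,
          |1 / ε ^ (2 / s) * GrazingLimit.linBoltzmann
                (fun x => ε * GrazingLimit.pairPotential f s x) ψ v₁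
              - f 0 ^ (2 / s) * GrazingLimit.nonCutoff s ψ v₁|
            ≤ δ * (1 + ‖v₁‖ ^ 3)) := by
  refine ⟨fun ε hε v₁ v₂ ν hν => GrazingLimit.existsUnique_isOutgoing hs hf hε (by simp) hν,
    fun ψ hψ => ?_⟩
  obtain ⟨A, L, h⟩ := hψ.exists_isBoundedC11
  exact ⟨fun ε hε v₁ => h.integrable_boltzmannIntegrand hs hf hε v₁,
    fun v₁ v₂ hv => h.integrableOn_angularIntegrand hs hv,
    fun v₁ => h.integrable_sphereIntegral hs hf v₁, fun δ hδ => h.grazing_limit hs hf hδ⟩
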